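/- Notation. Write $e(z)=e^{2\pi i z}$, $\tau=x+iy$, and $f^{(s)}=(2\pi i)^{-s}\,d^sf/d\tau^s$. For functions of weight $w$ let $R_w=\frac1{2\pi i}\bigl(\frac{\partial}{\partial\tau}+\frac{w}{\tau-\bar\tau}\bigr)$ and $R^r=R_{w+2r-2}\circ\cdots\circ R_w$. For functions $f,g$ of weights $k,l$ let $$[f,g]_r=\sum_{s=0}^r(-1)^s\binom{k+r-1}{s}\binom{l+r-1}{r-s}f^{(r-s)}g^{(s)}.$$ For an even lattice $L$ of signature $(2,b^-)$ and even rank, with bilinear form $(\cdot,\cdot)$ and $x^2=(x,x)$, let $L'$ be the dual lattice and $\rho_L$ the Weil representation of $\mathrm{SL}_2(\mathbb Z)$ on $\mathbb C[L'/L]=\bigoplus_\nu\mathbb C e_\nu$, given by $$\rho_L(T)e_\nu=e(\nu^2/2)e_\nu,\qquad \rho_L(S)e_\nu=i^{b^- /2-1}|L'/L|^{-1/2}\sum_\mu e(-(\mu,\nu))e_\mu,$$ where $T=\begin{pmatrix}1&1\\0&1\end{pmatrix}$ and $S=\begin{pmatrix}0&-1\\1&0\end{pmatrix}$. Let $M^!_w(\rho_L)$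 be the space of functions $f:\mathbb H\to\mathbb C[L'/L]$ that are holomorphic on $\mathbb H$, meromorphic at the cusp, and satisfy $f(\gamma\tau)=(c\tau+d)^w\rho_L(\gamma)f(\tau)$ for all $\gamma=\begin{pmatrix}a&b\\c&d\end{pmatrix}\in\mathrm{SL}_2(\mathbb Z)$; $M^!_w(\mathrm{SL}_2(\mathbb Z))$ is the scalar analogue. For a positive definite plane $v^+\subset L\otimes\mathbb R$ with orthogonal complement $v^-$, put $$\Theta_L(\tau,v^+)=y^{b^- /2}\sum_{l\in L'}e\bigl(\tau l_{v^+}^2/2+\bar\tau l_{v^-}^2/2\bigr)e_{l+L},\qquad \Phi_L(v^+,f)=\int^{\mathrm{reg}}_{\mathrm{SL}_2(\mathbb Z)\backslash\mathbb H}\sum_{\nu}f_\nu\,\overline{\Theta_{L,\nu}}\;y^{-1-b^- /2}\,dx\,dy .$$ The regularized integral is the constant term at $s=0$ of the Laurent expansion of the meromorphic continuation to $s\in\mathbb C$ of $\lim_{t\to\infty}\int_{F_t}(\cdots)\,y^{-s}\,dx\,dy$, $\operatorname{Re}s\gg0$, where $F_t=\{|x|<\frac12,\ |\tau|>1,\ y<t\}$;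 it is defined if the limit exists for $\operatorname{Re}s\gg0$ and has such a continuation. If $L$ has signature $(2,0)$, then $v^+=L\otimes\mathbb R$ is the only choice and one writes $\Phi_L(f)$. Let $k>1$ be an integer and let $\lambda=(\lambda_m)_{m\ge1}$ be a finitely supported sequence of integers that is a relation for $S_{2k}(\mathrm{SL}_2(\mathbb Z))$, i.e. $\sum_m\lambda_ma_m=0$ for every cusp form $\sum_{m\ge1} a_mq^m$ in that space. Let $g_\lambda\in M^!_{2-2k}(\mathrm{SL}_2(\mathbb Z))$ be the corresponding form, $g_\lambda=\sum_m\lambda_mq^{-m}+O(1)$. Let $S_\lambda\subset\mathbb H\times\mathbb H$ be the support of the divisor $\sum_m\lambda_mT_m$, where $T_m$ is the sum of the graphs $\{(\tau_1,\tau_2):\tau_1=\gamma\tau_2\}$ over the integral $2\times2$ matrices $\gamma$ of determinant $m$ modulo $\pm1$. Give $M_2(\mathbb Z)$ the quadratic form $x^2/2=-\det x$, an even unimodular lattice of signature $(2,2)$, so that scalar functions are $\mathbb C[M_2(\mathbb Z)'/M_2(\mathbb Z)]$-valued. For $\tau_1,\tau_2\in\mathbb H$ let $v^+(\tau_1,\tau_2)\subset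 M_2(\mathbb R)$ be the positive definite plane spanned by the real and imaginary parts of $\begin{pmatrix}\tau_1\tau_2&\tau_1\\\tau_2&1\end{pmatrix}$, and let $v^-(\tau_1,\tau_2)$ be its orthogonal complement. Theorem. Let $\tau_1,\tau_2\in\mathbb H$ be CM points lying in the same imaginary quadratic field, with $(\tau_1,\tau_2)\notin S_\lambda$. Put $N=v^+(\tau_1,\tau_2)\cap M_2(\mathbb Z)$ and $M=v^-(\tau_1,\tau_2)\cap M_2(\mathbb Z)$. Then $N$ spans $v^+(\tau_1,\tau_2)$ over $\mathbb R$, so it is an even positive definite lattice of rank $2$. For $\nu\in N'/N$ set $$\vartheta_\nu(\tau)=\sum_{m\in M'\cap(-\nu+M_2(\mathbb Z))}e(-\tau m^2/2),\qquad f_\nu=(-1)^{k-1}\,[\,g_\lambda,\vartheta_\nu\,]_{k-1},$$ the bracket being formed with weights $2-2k$ and $1$. Then $f=(f_\nu)_{\nu\in N'/N}$ belongs to $M^!_1(\rho_N)$, both regularized theta lifts below are defined, and $$\Phi_{M_2(\mathbb Z)}\bigl(v^+(\tau_1,\tau_2),R^{k-1}g_\lambda\bigr)=\Phi_N(f).$$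 -/

import Mathlib

open UpperHalfPlane hiding I
open Complex Filter Topology MeasureTheory
open scoped MatrixGroups ModularForm Manifold

noncomputable section

namespace CMGreen

/-- `e(z) = exp(2πiz)`. -/
def e (z : ℂ) : ℂ := Complex.exp (2 * Real.pi * I * z)

/-! ### Differential operators and Rankin–Cohen brackets -/

/-- The Wirtinger derivative `∂/∂τ = (∂/∂x - i ∂/∂y) / 2` of a function on the upper half plane. -/
def dTau (F : ℍ → ℂ) (τ : ℍ) : ℂ :=
  (fderiv ℝ (F ∘ ofComplex) (τ : ℂ) 1 - I * fderiv ℝ (F ∘ ofComplex) (τ : ℂ) I) / 2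

/-- The raising operator `R_w = (2πi)⁻¹ (∂/∂τ + w / (τ - τ̄))` in weight `w`. -/
def raise (w : ℤ) (F : ℍ → ℂ) (τ : ℍ) : ℂ :=
  (2 * Real.pi * I)⁻¹ * (dTau F τ + w / ((τ : ℂ) - (starRingEnd ℂ) (τ : ℂ)) * F τ)

/-- `R^r F = R_{w+2r-2} ∘ ⋯ ∘ R_{w+2} ∘ R_w F` for `F` of weight `w`. -/
def raiseIter (w : ℤ) : ℕ → (ℍ → ℂ) → ℍ → ℂ
  | 0, F => F
  | r + 1, F => raise (w + 2 * r) (raiseIter w r F)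

/-- The Rankin–Cohen bracket of functions `F`, `G` of weights `k`, `l`:
`[F,G]_r = ∑_{s=0}^r (-1)^s C(k+r-1, s) C(l+r-1, r-s) F^{(r-s)} G^{(s)}`, where
`F^{(s)} = (2πi)^{-s} d^s F / dτ^s` and `C` is the generalized binomial coefficient. -/
def rankinCohen (k l : ℤ) (r : ℕ) (F G : ℍ → ℂ) (τ : ℍ) : ℂ :=
  ∑ s ∈ Finset.range (r + 1), (-1 : ℂ) ^ s * (Ring.choose (k + r - 1) s : ℤ) *
    (Ring.choose (l + r - 1) (r - s) : ℤ) *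
    (Derivative.normalizedDerivOfComplex^[r - s] F τ) *
    (Derivative.normalizedDerivOfComplex^[s] G τ)

/-! ### Relations and weakly holomorphic forms for `SL₂(ℤ)` -/

/-- Growth condition "meromorphic at the cusp": `F(τ) = O(exp(2πn Im τ))` for some `n`. -/
def IsMeromorphicAtCusp (F : ℍ → ℂ) : Prop :=
  ∃ n : ℕ, IsBoundedAtImInfty fun τ : ℍ => e (n * (τ : ℂ)) * F τ

/-- The space `M^!_w(SL₂(ℤ))`: holomorphic on the upper half plane, modular of weight `w` for the
full modular group, and meromorphic at the cusp. -/
structure IsWeaklyHolomorphicForm (w : ℤ) (g : ℍ → ℂ) : Prop where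
  holo : MDiff g
  slash : ∀ γ : SL(2, ℤ), g ∣[w] γ = g
  mero : IsMeromorphicAtCusp g

/-- A finitely supported integral sequence `(λ_m)_{m ≥ 1}` is a relation for `S_{2k}(SL₂(ℤ))` if
`∑ λ_m a_m = 0` for every cusp form `∑ a_m q^m` of weight `2k`. -/
def IsRelation (k : ℕ) (lam : ℕ+ →₀ ℤ) : Prop :=
  ∀ f : CuspForm 𝒮ℒ (2 * k),
    (lam.sum fun m c => (c : ℂ) * (qExpansion 1 f).coeff (m : ℕ)) = 0

/-- `g = g_λ`: the form in `M^!_{2-2k}(SL₂(ℤ))` with `g = ∑ λ_m q^{-m} + O(1)` at the cusp. -/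
structure IsAssociatedForm (k : ℕ) (lam : ℕ+ →₀ ℤ) (g : ℍ → ℂ) : Prop where
  form : IsWeaklyHolomorphicForm (2 - 2 * (k : ℤ)) g
  principal : IsBoundedAtImInfty fun τ : ℍ =>
    g τ - lam.sum fun m c => (c : ℂ) * e (-((m : ℕ) : ℂ) * (τ : ℂ))

/-- The multiplicity in `D_λ = ∑ λ_m T_m` of the graph of a primitive integral matrix of determinant
`n`. Here `T_m` is the sum of the graphs of all integral matrices of determinant `m` (up to sign);
that graph occurs in `T_m`, with multiplicity one, exactly when `m = d² n` for some `d`. -/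
def divisorMultiplicity (lam : ℕ+ →₀ ℤ) (n : ℤ) : ℤ :=
  open Classical in
  ∑ m ∈ lam.support.filter fun m : ℕ+ => ∃ d : ℕ, ((m : ℕ) : ℤ) = (d : ℤ) ^ 2 * n, lam m

/-- The singular locus `S_λ`: the support of the divisor `D_λ = ∑ λ_m T_m` on `ℍ × ℍ`, i.e. the
union of the graphs `τ₁ = (aτ₂ + b) / (cτ₂ + d)` of primitive integral matrices of positive
determinant that have nonzero multiplicity in `D_λ`. -/
def singularLocus (lam : ℕ+ →₀ ℤ) : Set (ℍ × ℍ) :=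
  {p | ∃ a b c d : ℤ, 0 < a * d - b * c ∧ (∀ r : ℤ, r ∣ a → r ∣ b → r ∣ c → r ∣ d → IsUnit r) ∧
    divisorMultiplicity lam (a * d - b * c) ≠ 0 ∧
    (p.1 : ℂ) = (a * (p.2 : ℂ) + b) / (c * (p.2 : ℂ) + d)}

/-! ### Lattices, discriminant groups and the Weil representation -/

section Lattice

variable {V : Type*} [AddCommGroup V] [Module ℝ V]

/-- The dual lattice `L' = {x ∈ L ⊗ ℝ | (x, L) ⊆ ℤ}` of a lattice `L` in a real quadratic space;
`L` need not have full rank, `L ⊗ ℝ` being its real span. -/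
def dualLattice (B : LinearMap.BilinForm ℝ V) (L : Submodule ℤ V) : Submodule ℤ V :=
  B.dualSubmodule L ⊓ (Submodule.span ℝ (L : Set V)).restrictScalars ℤ

/-- The discriminant group `L'/L` (for an even, hence integral, lattice, `L ⊆ L'`). -/
abbrev DiscGroup (B : LinearMap.BilinForm ℝ V) (L : Submodule ℤ V) : Type _ :=
  dualLattice B L ⧸ L.comap (dualLattice B L).subtype

/-- The number `b⁻` for a lattice of signature `(2, b⁻)`. -/
def negRank (L : Submodule ℤ V) : ℝ :=
  (Module.finrank ℝ (Submodule.span ℝ (L : Set V)) : ℝ) - 2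

/-- `ρ_L(T)`: `e_ν ↦ e((ν,ν)/2) e_ν`, on elements `∑ φ_ν e_ν` of `ℂ[L'/L]`. For an even lattice the
choice of the representative `ν.out` of `ν` does not matter. -/
def weilT (B : LinearMap.BilinForm ℝ V) (L : Submodule ℤ V) :
    Function.End (DiscGroup B L → ℂ) :=
  fun φ ν => e ((B (ν.out : V) (ν.out : V) : ℂ) / 2) * φ ν

/-- `ρ_L(S)`: `e_ν ↦ i^{b⁻/2 - b⁺/2} |L'/L|^{-1/2} ∑_μ e(-(μ,ν)) e_μ` with `b⁺ = 2`, on elements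
`∑ φ_ν e_ν` of `ℂ[L'/L]`. -/
def weilS (B : LinearMap.BilinForm ℝ V) (L : Submodule ℤ V) :
    Function.End (DiscGroup B L → ℂ) :=
  fun φ μ => e (((negRank L - 2) / 8 : ℝ)) * ((Nat.card (DiscGroup B L) : ℝ) ^ (-(1 / 2) : ℝ) : ℝ) *
    ∑ᶠ ν : DiscGroup B L, e (-(B (μ.out : V) (ν.out : V) : ℂ)) * φ ν

/-- The graph of the Weil representation `γ ↦ ρ_L(γ)` of `SL₂(ℤ)` on `ℂ[L'/L]` for an even lattice
of signature `(2, b⁻)` and even rank: it is generated by `(T, ρ_L(T))` and `(S, ρ_L(S))`. -/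
def weilGraph (B : LinearMap.BilinForm ℝ V) (L : Submodule ℤ V) :
    Submonoid (SL(2, ℤ) × Function.End (DiscGroup B L → ℂ)) :=
  Submonoid.closure {(ModularGroup.T, weilT B L), (ModularGroup.S, weilS B L)}

/-- The space `M^!_w(SL₂(ℤ), ρ_L)` of vector valued weakly holomorphic modular forms of integral
weight `w`: `f((aτ+b)/(cτ+d)) = (cτ+d)^w ρ_L(γ) f(τ)`, with components that are holomorphic on the
upper half plane and meromorphic at the cusp. -/
structure IsWeaklyHolomorphicVector (B : LinearMap.BilinForm ℝ V) (L : Submodule ℤ V) (w : ℤ)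
    (f : DiscGroup B L → ℍ → ℂ) : Prop where
  holo : ∀ ν, MDiff (f ν)
  transform : ∀ p ∈ weilGraph B L, ∀ (τ : ℍ) (ν : DiscGroup B L),
    f ν (p.1 • τ) = denom p.1 τ ^ w * p.2 (fun μ => f μ τ) ν
  mero : ∀ ν, IsMeromorphicAtCusp (f ν)

/-! ### Siegel theta functions and the regularized theta lift -/

/-- Positive definite two-dimensional subspaces `v⁺`. Those contained in `L ⊗ ℝ` are the points of
the Grassmannian `G(L)` of a lattice `L` of signature `(2, b⁻)`. -/
structure PosPlane (B : LinearMap.BilinForm ℝ V) where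
  carrier : Submodule ℝ V
  finrank_eq : Module.finrank ℝ carrier = 2
  pos : ∀ x ∈ carrier, x ≠ 0 → 0 < B x x

theorem PosPlane.isCompl [FiniteDimensional ℝ V] {B : LinearMap.BilinForm ℝ V} (hB : B.IsSymm)
    (v : PosPlane B) : IsCompl v.carrier (B.orthogonal v.carrier) := by
  have hd : Disjoint v.carrier (B.orthogonal v.carrier) := by
    rw [Submodule.disjoint_def]
    intro x hx hx'
    by_contra h
    exact (v.pos x hx h).ne' (hx' x hx)
  exact LinearMap.BilinForm.isCompl_orthogonal_of_restrict_nondegenerate hB.isRefl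
    (B.nondegenerate_restrict_of_disjoint_orthogonal hB.isRefl hd)

/-- The projection `x ↦ x_{v⁺}` onto `v⁺`, along the orthogonal complement `v⁻`. -/
def PosPlane.projPos [FiniteDimensional ℝ V] {B : LinearMap.BilinForm ℝ V} (hB : B.IsSymm)
    (v : PosPlane B) (x : V) : V :=
  v.carrier.projection (B.orthogonal v.carrier) (v.isCompl hB) x

/-- The projection `x ↦ x_{v⁻} = x - x_{v⁺}` onto the orthogonal complement `v⁻` of `v⁺`. -/
def PosPlane.projNeg [FiniteDimensional ℝ V] {B : LinearMap.BilinForm ℝ V} (hB : B.IsSymm)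
    (v : PosPlane B) (x : V) : V :=
  x - v.projPos hB x

/-- The component at `ν ∈ L'/L` of the Siegel theta function
`Θ_L(τ, v⁺) = y^{b⁻/2} ∑_{l ∈ L'} e(τ l_{v⁺}²/2 + τ̄ l_{v⁻}²/2) e_{l+L}`. -/
def siegelTheta [FiniteDimensional ℝ V] {B : LinearMap.BilinForm ℝ V} (hB : B.IsSymm)
    (L : Submodule ℤ V) (v : PosPlane B) (τ : ℍ) (ν : DiscGroup B L) : ℂ :=
  ((τ.im ^ (negRank L / 2) : ℝ) : ℂ) *
    ∑' l : {l : dualLattice B L // (Submodule.Quotient.mk l : DiscGroup B L) = ν},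
      e ((τ : ℂ) * (B (v.projPos hB (l.1 : V)) (v.projPos hB (l.1 : V)) : ℂ) / 2 +
        (starRingEnd ℂ) (τ : ℂ) *
          (B (v.projNeg hB (l.1 : V)) (v.projNeg hB (l.1 : V)) : ℂ) / 2)

/-- The integrand `⟨f(τ), conj Θ_L(τ, v⁺)⟩ y^{-1-b⁻/2}` of the theta lift, where
`⟨f, conj Θ⟩ = ∑_ν f_ν conj Θ_ν`. -/
def thetaIntegrand [FiniteDimensional ℝ V] {B : LinearMap.BilinForm ℝ V} (hB : B.IsSymm)
    (L : Submodule ℤ V) (v : PosPlane B) (f : DiscGroup B L → ℍ → ℂ) (τ : ℍ) : ℂ :=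
  (∑ᶠ ν : DiscGroup B L, f ν τ * (starRingEnd ℂ) (siegelTheta hB L v τ ν)) *
    ((τ.im ^ (-1 - negRank L / 2) : ℝ) : ℂ)

end Lattice

/-- The truncated fundamental domain `F_t = {|Re τ| < 1/2, |τ| > 1, 0 < Im τ < t}`. -/
def truncatedDomain (t : ℝ) : Set ℂ :=
  {z | -(1 / 2) < z.re ∧ z.re < 1 / 2 ∧ 1 < ‖z‖ ∧ 0 < z.im ∧ z.im < t}

/-- `c` is the constant term of the Laurent expansion at `0` of the meromorphic function `G`: for
some principal part `P(1/s)`, `P` a polynomial with `P(0) = 0`, one has `G(s) - P(1/s) → c`. -/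
def IsLaurentConstantTerm (G : ℂ → ℂ) (c : ℂ) : Prop :=
  ∃ P : Polynomial ℂ, P.coeff 0 = 0 ∧ Tendsto (fun s => G s - P.eval s⁻¹) (𝓝[≠] 0) (𝓝 c)

/-- The regularized integral over `SL₂(ℤ)\ℍ` of `F(τ) dx dy` exists and equals `c`: for `Re s ≫ 0`
the limit as `t → ∞` of the integrals over `F_t` of `F(τ) y^{-s} dx dy` exists, it continues to a
meromorphic function of `s ∈ ℂ`, and `c` is the constant term of that function at `s = 0`. -/
def HasRegIntegral (F : ℍ → ℂ) (c : ℂ) : Prop :=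
  ∃ G : ℂ → ℂ, MeromorphicOn G Set.univ ∧
    (∃ σ : ℝ, ∀ s : ℂ, σ < s.re →
      (∀ t : ℝ, IntegrableOn (fun z : ℂ => F (ofComplex z) * (z.im : ℂ) ^ (-s))
        (truncatedDomain t)) ∧
      Tendsto (fun t : ℝ => ∫ z in truncatedDomain t, F (ofComplex z) * (z.im : ℂ) ^ (-s))
        atTop (𝓝 (G s))) ∧
    IsLaurentConstantTerm G c

theorem HasRegIntegral.unique {F : ℍ → ℂ} {c c' : ℂ} (h : HasRegIntegral F c)
    (h' : HasRegIntegral F c') : c = c' := by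
  obtain ⟨G, hG, ⟨σ, hσ⟩, P, hP, hc⟩ := h
  obtain ⟨G', hG', ⟨σ', hσ'⟩, P', hP', hc'⟩ := h'
  have hs : ∀ s : ℂ, max σ σ' < s.re → (G - G') s = 0 := fun s hs =>
    sub_eq_zero.2 (tendsto_nhds_unique (hσ s ((le_max_left _ _).trans_lt hs)).2
      (hσ' s ((le_max_right _ _).trans_lt hs)).2)
  have hmer : MeromorphicOn (G - G') Set.univ := hG.sub hG'
  have h0 : meromorphicOrderAt (G - G') 0 = ⊤ := by
    by_contra hne
    refine hmer.meromorphicOrderAt_ne_top_of_isPreconnected (y := ((max σ σ' + 1 : ℝ) : ℂ))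
      isPreconnected_univ (Set.mem_univ 0) (Set.mem_univ _) hne ?_
    rw [meromorphicOrderAt_eq_top_iff]
    have hopen : IsOpen {s : ℂ | max σ σ' < s.re} := isOpen_lt continuous_const continuous_re
    refine Filter.Eventually.filter_mono nhdsWithin_le_nhds ?_
    filter_upwards [hopen.mem_nhds (show max σ σ' < (((max σ σ' + 1 : ℝ) : ℂ)).re by simp)]
      with s hs' using hs s hs'
  rw [meromorphicOrderAt_eq_top_iff] at h0
  have hlim : Tendsto (fun s : ℂ => (P' - P).eval s⁻¹) (𝓝[≠] 0) (𝓝 (c - c')) := by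
    refine (hc.sub hc').congr' ?_
    filter_upwards [h0] with s hs'
    have : G s - G' s = 0 := hs'
    simp only [Polynomial.eval_sub]
    linear_combination this
  have hdeg : ¬ 0 < (P' - P).degree := by
    intro hd
    have hinv : Tendsto (fun s : ℂ => ‖s⁻¹‖) (𝓝[≠] 0) atTop :=
      tendsto_norm_cobounded_atTop.comp (tendsto_inv₀_nhdsNE_zero)
    exact not_tendsto_atTop_of_tendsto_nhds hlim.norm
      (Polynomial.tendsto_norm_atTop _ hd hinv)
  have hz : P' - P = 0 := by
    rw [Polynomial.eq_C_of_degree_le_zero (not_lt.1 hdeg)]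
    simp [hP, hP']
  rw [hz] at hlim
  simp only [Polynomial.eval_zero] at hlim
  exact sub_eq_zero.1 (tendsto_nhds_unique hlim tendsto_const_nhds)

/-- The regularized integral is defined. -/
def RegIntegrable (F : ℍ → ℂ) : Prop := ∃ c, HasRegIntegral F c

open Classical in
/-- The value of the regularized integral (`0` if it is not defined). -/
def regIntegral (F : ℍ → ℂ) : ℂ := if h : RegIntegrable F then h.choose else 0

theorem HasRegIntegral.regIntegral_eq {F : ℍ → ℂ} {c : ℂ} (h : HasRegIntegral F c) :
    regIntegral F = c := by
  have h' : RegIntegrable F := ⟨c, h⟩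
  rw [regIntegral, dif_pos h']
  exact h'.choose_spec.unique h

section Lift

variable {V : Type*} [AddCommGroup V] [Module ℝ V] [FiniteDimensional ℝ V]

/-- The regularized theta lift `Φ_L(v⁺, f)` is defined. -/
def ThetaLiftDefined {B : LinearMap.BilinForm ℝ V} (hB : B.IsSymm) (L : Submodule ℤ V)
    (v : PosPlane B) (f : DiscGroup B L → ℍ → ℂ) : Prop :=
  RegIntegrable (thetaIntegrand hB L v f)

/-- The regularized theta lift `Φ_L(v⁺, f)`, the regularized integral over `SL₂(ℤ)\ℍ` of
`⟨f, conj Θ_L(τ, v⁺)⟩ y^{-1-b⁻/2} dx dy`. -/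
def thetaLift {B : LinearMap.BilinForm ℝ V} (hB : B.IsSymm) (L : Submodule ℤ V)
    (v : PosPlane B) (f : DiscGroup B L → ℍ → ℂ) : ℂ :=
  regIntegral (thetaIntegrand hB L v f)

/-- For a lattice `L` with sublattices `N` and `M` that are the intersections of `L` with a rational
subspace and its orthogonal complement, `M` negative definite: the theta function
`ϑ_ν(τ) = ∑_{m ∈ M' ∩ (-ν + L)} e(-τ m²/2)` for `ν ∈ N'/N`. -/
def complTheta (B : LinearMap.BilinForm ℝ V) (L N M : Submodule ℤ V) (ν : DiscGroup B N)
    (τ : ℍ) : ℂ :=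
  ∑' m : {m : dualLattice B M // ∃ x : dualLattice B N,
      (Submodule.Quotient.mk x : DiscGroup B N) = ν ∧ (m : V) + (x : V) ∈ L},
    e (-((τ : ℂ) * (B (m.1 : V) (m.1 : V) : ℂ) / 2))

end Lift

/-! ### The lattice `M₂(ℤ)` with the quadratic form `-det` -/

/-- The bilinear form on `M₂(ℝ)` with `(x,x)/2 = -det x`. -/
def detForm : LinearMap.BilinForm ℝ (Matrix (Fin 2) (Fin 2) ℝ) :=
  LinearMap.mk₂ ℝ (fun x y => x 0 1 * y 1 0 + x 1 0 * y 0 1 - x 0 0 * y 1 1 - x 1 1 * y 0 0)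
    (by intros; simp only [Matrix.add_apply]; ring)
    (by intros; simp only [Matrix.smul_apply, smul_eq_mul]; ring)
    (by intros; simp only [Matrix.add_apply]; ring)
    (by intros; simp only [Matrix.smul_apply, smul_eq_mul]; ring)

theorem detForm_apply (x y : Matrix (Fin 2) (Fin 2) ℝ) :
    detForm x y = x 0 1 * y 1 0 + x 1 0 * y 0 1 - x 0 0 * y 1 1 - x 1 1 * y 0 0 := rfl

theorem detForm_self (x : Matrix (Fin 2) (Fin 2) ℝ) : detForm x x / 2 = -x.det := by
  rw [detForm_apply, Matrix.det_fin_two]; ring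

theorem detForm_isSymm : detForm.IsSymm :=
  ⟨fun x y => by simp only [detForm_apply]; ring⟩

/-- The lattice `M₂(ℤ)` inside `M₂(ℝ)`. -/
def matLattice : Submodule ℤ (Matrix (Fin 2) (Fin 2) ℝ) where
  carrier := {x | ∀ i j, ∃ n : ℤ, x i j = n}
  zero_mem' := fun _ _ => ⟨0, by simp⟩
  add_mem' := by
    intro x y hx hy i j
    obtain ⟨m, hm⟩ := hx i j
    obtain ⟨n, hn⟩ := hy i j
    exact ⟨m + n, by simp [hm, hn]⟩
  smul_mem' := by
    intro c x hx i j
    obtain ⟨m, hm⟩ := hx i j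
    exact ⟨c * m, by simp [hm]⟩

/-- The isotropic vector `Z = (τ₁τ₂, τ₁; τ₂, 1)`. -/
def Zmat (τ₁ τ₂ : ℍ) : Matrix (Fin 2) (Fin 2) ℂ :=
  !![(τ₁ : ℂ) * (τ₂ : ℂ), (τ₁ : ℂ); (τ₂ : ℂ), 1]

/-- `X = Re Z`. -/
def Xmat (τ₁ τ₂ : ℍ) : Matrix (Fin 2) (Fin 2) ℝ := (Zmat τ₁ τ₂).map Complex.re

/-- `Y = Im Z`. -/
def Ymat (τ₁ τ₂ : ℍ) : Matrix (Fin 2) (Fin 2) ℝ := (Zmat τ₁ τ₂).map Complex.im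

theorem detForm_combination (τ₁ τ₂ : ℍ) (a b : ℝ) :
    detForm (a • Xmat τ₁ τ₂ + b • Ymat τ₁ τ₂) (a • Xmat τ₁ τ₂ + b • Ymat τ₁ τ₂) =
      2 * τ₁.im * τ₂.im * (a ^ 2 + b ^ 2) := by
  simp [detForm_apply, Xmat, Ymat, Zmat]
  ring

theorem combination_pos (τ₁ τ₂ : ℍ) {a b : ℝ} (h : ¬(a = 0 ∧ b = 0)) :
    0 < 2 * τ₁.im * τ₂.im * (a ^ 2 + b ^ 2) := by
  have h1 := τ₁.im_pos
  have h2 := τ₂.im_pos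
  have : 0 < a ^ 2 + b ^ 2 := by
    by_contra hn
    exact h ⟨by nlinarith [sq_nonneg a, sq_nonneg b], by nlinarith [sq_nonneg a, sq_nonneg b]⟩
  positivity

/-- The point `v⁺(τ₁, τ₂) = ℝ Re Z + ℝ Im Z` of the Grassmannian of `M₂(ℤ)`. -/
def vPlus (τ₁ τ₂ : ℍ) : PosPlane detForm where
  carrier := Submodule.span ℝ {Xmat τ₁ τ₂, Ymat τ₁ τ₂}
  finrank_eq := by
    have hli : LinearIndependent ℝ ![Xmat τ₁ τ₂, Ymat τ₁ τ₂] := by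
      rw [LinearIndependent.pair_iff]
      intro a b hab
      by_contra h
      have := combination_pos τ₁ τ₂ h
      rw [← detForm_combination, hab] at this
      simp at this
    have := finrank_span_eq_card hli
    rwa [Matrix.range_cons_cons_empty, Fintype.card_fin] at this
  pos := by
    intro x hx hx0
    obtain ⟨a, b, rfl⟩ := Submodule.mem_span_pair.1 hx
    rw [detForm_combination]
    refine combination_pos τ₁ τ₂ ?_
    rintro ⟨rfl, rfl⟩
    simp at hx0

/-- The lattice `N = v⁺(τ₁, τ₂) ∩ M₂(ℤ)`. -/
def latticeN (τ₁ τ₂ : ℍ) : Submodule ℤ (Matrix (Fin 2) (Fin 2) ℝ) :=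
  (vPlus τ₁ τ₂).carrier.restrictScalars ℤ ⊓ matLattice

/-- The lattice `M = v⁻(τ₁, τ₂) ∩ M₂(ℤ)`. -/
def latticeM (τ₁ τ₂ : ℍ) : Submodule ℤ (Matrix (Fin 2) (Fin 2) ℝ) :=
  (detForm.orthogonal (vPlus τ₁ τ₂).carrier).restrictScalars ℤ ⊓ matLattice

/-- The vector valued function `f = (f_ν)_{ν ∈ N'/N}`, `f_ν = (-1)^{k-1} [g, ϑ_ν]_{k-1}`, where `g`
has weight `2 - 2k` and the theta functions `ϑ_ν` have weight `1`. -/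
def bracketForm (k : ℕ) (g : ℍ → ℂ) (τ₁ τ₂ : ℍ) (ν : DiscGroup detForm (latticeN τ₁ τ₂))
    (τ : ℍ) : ℂ :=
  (-1) ^ (k - 1) * rankinCohen (2 - 2 * (k : ℤ)) 1 (k - 1) g
    (complTheta detForm matLattice (latticeN τ₁ τ₂) (latticeM τ₁ τ₂) ν) τ

/-- A scalar function, viewed as a `ℂ[L'/L]`-valued function for the unimodular lattice
`L = M₂(ℤ)`, whose discriminant group has one element. -/
def scalarVector (h : ℍ → ℂ) : DiscGroup detForm matLattice → ℍ → ℂ := fun _ => h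

end CMGreen

end

open UpperHalfPlane hiding I
open Complex Filter Topology MeasureTheory
open scoped MatrixGroups ModularForm Manifold

noncomputable section

namespace CMGreen

/-! ### The exponential `e` -/

/-! Write $r=k-1$ and let $\theta_\nu$ be the theta function of the coset $\nu$ of $N$ in $N'$. At
CM points of one imaginary quadratic field both $v^+$ and $v^-$ are spanned by integral matrices
(`isRationalPlane_vPlus`), so $N$ and $M$ have rank two. Since $M_2(\mathbb Z)$ is unimodular, each
coset of $N$ in $N'$ is glued to exactly one coset of $M$ in $M'$, and
$\overline{\Theta_L}=y\sum_\nu\overline{\theta_\nu}\,\vartheta_\nu$ (`conj_siegelTheta_matLattice`).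
The two integrands become $y^{-1}\sum_\nu (R^rg)\,\vartheta_\nu\,\overline{\theta_\nu}$ and
$y^{-1}\sum_\nu(-1)^r[g,\vartheta_\nu]_r\,\overline{\theta_\nu}$.

They differ by a total derivative. A Rankin–Cohen bracket does not change when derivatives are
replaced by raising operators (`rankinCohen_eq_raise`), and in weights $-2r$ and $1$ the function
$(-1)^r[g,\vartheta]_r$ is $(R^rg)\vartheta$ plus a combination of sums
$R^{r-i}g\,R^i\vartheta+R^{r-i-1}g\,R^{i+1}\vartheta$ (`exists_bracketSum_eq`). After multiplication
by $y^{-1}\overline{\theta_\nu}$ and summation over $\nu$, such a sum is $(2\pi i)^{-1}\partial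
u/\partial\tau$ with $u=y^{-1}\sum_\nu R^{r-i-1}g\,R^i\vartheta_\nu\,\overline{\theta_\nu}$
(`dTau_thetaPairing`). The form $u\,d\bar\tau$ is invariant under $T$ and $S$; for $S$ this rests on
Poisson summation and on the unitarity of the finite Fourier transform. Stokes' theorem on $F_t$
therefore leaves only the integral of $u$ at height $t$ (`integral_dTau_truncatedDomain`).

At the cusp all these functions have horizontal means that are polynomials in $1/y$ without constant
term, up to rapid decay (`HasCuspExpansion`); the poles of $g$ in $q$ do no harm, because the mean
of $q^{-n}H\overline{\Theta}$ over a small circle converges (`circleAverage_mul_conj`). Hence the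
boundary term tends to zero. A Mellin transform continues the integral in $s$ with at most a simple
pole at $0$ (`HasCuspExpansion.exists_regularization`), so both lifts are defined, and the exact
terms have regularized integral zero (`HasCuspExpansion.hasRegIntegral_zero`).

That $f$ transforms under the Weil representation follows from the equivariance of raising operators
and the transformation of $\vartheta_\nu$ under the two generators (`rankinCohen_negInv`,
`weilGraph_transform`). -/

theorem e_add (z w : ℂ) : e (z + w) = e z * e w := by
  simp only [e, mul_add, Complex.exp_add]

theorem e_zero : e 0 = 1 := by simp [e]

theorem e_ne_zero (z : ℂ) : e z ≠ 0 := Complex.exp_ne_zero _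

theorem e_int (n : ℤ) : e n = 1 := by
  rw [e, Complex.exp_eq_one_iff]; exact ⟨n, by ring⟩

theorem e_add_int (z : ℂ) (n : ℤ) : e (z + n) = e z := by rw [e_add, e_int, mul_one]

theorem norm_e (z : ℂ) : ‖e z‖ = Real.exp (-(2 * Real.pi * z.im)) := by
  rw [e, Complex.norm_exp]
  congr 1
  simp

theorem conj_e (z : ℂ) : (starRingEnd ℂ) (e z) = e (-(starRingEnd ℂ) z) := by
  rw [e, e, ← Complex.exp_conj]
  congr 1
  simp [Complex.conj_ofNat]

theorem e_eq_one_iff {x : ℝ} : e (x : ℂ) = 1 ↔ ∃ n : ℤ, x = n := by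
  rw [e, Complex.exp_eq_one_iff]
  have h : (2 * Real.pi * I : ℂ) ≠ 0 := by simp [Real.pi_ne_zero]
  constructor
  · rintro ⟨n, hn⟩
    refine ⟨n, ?_⟩
    have : (x : ℂ) = n := mul_left_cancel₀ h (by linear_combination hn)
    exact_mod_cast this
  · rintro ⟨n, rfl⟩
    exact ⟨n, by push_cast; ring⟩

theorem differentiable_e : Differentiable ℂ e := by
  unfold e; fun_prop

/-! ### Exponential sums `∑ e(τ w_i)` -/

/-- The exponents `w_i ≥ 0` tend to infinity fast enough for `∑ exp(-ε w_i)` to converge. -/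
structure SummableExponents {ι : Type*} (w : ι → ℝ) : Prop where
  nonneg : ∀ i, 0 ≤ w i
  summable : ∀ ε : ℝ, 0 < ε → Summable fun i => Real.exp (-(ε * w i))

theorem SummableExponents.comp_injective {ι κ : Type*} {w : ι → ℝ} (h : SummableExponents w)
    {f : κ → ι} (hf : Function.Injective f) : SummableExponents (w ∘ f) :=
  ⟨fun _ => h.nonneg _, fun ε hε => (h.summable ε hε).comp_injective hf⟩

theorem norm_e_mul_ofReal (z : ℂ) (w : ℝ) :
    ‖e (z * w)‖ = Real.exp (-(2 * Real.pi * z.im * w)) := by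
  rw [norm_e]; simp [mul_assoc]

theorem SummableExponents.summable_norm {ι : Type*} {w : ι → ℝ} (h : SummableExponents w)
    (τ : ℍ) : Summable fun i => ‖e ((τ : ℂ) * w i)‖ := by
  simp only [norm_e_mul_ofReal]
  exact h.summable _ (by have := τ.im_pos; simp only [coe_im]; positivity)

theorem SummableExponents.mdiff {ι : Type*} {w : ι → ℝ} (h : SummableExponents w) :
    MDiff (fun τ : ℍ => ∑' i, e ((τ : ℂ) * w i)) := by
  rw [UpperHalfPlane.mdifferentiable_iff]
  have key : ∀ ε : ℝ, 0 < ε →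
      DifferentiableOn ℂ (fun z : ℂ => ∑' i, e (z * w i)) {z | ε < z.im} := by
    intro ε hε
    refine differentiableOn_tsum_of_summable_norm (h.summable (2 * Real.pi * ε) (by positivity))
      (fun _ => ?_) (isOpen_lt continuous_const Complex.continuous_im) ?_
    · exact (differentiable_e.comp (differentiable_id.mul_const _)).differentiableOn
    · intro i z hz
      rw [norm_e_mul_ofReal]
      apply Real.exp_le_exp.2
      have := h.nonneg i
      have hz' : ε ≤ z.im := le_of_lt hz
      have := Real.pi_pos
      rw [neg_le_neg_iff]
      gcongr
  intro z hz
  have hz' : 0 < z.im := hz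
  have h1 : DifferentiableAt ℂ (fun z : ℂ => ∑' i, e (z * w i)) z :=
    (key (z.im / 2) (by positivity)).differentiableAt
      ((isOpen_lt continuous_const Complex.continuous_im).mem_nhds (half_lt_self hz'))
  refine (h1.congr_of_eventuallyEq ?_).differentiableWithinAt
  filter_upwards [isOpen_upperHalfPlaneSet.mem_nhds hz] with x hx
  simp [ofComplex_apply_of_im_pos hx]

/-- If all exponents are at least `α`, the sum is `O(|e(ατ)|)` at the cusp. -/
theorem SummableExponents.isBoundedAtImInfty {ι : Type*} {w : ι → ℝ} (h : SummableExponents w)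
    {α : ℝ} (hα : ∀ i, α ≤ w i) :
    IsBoundedAtImInfty fun τ : ℍ => e (-α * (τ : ℂ)) * ∑' i, e ((τ : ℂ) * w i) := by
  rw [UpperHalfPlane.isBoundedAtImInfty_iff]
  refine ⟨∑' i, Real.exp (-(2 * Real.pi * (w i - α))), 1, fun τ hτ => ?_⟩
  have hs : Summable fun i => Real.exp (-(2 * Real.pi * (w i - α))) := by
    have := (h.summable (2 * Real.pi) (by positivity)).mul_left (Real.exp (2 * Real.pi * α))
    refine this.congr fun i => ?_
    rw [← Real.exp_add]; ring_nf
  rw [← tsum_mul_left]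
  refine tsum_of_norm_bounded hs.hasSum fun i => ?_
  rw [← e_add, norm_e]
  apply Real.exp_le_exp.2
  have h1 := hα i
  have h2 : (-(α : ℂ) * (τ : ℂ) + (τ : ℂ) * (w i : ℂ)).im = τ.im * (w i - α) := by
    simp; ring
  rw [h2, neg_le_neg_iff]
  have := Real.pi_pos
  have : 0 ≤ w i - α := by linarith
  nlinarith [mul_nonneg this (sub_nonneg.2 hτ), mul_nonneg (mul_nonneg this (sub_nonneg.2 hτ)) Real.pi_pos.le]

/-! ### Gaussian sums over `ℤ²` -/

theorem summable_exp_neg_sq {c : ℝ} (hc : 0 < c) :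
    Summable fun n : ℤ => Real.exp (-(c * (n : ℝ) ^ 2)) := by
  have := summable_pow_mul_jacobiTheta₂_term_bound 0 (T := c / Real.pi) (by positivity) 0
  refine this.congr fun n => ?_
  simp only [pow_zero, one_mul]
  congr 1
  field_simp
  ring

/-- The binary quadratic form `a (u + tv)² + d v²`. -/
def binForm (a t d u v : ℝ) : ℝ := a * (u + t * v) ^ 2 + d * v ^ 2

theorem binForm_lower {a t d : ℝ} (ha : 0 < a) (hd : 0 < d) :
    ∃ c > 0, ∀ u v, c * (u ^ 2 + v ^ 2) ≤ binForm a t d u v := by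
  -- From $u^2\le 2(u+tv)^2+2t^2v^2$; each of $a(u+tv)^2$ and $dv^2$ is at most the form.
  refine ⟨(2 / a + (2 * t ^ 2 + 1) / d)⁻¹, by positivity, fun u v => ?_⟩
  rw [inv_mul_le_iff₀ (by positivity), binForm]
  have h1 : (2 / a + (2 * t ^ 2 + 1) / d) * (a * (u + t * v) ^ 2 + d * v ^ 2) =
      2 * (u + t * v) ^ 2 + (2 * t ^ 2 + 1) * v ^ 2 + 2 / a * (d * v ^ 2) +
        (2 * t ^ 2 + 1) / d * (a * (u + t * v) ^ 2) := by
    field_simp; ring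
  rw [h1]
  have h2 : 0 ≤ 2 / a * (d * v ^ 2) := by positivity
  have h3 : 0 ≤ (2 * t ^ 2 + 1) / d * (a * (u + t * v) ^ 2) := by positivity
  nlinarith [sq_nonneg (u + 2 * t * v)]

theorem summableExponents_binForm {a t d : ℝ} (ha : 0 < a) (hd : 0 < d) (x y : ℝ) :
    SummableExponents fun p : ℤ × ℤ => binForm a t d (p.1 + x) (p.2 + y) / 2 := by
  refine ⟨fun p => by unfold binForm; positivity, fun ε hε => ?_⟩
  obtain ⟨c, hc, hlow⟩ := binForm_lower (t := t) ha hd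
  -- The inequality $(n+x)^2\ge n^2/2-x^2$ removes the shift. It halves the constant once more and
  -- costs the factor $\exp(\varepsilon c(x^2+y^2)/2)$.
  have h1 := summable_exp_neg_sq (c := ε * c / 4) (by positivity)
  have h2 := (h1.mul_of_nonneg h1 (fun _ => (Real.exp_pos _).le)
    (fun _ => (Real.exp_pos _).le)).mul_left (Real.exp (ε * c * (x ^ 2 + y ^ 2) / 2))
  refine Summable.of_nonneg_of_le (fun _ => (Real.exp_pos _).le) (fun p => ?_) h2
  rw [← Real.exp_add, ← Real.exp_add]
  apply Real.exp_le_exp.2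
  have h3 := hlow (p.1 + x) (p.2 + y)
  have h4 : ε * (c * ((p.1 + x) ^ 2 + (p.2 + y) ^ 2)) ≤
    ε * binForm a t d (p.1 + x) (p.2 + y) := by gcongr
  nlinarith [mul_nonneg (mul_pos hε hc).le (sq_nonneg (p.1 + 2 * x)),
    mul_nonneg (mul_pos hε hc).le (sq_nonneg (p.2 + 2 * y))]

/-- One-dimensional Poisson summation for shifted Gaussians with a character. -/
theorem tsum_gaussian_char (τ : ℍ) {d : ℝ} (hd : 0 < d) (z s : ℝ) :
    ∑' n : ℤ, e (-(z * (n + s) : ℝ)) * e ((-1 / (τ : ℂ)) * (d * (n + s) ^ 2 / 2 : ℝ)) =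
      1 / (-I * (-1 / (τ : ℂ) * d)) ^ (1 / 2 : ℂ) *
        ∑' q : ℤ, e (-(q * s : ℝ)) * e ((τ : ℂ) * ((q - z) ^ 2 / d / 2 : ℝ)) := by
  have hτ : (τ : ℂ) ≠ 0 := τ.ne_zero
  have hdc : (d : ℂ) ≠ 0 := by exact_mod_cast hd.ne'
  set τ' : ℂ := -1 / (τ : ℂ) with hτ'
  have hτ'0 : τ' ≠ 0 := by simp [hτ', hτ]
  -- The argument $-z+\tau'ds$ encodes both the character and the shift. The Gaussian factors
  -- outside the two theta functions come from completing the square.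
  have hfe := jacobiTheta₂_functional_equation (-z + τ' * d * s) (τ' * d)
  have hL : ∑' n : ℤ, e (-(z * (n + s) : ℝ)) * e (τ' * (d * (n + s) ^ 2 / 2 : ℝ)) =
      (e (-(z * s)) * e (τ' * d * s ^ 2 / 2)) * jacobiTheta₂ (-z + τ' * d * s) (τ' * d) := by
    rw [jacobiTheta₂, ← tsum_mul_left]
    refine tsum_congr fun n => ?_
    simp only [jacobiTheta₂_term, e, ← Complex.exp_add]
    congr 1
    push_cast
    ring
  have hR : ∑' q : ℤ, e (-(q * s : ℝ)) * e ((τ : ℂ) * ((q - z) ^ 2 / d / 2 : ℝ)) =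
      e ((τ : ℂ) * z ^ 2 / d / 2) * jacobiTheta₂ ((-z + τ' * d * s) / (τ' * d)) (-1 / (τ' * d)) := by
    rw [jacobiTheta₂, ← tsum_mul_left, ← (Equiv.neg ℤ).tsum_eq]
    refine tsum_congr fun n => ?_
    simp only [jacobiTheta₂_term, e, ← Complex.exp_add, Equiv.neg_apply]
    congr 1
    rw [hτ']
    push_cast
    field_simp
    ring
  rw [hL, hR, hfe]
  have : e (-(z * s)) * e (τ' * d * s ^ 2 / 2) *
      cexp (-Real.pi * I * (-z + τ' * d * s) ^ 2 / (τ' * d)) = e ((τ : ℂ) * z ^ 2 / d / 2) := by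
    simp only [e, ← Complex.exp_add]
    congr 1
    rw [hτ']
    field_simp
    ring
  rw [← this]
  ring

/-- A positive real factor passes through the principal square root, so both roots are real
multiples of the same root of $-i\cdot(-1/\tau)$; its square carries no sign ambiguity. -/
theorem half_cpow_mul (τ : ℍ) {a d : ℝ} (ha : 0 < a) (hd : 0 < d) :
    1 / (-I * (-1 / (τ : ℂ) * a)) ^ (1 / 2 : ℂ) * (1 / (-I * (-1 / (τ : ℂ) * d)) ^ (1 / 2 : ℂ)) =
      -I * τ * ((Real.sqrt (a * d))⁻¹ : ℝ) := by
  have hτ : (τ : ℂ) ≠ 0 := τ.ne_zero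
  have h1 : ∀ x : ℝ, 0 < x → (-I * (-1 / (τ : ℂ) * x)) ^ (1 / 2 : ℂ) =
      (-I * (-1 / (τ : ℂ))) ^ (1 / 2 : ℂ) * (Real.sqrt x : ℂ) := by
    intro x hx
    have h0 : -I * (-1 / (τ : ℂ)) ≠ 0 := by simp [hτ]
    have hxc : (x : ℂ) ≠ 0 := by exact_mod_cast hx.ne'
    rw [show -I * (-1 / (τ : ℂ) * x) = (x : ℂ) * (-I * (-1 / (τ : ℂ))) by ring,
      Complex.cpow_def_of_ne_zero (mul_ne_zero hxc h0), Complex.cpow_def_of_ne_zero h0,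
      Complex.log_ofReal_mul hx h0, Real.sqrt_eq_rpow, Real.rpow_def_of_pos hx, Complex.ofReal_exp,
      ← Complex.exp_add]
    congr 1
    push_cast
    ring
  rw [h1 a ha, h1 d hd]
  have h2 : (-I * (-1 / (τ : ℂ))) ^ (1 / 2 : ℂ) * (-I * (-1 / (τ : ℂ))) ^ (1 / 2 : ℂ) =
      -I * (-1 / (τ : ℂ)) := by
    rw [← Complex.cpow_add _ _ (by simp [hτ])]
    norm_num
  rw [Real.sqrt_mul ha.le]
  have hsa : (Real.sqrt a : ℂ) ≠ 0 := by exact_mod_cast (Real.sqrt_pos.2 ha).ne'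
  have hsd : (Real.sqrt d : ℂ) ≠ 0 := by exact_mod_cast (Real.sqrt_pos.2 hd).ne'
  have h3 : 1 / ((-I * (-1 / (τ : ℂ))) ^ (1 / 2 : ℂ) * (Real.sqrt a : ℂ)) *
      (1 / ((-I * (-1 / (τ : ℂ))) ^ (1 / 2 : ℂ) * (Real.sqrt d : ℂ))) =
      1 / ((-I * (-1 / (τ : ℂ))) ^ (1 / 2 : ℂ) * (-I * (-1 / (τ : ℂ))) ^ (1 / 2 : ℂ) *
        (Real.sqrt a * Real.sqrt d)) := by
    rw [div_mul_div_comm]; congr 1 <;> ring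
  rw [h3, h2]
  push_cast
  field_simp
  simp

theorem norm_e_neg_ofReal (x : ℝ) : ‖e (-(x : ℂ))‖ = 1 := by rw [norm_e]; simp

theorem summable_norm_e_sq (τ : ℍ) {d : ℝ} (hd : 0 < d) (y : ℝ) :
    Summable fun n : ℤ => ‖e ((τ : ℂ) * (d * (n + y) ^ 2 / 2 : ℝ))‖ := by
  have := ((summableExponents_binForm (t := 0) hd hd 0 y).comp_injective
    (f := fun n : ℤ => ((0 : ℤ), n)) fun _ _ h => (Prod.ext_iff.1 h).2).summable_norm τ
  simpa [binForm] using this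

theorem summable_binForm_swap (τ : ℍ) {a t d : ℝ} (ha : 0 < a) (hd : 0 < d) (x y : ℝ) :
    Summable fun p : ℤ × ℤ => e ((τ : ℂ) * (binForm a t d (p.2 + x) (p.1 + y) / 2 : ℝ)) :=
  (((summableExponents_binForm ha hd x y).comp_injective
    Prod.swap_injective).summable_norm τ).of_norm

theorem summable_dual_binForm (τ : ℍ) {a t d : ℝ} (ha : 0 < a) (hd : 0 < d) (x y : ℝ) :
    Summable fun p : ℤ × ℤ => e (-(p.1 * x + p.2 * y : ℝ)) *
      e ((τ : ℂ) * ((p.1 ^ 2 / a + (p.2 - t * p.1) ^ 2 / d) / 2 : ℝ)) := by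
  have h := (summable_binForm_swap τ (t := -t) (inv_pos.2 hd) (inv_pos.2 ha) 0 0).norm
  refine Summable.of_norm (h.congr fun p => ?_)
  rw [norm_mul, norm_e_neg_ofReal, one_mul, binForm]
  congr 4
  ring

/-- Justifies exchanging the two summations after Poisson summation in one variable only, when one
Gaussian already lives at $\tau$ and the other still at $\sigma=-1/\tau$. The character has modulus
one, so a product of Gaussians dominates. -/
theorem summable_mixed_gaussian (σ τ : ℍ) {a d : ℝ} (t : ℝ) (ha : 0 < a) (hd : 0 < d) (x y : ℝ) :
    Summable (Function.uncurry fun p n : ℤ => e (-(p * (x + t * (n + y)) : ℝ)) *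
        e ((τ : ℂ) * (p ^ 2 / a / 2 : ℝ)) * e ((σ : ℂ) * (d * (n + y) ^ 2 / 2 : ℝ))) := by
  have h2 : Summable fun n : ℤ => ‖e ((τ : ℂ) * (n ^ 2 / a / 2 : ℝ))‖ := by
    refine (summable_norm_e_sq τ (inv_pos.2 ha) 0).congr fun n => ?_
    rw [add_zero, div_eq_inv_mul _ a]
  refine Summable.of_norm ((h2.mul_of_nonneg (summable_norm_e_sq σ hd y) (fun _ => norm_nonneg _)
      (fun _ => norm_nonneg _)).congr fun p => ?_)
  rw [Function.uncurry, norm_mul, norm_mul, norm_e_neg_ofReal, one_mul]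

theorem tsum_gaussian_fst (τ : ℍ) {a : ℝ} (t d : ℝ) (ha : 0 < a) (x y : ℝ) (n : ℤ) :
    ∑' m : ℤ, e ((-1 / (τ : ℂ)) * (binForm a t d (m + x) (n + y) / 2 : ℝ)) =
      1 / (-I * (-1 / (τ : ℂ) * a)) ^ (1 / 2 : ℂ) *
        ∑' p : ℤ, e (-(p * (x + t * (n + y)) : ℝ)) * e ((τ : ℂ) * (p ^ 2 / a / 2 : ℝ)) *
          e ((-1 / (τ : ℂ)) * (d * (n + y) ^ 2 / 2 : ℝ)) := by
  have := tsum_gaussian_char τ ha 0 (x + t * (n + y))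
  simp only [zero_mul, Complex.ofReal_zero, neg_zero, e_zero, one_mul, sub_zero] at this
  rw [tsum_mul_right, ← mul_assoc, ← this, ← tsum_mul_right]
  refine tsum_congr fun m => ?_
  rw [← e_add, binForm]
  congr 1
  push_cast
  ring

/-- The character left over from the first Poisson summation has frequency $tp$ in the second
variable, which moves the dual variable from $q$ to $q-tp$. -/
theorem tsum_gaussian_snd (τ : ℍ) {d : ℝ} (a t : ℝ) (hd : 0 < d) (x y : ℝ) (p : ℤ) :
    ∑' n : ℤ, e (-(p * (x + t * (n + y)) : ℝ)) * e ((τ : ℂ) * (p ^ 2 / a / 2 : ℝ)) *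
        e ((-1 / (τ : ℂ)) * (d * (n + y) ^ 2 / 2 : ℝ)) =
      1 / (-I * (-1 / (τ : ℂ) * d)) ^ (1 / 2 : ℂ) * ∑' q : ℤ, e (-(p * x + q * y : ℝ)) *
          e ((τ : ℂ) * ((p ^ 2 / a + (q - t * p) ^ 2 / d) / 2 : ℝ)) := by
  refine Eq.trans ?_ ((congrArg (e (-(p * x : ℝ)) * e ((τ : ℂ) * (p ^ 2 / a / 2 : ℝ)) * ·)
    (tsum_gaussian_char τ hd (t * p) y)).trans ?_)
  · rw [← tsum_mul_left]
    refine tsum_congr fun n => ?_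
    simp only [← e_add]
    congr 1
    push_cast
    ring
  · rw [mul_left_comm, ← tsum_mul_left]
    congr 1
    refine tsum_congr fun q => ?_
    simp only [← e_add]
    congr 1
    push_cast
    ring

/-- The point `-1/τ` of the upper half plane. -/
def negInv (τ : ℍ) : ℍ := ⟨-1 / (τ : ℂ), by
  rw [neg_div, one_div, neg_im, inv_im, neg_div, neg_neg]
  exact div_pos τ.im_pos (normSq_pos.2 τ.ne_zero)⟩

theorem coe_negInv (τ : ℍ) : (negInv τ : ℂ) = -1 / (τ : ℂ) := rfl

/-- Two-dimensional Poisson summation for theta series of binary forms. -/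
theorem tsum_binForm (τ : ℍ) {a t d : ℝ} (ha : 0 < a) (hd : 0 < d) (x y : ℝ) :
    ∑' p : ℤ × ℤ, e ((negInv τ : ℂ) * (binForm a t d (p.1 + x) (p.2 + y) / 2 : ℝ)) =
      -I * τ * ((Real.sqrt (a * d))⁻¹ : ℝ) *
        ∑' p : ℤ × ℤ, e (-(p.1 * x + p.2 * y : ℝ)) *
          e ((τ : ℂ) * ((p.1 ^ 2 / a + (p.2 - t * p.1) ^ 2 / d) / 2 : ℝ)) := by
  have h1 : ∑' p : ℤ × ℤ, e ((negInv τ : ℂ) * (binForm a t d (p.1 + x) (p.2 + y) / 2 : ℝ)) =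
      ∑' p : ℤ × ℤ, e ((negInv τ : ℂ) * (binForm a t d (p.2 + x) (p.1 + y) / 2 : ℝ)) := by
    rw [← (Equiv.prodComm ℤ ℤ).tsum_eq]
    simp only [Equiv.prodComm_apply, Prod.fst_swap, Prod.snd_swap]
  have h2 := (summable_binForm_swap (negInv τ) (t := t) ha hd x y).tsum_prod
  simp only [coe_negInv, tsum_gaussian_fst τ t d ha] at h2
  have h3 := (summable_mixed_gaussian (negInv τ) τ t ha hd x y).tsum_comm
  simp only [coe_negInv, tsum_gaussian_snd τ a t hd] at h3
  have h4 := (summable_dual_binForm τ (t := t) ha hd x y).tsum_prod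
  rw [tsum_mul_left] at h2 h3
  rw [h1, coe_negInv, h2, h3, h4, ← mul_assoc, half_cpow_mul τ ha hd]

/-! ### Theta functions of the cosets of a binary lattice -/

section CosetTheta

variable {V : Type*} [AddCommGroup V] [Module ℝ V]

/-- The theta function `∑_{x ∈ S} e(τ (x,x)/2)`. -/
def setTheta (E : LinearMap.BilinForm ℝ V) (S : Set V) (τ : ℍ) : ℂ :=
  ∑' x : S, e ((τ : ℂ) * (E x x / 2 : ℝ))

/-- The sets `S ν` are the cosets, in its dual lattice, of the lattice spanned over `ℤ` by `b₁` and
`b₂`, on whose real span `E` is positive definite. The conjugate of the discriminant pairing is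
`χ`. -/
structure IsCosetSystem {ι : Type*} (E : LinearMap.BilinForm ℝ V) (b₁ b₂ : V) (S : ι → Set V)
    (χ : ι → ι → ℂ) : Prop where
  symm : E.IsSymm
  pos : ∀ u v : ℝ, (u ≠ 0 ∨ v ≠ 0) → 0 < E (u • b₁ + v • b₂) (u • b₁ + v • b₂)
  nonempty : ∀ ν, (S ν).Nonempty
  mem_iUnion : ∀ x, (∃ ν, x ∈ S ν) ↔
    (∃ u v : ℝ, x = u • b₁ + v • b₂) ∧ (∃ m : ℤ, E x b₁ = m) ∧ ∃ n : ℤ, E x b₂ = n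
  disjoint : ∀ {μ ν x}, x ∈ S μ → x ∈ S ν → μ = ν
  coset : ∀ {ν x y}, x ∈ S ν → (y ∈ S ν ↔ ∃ m n : ℤ, y = x + (m • b₁ + n • b₂))
  pairing : ∀ {μ ν x y}, x ∈ S μ → y ∈ S ν → e (-(E x y : ℝ)) = χ μ ν

namespace IsCosetSystem

variable {ι : Type*} {E : LinearMap.BilinForm ℝ V} {b₁ b₂ : V} {S : ι → Set V} {χ : ι → ι → ℂ}

theorem pos_fst (h : IsCosetSystem E b₁ b₂ S χ) : 0 < E b₁ b₁ := by
  simpa using h.pos 1 0 (by simp)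

theorem apply_self (h : IsCosetSystem E b₁ b₂ S χ) (u v : ℝ) :
    E (u • b₁ + v • b₂) (u • b₁ + v • b₂) = binForm (E b₁ b₁) (E b₁ b₂ / E b₁ b₁)
      (E b₂ b₂ - E b₁ b₂ ^ 2 / E b₁ b₁) u v := by
  have := h.pos_fst.ne'
  simp only [map_add, map_smul, LinearMap.add_apply, LinearMap.smul_apply, smul_eq_mul,
    show E b₂ b₁ = E b₁ b₂ by simpa using h.symm.eq b₂ b₁, binForm]
  field_simp
  ring

theorem pos_snd (h : IsCosetSystem E b₁ b₂ S χ) : 0 < E b₂ b₂ - E b₁ b₂ ^ 2 / E b₁ b₁ := by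
  have h1 := h.pos (-(E b₁ b₂ / E b₁ b₁)) 1 (by simp)
  rw [h.apply_self] at h1
  simpa [binForm] using h1

theorem eq_of_smul_eq (h : IsCosetSystem E b₁ b₂ S χ) {u v u' v' : ℝ}
    (huv : u • b₁ + v • b₂ = u' • b₁ + v' • b₂) : u = u' ∧ v = v' := by
  by_contra hne
  have h1 := h.pos (u - u') (v - v') (by
    by_contra! h2
    exact hne ⟨sub_eq_zero.1 h2.1, sub_eq_zero.1 h2.2⟩)
  have h2 : (u - u') • b₁ + (v - v') • b₂ = 0 := by
    rw [sub_smul, sub_smul, ← sub_eq_zero.2 huv]; abel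
  simp [h2] at h1

/-- A coset is parametrized by `ℤ²`. -/
def cosetEquiv (h : IsCosetSystem E b₁ b₂ S χ) {ν : ι} {x₀ : V} (hx₀ : x₀ ∈ S ν) : ℤ × ℤ ≃ S ν :=
  Equiv.ofBijective (fun p => ⟨x₀ + (p.1 • b₁ + p.2 • b₂), (h.coset hx₀).2 ⟨_, _, rfl⟩⟩) <| by
    constructor
    · intro p q hpq
      have h1 : x₀ + (p.1 • b₁ + p.2 • b₂) = x₀ + (q.1 • b₁ + q.2 • b₂) := congrArg Subtype.val hpq
      have h2 := add_left_cancel h1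
      simp only [← Int.cast_smul_eq_zsmul ℝ] at h2
      have h3 := h.eq_of_smul_eq h2
      ext
      · exact_mod_cast h3.1
      · exact_mod_cast h3.2
    · rintro ⟨y, hy⟩
      obtain ⟨m, n, rfl⟩ := (h.coset hx₀).1 hy
      exact ⟨(m, n), rfl⟩

theorem coe_cosetEquiv (h : IsCosetSystem E b₁ b₂ S χ) {ν : ι} {x₀ : V} (hx₀ : x₀ ∈ S ν)
    (p : ℤ × ℤ) : (h.cosetEquiv hx₀ p : V) = x₀ + (p.1 • b₁ + p.2 • b₂) := rfl

theorem exists_coords (h : IsCosetSystem E b₁ b₂ S χ) {ν : ι} {x : V} (hx : x ∈ S ν) :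
    ∃ u v : ℝ, x = u • b₁ + v • b₂ := ((h.mem_iUnion x).1 ⟨ν, hx⟩).1

theorem cosetEquiv_apply_self (h : IsCosetSystem E b₁ b₂ S χ) {ν : ι} {x y : ℝ}
    (hx : x • b₁ + y • b₂ ∈ S ν) (p : ℤ × ℤ) :
    E (h.cosetEquiv hx p) (h.cosetEquiv hx p) = binForm (E b₁ b₁) (E b₁ b₂ / E b₁ b₁)
      (E b₂ b₂ - E b₁ b₂ ^ 2 / E b₁ b₁) (p.1 + x) (p.2 + y) := by
  rw [← h.apply_self, coe_cosetEquiv]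
  simp only [← Int.cast_smul_eq_zsmul ℝ]
  rw [show x • b₁ + y • b₂ + ((p.1 : ℝ) • b₁ + (p.2 : ℝ) • b₂) =
    ((p.1 : ℝ) + x) • b₁ + ((p.2 : ℝ) + y) • b₂ by module]

theorem summableExponents (h : IsCosetSystem E b₁ b₂ S χ) (ν : ι) :
    SummableExponents fun x : S ν => E x x / 2 := by
  obtain ⟨x₀, hx₀⟩ := h.nonempty ν
  obtain ⟨x, y, rfl⟩ := h.exists_coords hx₀
  have h1 := (summableExponents_binForm (t := E b₁ b₂ / E b₁ b₁) h.pos_fst h.pos_snd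
    x y).comp_injective (h.cosetEquiv hx₀).symm.injective
  convert h1 using 2 with z
  obtain ⟨p, rfl⟩ := (h.cosetEquiv hx₀).surjective z
  simp [h.cosetEquiv_apply_self]

/-- The vector with coordinates `p` with respect to the dual basis. -/
def dualVector (E : LinearMap.BilinForm ℝ V) (b₁ b₂ : V) (p q : ℝ) : V :=
  (p / E b₁ b₁ - E b₁ b₂ / E b₁ b₁ * ((q - E b₁ b₂ / E b₁ b₁ * p) /
    (E b₂ b₂ - E b₁ b₂ ^ 2 / E b₁ b₁))) • b₁ +
  ((q - E b₁ b₂ / E b₁ b₁ * p) / (E b₂ b₂ - E b₁ b₂ ^ 2 / E b₁ b₁)) • b₂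

theorem dualVector_fst (h : IsCosetSystem E b₁ b₂ S χ) (p q : ℝ) :
    E (dualVector E b₁ b₂ p q) b₁ = p := by
  have h1 := h.pos_fst.ne'
  have h2 : E b₂ b₁ = E b₁ b₂ := by simpa using h.symm.eq b₂ b₁
  simp only [dualVector, map_add, map_smul, LinearMap.add_apply, LinearMap.smul_apply, smul_eq_mul,
    h2]
  generalize (q - E b₁ b₂ / E b₁ b₁ * p) / (E b₂ b₂ - E b₁ b₂ ^ 2 / E b₁ b₁) = r
  field_simp
  ring

theorem dualVector_snd (h : IsCosetSystem E b₁ b₂ S χ) (p q : ℝ) :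
    E (dualVector E b₁ b₂ p q) b₂ = q := by
  have h1 := h.pos_fst.ne'
  have h2 := h.pos_snd.ne'
  simp only [dualVector, map_add, map_smul, LinearMap.add_apply, LinearMap.smul_apply, smul_eq_mul]
  generalize hD : E b₂ b₂ - E b₁ b₂ ^ 2 / E b₁ b₁ = D at *
  have h3 : E b₂ b₂ = D + E b₁ b₂ ^ 2 / E b₁ b₁ := by rw [← hD]; ring
  rw [h3]
  field_simp
  ring

theorem apply_comb (p q : ℝ) (x y : V) (u v : ℝ) (hx : E x b₁ = p) (hy : E x b₂ = q)
    (h : y = u • b₁ + v • b₂) : E x y = p * u + q * v := by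
  subst h
  simp only [map_add, map_smul, smul_eq_mul, hx, hy]
  ring

theorem dualVector_apply_self (h : IsCosetSystem E b₁ b₂ S χ) (p q : ℝ) :
    E (dualVector E b₁ b₂ p q) (dualVector E b₁ b₂ p q) = p ^ 2 / E b₁ b₁ +
      (q - E b₁ b₂ / E b₁ b₁ * p) ^ 2 / (E b₂ b₂ - E b₁ b₂ ^ 2 / E b₁ b₁) := by
  refine (apply_comb p q _ _ _ _ (h.dualVector_fst p q) (h.dualVector_snd p q) rfl).trans ?_
  ring

theorem dualVector_mem (h : IsCosetSystem E b₁ b₂ S χ) (p q : ℤ) :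
    ∃ ν, dualVector E b₁ b₂ p q ∈ S ν :=
  (h.mem_iUnion _).2 ⟨⟨_, _, rfl⟩, ⟨p, h.dualVector_fst _ _⟩, ⟨q, h.dualVector_snd _ _⟩⟩

theorem ext_dual (h : IsCosetSystem E b₁ b₂ S χ) {x y : V} (hx : ∃ u v : ℝ, x = u • b₁ + v • b₂)
    (hy : ∃ u v : ℝ, y = u • b₁ + v • b₂) (h1 : E x b₁ = E y b₁) (h2 : E x b₂ = E y b₂) :
    x = y := by
  obtain ⟨u, v, hx⟩ := hx
  obtain ⟨u', v', hy⟩ := hy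
  have hxy : x - y = (u - u') • b₁ + (v - v') • b₂ := by rw [hx, hy]; module
  by_contra hne
  have hpos := h.pos (u - u') (v - v') (by
    by_contra! h3
    rw [h3.1, h3.2] at hxy
    exact hne (sub_eq_zero.1 (by simpa using hxy)))
  rw [← hxy] at hpos
  nth_rw 2 [hxy] at hpos
  simp [h1, h2] at hpos

/-- The dual lattice is parametrized by `ℤ²`. -/
def dualEquiv (h : IsCosetSystem E b₁ b₂ S χ) : ℤ × ℤ ≃ Σ ν, S ν :=
  Equiv.ofBijective (fun p => ⟨(h.dualVector_mem p.1 p.2).choose, dualVector E b₁ b₂ p.1 p.2,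
      (h.dualVector_mem p.1 p.2).choose_spec⟩) <| by
    constructor
    · intro p q hpq
      have h1 : dualVector E b₁ b₂ p.1 p.2 = dualVector E b₁ b₂ q.1 q.2 :=
        congrArg (fun z : Σ ν, S ν => (z.2 : V)) hpq
      have h2 := congrArg (fun z => E z b₁) h1
      have h3 := congrArg (fun z => E z b₂) h1
      simp only [h.dualVector_fst, h.dualVector_snd] at h2 h3
      ext
      · exact_mod_cast h2
      · exact_mod_cast h3
    · rintro ⟨ν, x, hx⟩
      obtain ⟨h1, ⟨m, hm⟩, ⟨n, hn⟩⟩ := (h.mem_iUnion x).1 ⟨ν, hx⟩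
      have h2 : dualVector E b₁ b₂ m n = x := h.ext_dual ⟨_, _, rfl⟩ h1
        (by rw [h.dualVector_fst, hm]) (by rw [h.dualVector_snd, hn])
      refine ⟨(m, n), ?_⟩
      obtain rfl : ν = (h.dualVector_mem m n).choose :=
        h.disjoint hx (h2 ▸ (h.dualVector_mem m n).choose_spec)
      simp [h2]

theorem coe_dualEquiv (h : IsCosetSystem E b₁ b₂ S χ) (p : ℤ × ℤ) :
    ((h.dualEquiv p).2 : V) = dualVector E b₁ b₂ p.1 p.2 := rfl

theorem mdiff_setTheta (h : IsCosetSystem E b₁ b₂ S χ) (ν : ι) : MDiff (setTheta E (S ν)) :=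
  (h.summableExponents ν).mdiff

/-- The transformation formula up to a positive constant. -/
theorem setTheta_negInv_aux [Fintype ι] (h : IsCosetSystem E b₁ b₂ S χ) : ∃ C : ℝ, 0 < C ∧
    ∀ (τ : ℍ) (ν : ι), setTheta E (S ν) (negInv τ) =
      -I * τ * C * ∑ μ, χ μ ν * setTheta E (S μ) τ := by
  refine ⟨_, inv_pos.2 (Real.sqrt_pos.2 (mul_pos h.pos_fst h.pos_snd)), fun τ ν => ?_⟩
  obtain ⟨x₀, hx₀⟩ := h.nonempty ν
  obtain ⟨x, y, rfl⟩ := h.exists_coords hx₀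
  have hP := tsum_binForm τ (t := E b₁ b₂ / E b₁ b₁) h.pos_fst h.pos_snd x y
  have hL : setTheta E (S ν) (negInv τ) = ∑' p : ℤ × ℤ, e ((negInv τ : ℂ) *
      (binForm (E b₁ b₁) (E b₁ b₂ / E b₁ b₁)
        (E b₂ b₂ - E b₁ b₂ ^ 2 / E b₁ b₁) (p.1 + x) (p.2 + y) / 2 : ℝ)) := by
    rw [setTheta, ← (h.cosetEquiv hx₀).tsum_eq]
    simp only [h.cosetEquiv_apply_self]
  rw [hL, hP]
  congr 1
  -- The Poisson-dual sum runs over the whole dual lattice. It is regrouped by cosets, on each of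
  -- which the character is the constant $\chi_{\mu\nu}$.
  let F : (Σ ν, S ν) → ℂ := fun z => e (-(E z.2 (x • b₁ + y • b₂) : ℝ)) *
    e ((τ : ℂ) * (E z.2 z.2 / 2 : ℝ))
  have hF : ∀ p : ℤ × ℤ, F (h.dualEquiv p) = e (-(p.1 * x + p.2 * y : ℝ)) *
      e ((τ : ℂ) * (((p.1 : ℝ) ^ 2 / E b₁ b₁ + ((p.2 : ℝ) - E b₁ b₂ / E b₁ b₁ * p.1) ^ 2 /
        (E b₂ b₂ - E b₁ b₂ ^ 2 / E b₁ b₁)) / 2 : ℝ)) := by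
    intro p
    simp only [F, coe_dualEquiv]
    rw [h.dualVector_apply_self, apply_comb p.1 p.2 _ _ x y (h.dualVector_fst _ _)
      (h.dualVector_snd _ _) rfl]
  have hsum : Summable F := by
    rw [← h.dualEquiv.summable_iff]
    refine (summable_dual_binForm τ (t := E b₁ b₂ / E b₁ b₁) h.pos_fst h.pos_snd x y).congr ?_
    exact fun p => (hF p).symm
  rw [← tsum_congr hF, h.dualEquiv.tsum_eq F, hsum.tsum_sigma, tsum_fintype]
  refine Finset.sum_congr rfl fun μ _ => ?_
  rw [setTheta, ← tsum_mul_left]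
  refine tsum_congr fun z => ?_
  simp only [F]
  rw [h.pairing z.2 hx₀]

/-- All terms are positive reals at $\tau=i$. This allows a theta value to be cancelled when the
constant of the transformation formula is computed. -/
theorem setTheta_I_ne_zero (h : IsCosetSystem E b₁ b₂ S χ) (ν : ι) :
    setTheta E (S ν) UpperHalfPlane.I ≠ 0 := by
  have h1 : setTheta E (S ν) UpperHalfPlane.I =
      ((∑' x : S ν, Real.exp (-(2 * Real.pi * (E x x / 2))) : ℝ) : ℂ) := by
    rw [setTheta, Complex.ofReal_tsum]
    refine tsum_congr fun x => ?_
    rw [e, Complex.ofReal_exp]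
    congr 1
    push_cast
    linear_combination (Real.pi * (E x x : ℂ)) * I_mul_I
  rw [h1]
  obtain ⟨x₀, hx₀⟩ := h.nonempty ν
  have := ((h.summableExponents ν).summable (2 * Real.pi) (by positivity)).tsum_pos
    (fun _ => (Real.exp_pos _).le) ⟨x₀, hx₀⟩ (Real.exp_pos _)
  exact_mod_cast this.ne'

/-- The transformation formula of the theta functions of the cosets under `τ ↦ -1/τ`. -/
theorem setTheta_negInv [Fintype ι] [DecidableEq ι] [Zero ι] (h : IsCosetSystem E b₁ b₂ S χ)
    (hχ : ∀ κ, ∑ μ, χ κ μ = if κ = 0 then (Fintype.card ι : ℂ) else 0) (hχ0 : ∀ μ, χ μ 0 = 1)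
    (τ : ℍ) (ν : ι) : setTheta E (S ν) (negInv τ) =
      -I * τ * ((Fintype.card ι : ℝ) ^ (-(1 / 2) : ℝ) : ℝ) *
        ∑ μ, χ μ ν * setTheta E (S μ) τ := by
  obtain ⟨C, hC, hT⟩ := h.setTheta_negInv_aux
  suffices hCc : C = (Fintype.card ι : ℝ) ^ (-(1 / 2) : ℝ) by rw [← hCc]; exact hT τ ν
  -- The constant is determined at the fixed point $i$ without computing a covolume: applying the
  -- formula twice there and using orthogonality of characters gives $C^2\,|\iota|=1$, and $C>0$.
  have hII : negInv UpperHalfPlane.I = UpperHalfPlane.I := by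
    ext
    simp [coe_negInv]
  have h0 := hT UpperHalfPlane.I
  simp only [hII, UpperHalfPlane.coe_I, neg_mul, I_mul_I, neg_neg, one_mul] at h0
  have h1 := h0 0
  simp only [hχ0, one_mul] at h1
  have h2 : ∑ μ, setTheta E (S μ) UpperHalfPlane.I =
      C * (Fintype.card ι * setTheta E (S 0) UpperHalfPlane.I) := by
    rw [Finset.sum_congr rfl fun μ _ => h0 μ, ← Finset.mul_sum, Finset.sum_comm]
    simp only [← Finset.sum_mul, hχ]
    simp
  rw [h2] at h1
  have h3 := h.setTheta_I_ne_zero 0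
  have h4 : (C : ℂ) * C * Fintype.card ι = 1 := mul_right_cancel₀ h3 (by linear_combination -h1)
  have h5 : C * C * Fintype.card ι = 1 := by exact_mod_cast h4
  have hc : (0 : ℝ) < Fintype.card ι := by
    exact_mod_cast Fintype.card_pos_iff.2 ⟨0⟩
  rw [Real.rpow_neg hc.le, ← Real.sqrt_eq_rpow, ← Real.sqrt_inv]
  rw [eq_comm, Real.sqrt_eq_iff_mul_self_eq (by positivity) hC.le]
  field_simp
  linarith

end IsCosetSystem

end CosetTheta

/-! ### Primitive sublattices of `M₂(ℤ)` -/

/-- The inclusion of `ℤ⁴` as `M₂(ℤ)` into `M₂(ℝ)`. -/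
def intMat : (Fin 2 × Fin 2 → ℤ) →ₗ[ℤ] Matrix (Fin 2) (Fin 2) ℝ where
  toFun c := Matrix.of fun i j => (c (i, j) : ℝ)
  map_add' c d := by ext; simp
  map_smul' c d := by ext; simp

theorem intMat_apply (c : Fin 2 × Fin 2 → ℤ) (i j : Fin 2) : intMat c i j = c (i, j) := rfl

theorem mem_matLattice_iff {x : Matrix (Fin 2) (Fin 2) ℝ} :
    x ∈ matLattice ↔ ∃ c, intMat c = x := by
  constructor
  · intro h
    choose c hc using h
    exact ⟨fun p => c p.1 p.2, by ext i j; simp [intMat_apply, hc]⟩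
  · rintro ⟨c, rfl⟩ i j
    exact ⟨c (i, j), rfl⟩

/-- The primitive sublattice `U ∩ M₂(ℤ)`. -/
def planeLattice (U : Submodule ℝ (Matrix (Fin 2) (Fin 2) ℝ)) :
    Submodule ℤ (Matrix (Fin 2) (Fin 2) ℝ) := U.restrictScalars ℤ ⊓ matLattice

theorem linearIndependent_intMat {ι : Type*} {v : ι → Fin 2 × Fin 2 → ℤ}
    (hv : LinearIndependent ℤ v) : LinearIndependent ℝ fun i => intMat (v i) := by
  have h1 := (linearIndependent_algebraMap_comp_iff (S := ℝ)).2 hv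
  let T : (Fin 2 × Fin 2 → ℝ) →ₗ[ℝ] Matrix (Fin 2) (Fin 2) ℝ :=
    { toFun := fun c => Matrix.of fun i j => c (i, j)
      map_add' := fun c d => by ext; simp
      map_smul' := fun c d => by ext; simp }
  have hT : LinearMap.ker T = ⊥ := by
    rw [LinearMap.ker_eq_bot]
    intro c d h
    ext ⟨i, j⟩
    exact congrFun (congrFun h i) j
  have h2 := h1.map' T hT
  have h3 : (T ∘ fun i => algebraMap ℤ ℝ ∘ v i) = fun i => intMat (v i) := by
    ext i j k
    simp [T, intMat_apply]
  rwa [h3] at h2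

/-- The lattice is free, being a submodule of $\mathbb Z^4$ up to `intMat`. Integral independence of
its basis remains independence over $\mathbb R$, so its rank equals the real dimension of its span,
which is two. -/
theorem exists_basis_planeLattice {U : Submodule ℝ (Matrix (Fin 2) (Fin 2) ℝ)}
    (hU : Module.finrank ℝ U = 2) (hspan : Submodule.span ℝ (planeLattice U : Set _) = U) :
    ∃ b₁ b₂, (∀ x, x ∈ planeLattice U ↔ ∃ m n : ℤ, x = m • b₁ + n • b₂) ∧
      (∀ x, x ∈ U ↔ ∃ u v : ℝ, x = u • b₁ + v • b₂) ∧
      ∀ u v : ℝ, u • b₁ + v • b₂ = 0 → u = 0 ∧ v = 0 := by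
  obtain ⟨n, ⟨b⟩⟩ := Submodule.nonempty_basis_of_pid (Pi.basisFun ℤ (Fin 2 × Fin 2))
    ((planeLattice U).comap intMat)
  have hli0 : LinearIndependent ℤ fun i => (b i : Fin 2 × Fin 2 → ℤ) :=
    b.linearIndependent.map' (Submodule.subtype _) (Submodule.ker_subtype _)
  have hli : LinearIndependent ℝ fun i => intMat (b i : Fin 2 × Fin 2 → ℤ) :=
    linearIndependent_intMat hli0
  have hmem : ∀ x, x ∈ planeLattice U ↔
      ∃ c : Fin n → ℤ, x = ∑ i, c i • intMat (b i : Fin 2 × Fin 2 → ℤ) := by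
    intro x
    constructor
    · intro hx
      obtain ⟨c, rfl⟩ := mem_matLattice_iff.1 hx.2
      refine ⟨b.repr ⟨c, hx⟩, ?_⟩
      have := congrArg (fun z => intMat (Submodule.subtype _ z)) (b.sum_repr ⟨c, hx⟩)
      simpa only [map_sum, map_smul, Submodule.subtype_apply] using this.symm
    · rintro ⟨c, rfl⟩
      exact Submodule.sum_mem _ fun i _ => Submodule.smul_mem _ _ (b i).2
  have hspan2 : Submodule.span ℝ (Set.range fun i => intMat (b i : Fin 2 × Fin 2 → ℤ)) = U := by
    apply le_antisymm
    · rw [Submodule.span_le]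
      rintro _ ⟨i, rfl⟩
      exact (b i).2.1
    · conv_lhs => rw [← hspan]
      rw [Submodule.span_le]
      intro x hx
      obtain ⟨c, rfl⟩ := (hmem x).1 hx
      refine Submodule.sum_mem _ fun i _ => ?_
      rw [← Int.cast_smul_eq_zsmul ℝ]
      exact Submodule.smul_mem _ _ (Submodule.subset_span ⟨i, rfl⟩)
  have hn : n = 2 := by
    have := finrank_span_eq_card hli
    rw [hspan2, hU, Fintype.card_fin] at this
    exact this.symm
  subst hn
  refine ⟨intMat (b 0), intMat (b 1), fun x => ?_, fun x => ?_, fun u v huv => ?_⟩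
  · rw [hmem]
    constructor
    · rintro ⟨c, rfl⟩
      exact ⟨c 0, c 1, by simp [Fin.sum_univ_two]⟩
    · rintro ⟨m, n, rfl⟩
      exact ⟨![m, n], by simp [Fin.sum_univ_two]⟩
  · refine (iff_of_eq (congrArg (x ∈ ·) hspan2.symm)).trans ?_
    rw [show (Set.range fun i => intMat (b i : Fin 2 × Fin 2 → ℤ)) =
      {intMat (b 0), intMat (b 1)} by ext; simp [eq_comm], Submodule.mem_span_pair]
    exact ⟨fun ⟨u, v, h⟩ => ⟨u, v, h.symm⟩, fun ⟨u, v, h⟩ => ⟨u, v, h.symm⟩⟩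
  · have h1 := Fintype.linearIndependent_iff.1 hli ![u, v] (by simpa [Fin.sum_univ_two] using huv)
    exact ⟨h1 0, h1 1⟩

/-- Unimodularity: every functional on `M₂(ℤ)` is represented by a lattice vector. -/
theorem exists_detForm_eq (f : (Fin 2 × Fin 2 → ℤ) →ₗ[ℤ] ℤ) :
    ∃ l ∈ matLattice, ∀ c, detForm l (intMat c) = f c := by
  -- Under $-\det$ the matrix units are dual in pairs: $E_{12}$ with $E_{21}$ with sign $+$, and
  -- $E_{11}$ with $E_{22}$ with sign $-$.
  refine ⟨intMat fun p => if p = (0, 0) then -f (Pi.single (1, 1) 1) else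
    if p = (0, 1) then f (Pi.single (1, 0) 1) else if p = (1, 0) then f (Pi.single (0, 1) 1) else
      -f (Pi.single (0, 0) 1), mem_matLattice_iff.2 ⟨_, rfl⟩, fun c => ?_⟩
  have hc : c = ∑ p, c p • Pi.single p (1 : ℤ) := by
    ext q
    simp [Finset.sum_apply, Pi.single_apply]
  have hf : f c = ∑ p, c p * f (Pi.single p 1) := by
    conv_lhs => rw [hc]
    simp only [map_sum, map_smul, smul_eq_mul]
  rw [hf, Fintype.sum_prod_type]
  simp only [detForm_apply, intMat_apply, Fin.sum_univ_two]
  simp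
  ring

/-- Functionals on a primitive sublattice of `ℤ⁴` extend. -/
theorem exists_extension (N : Submodule ℤ (Fin 2 × Fin 2 → ℤ))
    (hN : ∀ (r : ℤ) (c : Fin 2 × Fin 2 → ℤ), r ≠ 0 → r • c ∈ N → c ∈ N) (f : N →ₗ[ℤ] ℤ) :
    ∃ g : (Fin 2 × Fin 2 → ℤ) →ₗ[ℤ] ℤ, ∀ c : N, g c = f c := by
  -- Primitivity says that the quotient is torsion-free. Being finitely generated over $\mathbb Z$
  -- it is then projective, so the quotient map splits and $N$ is a direct summand.
  have : Module.IsTorsionFree ℤ ((Fin 2 × Fin 2 → ℤ) ⧸ N) := by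
    refine Module.IsTorsionFree.of_smul_eq_zero fun r x hx => ?_
    obtain ⟨c, rfl⟩ := Submodule.Quotient.mk_surjective N x
    by_contra! h
    refine h.2 ?_
    rw [← Submodule.Quotient.mk_smul, Submodule.Quotient.mk_eq_zero] at hx
    rw [Submodule.Quotient.mk_eq_zero]
    exact hN r c h.1 hx
  obtain ⟨s, hs⟩ := Module.projective_lifting_property N.mkQ LinearMap.id N.mkQ_surjective
  have hs' : ∀ x, N.mkQ (s x) = x := fun x => LinearMap.congr_fun hs x
  let π : (Fin 2 × Fin 2 → ℤ) →ₗ[ℤ] N := (LinearMap.id - s ∘ₗ N.mkQ).codRestrict N fun c => by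
    rw [← Submodule.Quotient.mk_eq_zero, ← Submodule.mkQ_apply]
    simp only [LinearMap.sub_apply, LinearMap.id_apply, LinearMap.comp_apply, map_sub, hs',
      sub_self]
  refine ⟨f ∘ₗ π, fun c => ?_⟩
  have : N.mkQ c = 0 := by rw [Submodule.mkQ_apply, Submodule.Quotient.mk_eq_zero]; exact c.2
  rw [LinearMap.comp_apply]
  congr 1
  ext1
  change (c : Fin 2 × Fin 2 → ℤ) - s (N.mkQ c) = c
  rw [this, map_zero, sub_zero]

/-- An integral functional on `U ∩ M₂(ℤ)` represented by `x` is represented by a lattice vector. -/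
theorem exists_lattice_representative {U : Submodule ℝ (Matrix (Fin 2) (Fin 2) ℝ)}
    (hspan : Submodule.span ℝ (planeLattice U : Set _) = U)
    {x : Matrix (Fin 2) (Fin 2) ℝ} (hx : ∀ y ∈ planeLattice U, ∃ n : ℤ, detForm x y = n) :
    ∃ l ∈ matLattice, l - x ∈ detForm.orthogonal U := by
  choose! n hn using hx
  let f : (planeLattice U).comap intMat →ₗ[ℤ] ℤ :=
    { toFun := fun c => n (intMat c)
      map_add' := fun c d => by
        have h := hn _ (c + d).2
        have h1 := hn _ c.2
        have h2 := hn _ d.2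
        rw [Submodule.coe_add, map_add, map_add, h1, h2] at h
        rw [Submodule.coe_add, map_add]
        exact_mod_cast h.symm
      map_smul' := fun r c => by
        have h := hn _ (r • c).2
        have h1 := hn _ c.2
        rw [Submodule.coe_smul, map_smul, map_zsmul, h1] at h
        rw [Submodule.coe_smul, map_smul]
        rw [zsmul_eq_mul] at h
        rw [eq_intCast, Int.cast_id, smul_eq_mul]
        exact_mod_cast h.symm }
  -- Primitivity is automatic: $U$ is a real subspace, so division by a nonzero integer stays in
  -- $U$.
  obtain ⟨g, hg⟩ := exists_extension ((planeLattice U).comap intMat) (fun r c hr h =>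
    Submodule.mem_comap.2 ⟨(U.smul_mem_iff (s := (r : ℝ)) (Int.cast_ne_zero.2 hr)).1 (by
      have h1 := h.1
      rwa [map_smul, ← Int.cast_smul_eq_zsmul ℝ] at h1), mem_matLattice_iff.2 ⟨_, rfl⟩⟩) f
  obtain ⟨l, hl, hlg⟩ := exists_detForm_eq g
  refine ⟨l, hl, ?_⟩
  rw [LinearMap.BilinForm.mem_orthogonal_iff]
  have h0 : ∀ y ∈ planeLattice U, detForm (l - x) y = 0 := by
    intro y hy
    obtain ⟨c, rfl⟩ := mem_matLattice_iff.1 hy.2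
    rw [map_sub, LinearMap.sub_apply, hn _ hy, hlg, hg (⟨c, hy⟩ : (planeLattice U).comap intMat)]
    simp [f]
  intro y hy
  rw [← hspan] at hy
  change detForm y (l - x) = 0
  rw [show detForm y (l - x) = detForm (l - x) y from detForm_isSymm.eq _ _]
  induction hy using Submodule.span_induction with
  | mem y hy => exact h0 y hy
  | zero => simp
  | add y z _ _ hy hz => rw [map_add, hy, hz, add_zero]
  | smul r y _ hy => rw [map_smul, hy, smul_zero]

/-! ### The discriminant group of a rational plane -/

theorem detForm_comm (x y : Matrix (Fin 2) (Fin 2) ℝ) : detForm x y = detForm y x :=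
  detForm_isSymm.eq x y

theorem detForm_zsmul_add (x b₁ b₂ : Matrix (Fin 2) (Fin 2) ℝ) (m n : ℤ) :
    detForm x (m • b₁ + n • b₂) = m * detForm x b₁ + n * detForm x b₂ := by
  rw [map_add, map_zsmul, map_zsmul, zsmul_eq_mul, zsmul_eq_mul]

theorem detForm_int {x y : Matrix (Fin 2) (Fin 2) ℝ} (hx : x ∈ matLattice) (hy : y ∈ matLattice) :
    ∃ n : ℤ, detForm x y = n := by
  obtain ⟨c, rfl⟩ := mem_matLattice_iff.1 hx
  obtain ⟨d, rfl⟩ := mem_matLattice_iff.1 hy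
  exact ⟨c (0, 1) * d (1, 0) + c (1, 0) * d (0, 1) - c (0, 0) * d (1, 1) - c (1, 1) * d (0, 0), by
    simp [detForm_apply, intMat_apply]⟩

theorem detForm_even {x : Matrix (Fin 2) (Fin 2) ℝ} (hx : x ∈ matLattice) :
    ∃ n : ℤ, detForm x x / 2 = n := by
  obtain ⟨c, rfl⟩ := mem_matLattice_iff.1 hx
  exact ⟨c (0, 1) * c (1, 0) - c (0, 0) * c (1, 1), by
    simp [detForm_apply, intMat_apply]; ring⟩

/-- A positive definite plane `U` such that `U` and its (negative definite) orthogonal complement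
are spanned by integral matrices. -/
structure IsRationalPlane (U : Submodule ℝ (Matrix (Fin 2) (Fin 2) ℝ)) : Prop where
  finrank_eq : Module.finrank ℝ U = 2
  finrank_orthogonal : Module.finrank ℝ (detForm.orthogonal U) = 2
  pos : ∀ x ∈ U, x ≠ 0 → 0 < detForm x x
  neg : ∀ x ∈ detForm.orthogonal U, x ≠ 0 → detForm x x < 0
  orthogonal_orthogonal : detForm.orthogonal (detForm.orthogonal U) = U
  span_eq : Submodule.span ℝ (planeLattice U : Set _) = U
  span_orthogonal : Submodule.span ℝ (planeLattice (detForm.orthogonal U) : Set _) =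
    detForm.orthogonal U

theorem mem_dualLattice_iff {U : Submodule ℝ (Matrix (Fin 2) (Fin 2) ℝ)}
    (h : Submodule.span ℝ (planeLattice U : Set _) = U) {x : Matrix (Fin 2) (Fin 2) ℝ} :
    x ∈ dualLattice detForm (planeLattice U) ↔
      x ∈ U ∧ ∀ y ∈ planeLattice U, ∃ n : ℤ, detForm x y = n := by
  rw [dualLattice, Submodule.mem_inf, LinearMap.BilinForm.mem_dualSubmodule, h,
    Submodule.restrictScalars_mem, and_comm]
  simp only [Submodule.mem_one, algebraMap_int_eq, eq_intCast, eq_comm]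

theorem planeLattice_le_dualLattice {U : Submodule ℝ (Matrix (Fin 2) (Fin 2) ℝ)}
    (h : Submodule.span ℝ (planeLattice U : Set _) = U) :
    planeLattice U ≤ dualLattice detForm (planeLattice U) := fun _ hx =>
  (mem_dualLattice_iff h).2 ⟨hx.1, fun _ hy => detForm_int hx.2 hy.2⟩

theorem discGroup_mk_eq {U : Submodule ℝ (Matrix (Fin 2) (Fin 2) ℝ)}
    {x y : dualLattice detForm (planeLattice U)} :
    (Submodule.Quotient.mk x : DiscGroup detForm (planeLattice U)) = Submodule.Quotient.mk y ↔
      (x : Matrix (Fin 2) (Fin 2) ℝ) - y ∈ planeLattice U := by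
  rw [Submodule.Quotient.eq]
  rfl

/-- The coset `ν` as a subset of the ambient space. -/
def posSet (U : Submodule ℝ (Matrix (Fin 2) (Fin 2) ℝ)) (ν : DiscGroup detForm (planeLattice U)) :
    Set (Matrix (Fin 2) (Fin 2) ℝ) :=
  {x | ∃ h : x ∈ dualLattice detForm (planeLattice U), Submodule.Quotient.mk ⟨x, h⟩ = ν}

/-- The coset `M' ∩ (-ν + L)` of the orthogonal lattice `M` that is glued to `ν`. -/
def negSet (U : Submodule ℝ (Matrix (Fin 2) (Fin 2) ℝ)) (ν : DiscGroup detForm (planeLattice U)) :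
    Set (Matrix (Fin 2) (Fin 2) ℝ) :=
  {m | m ∈ dualLattice detForm (planeLattice (detForm.orthogonal U)) ∧
    ∃ x ∈ posSet U ν, m + x ∈ matLattice}

/-- The conjugate of the discriminant pairing. -/
def discPairing (U : Submodule ℝ (Matrix (Fin 2) (Fin 2) ℝ))
    (μ ν : DiscGroup detForm (planeLattice U)) : ℂ :=
  e (-(detForm (ν.out : Matrix (Fin 2) (Fin 2) ℝ) (μ.out : Matrix (Fin 2) (Fin 2) ℝ) : ℂ))

namespace IsRationalPlane

variable {U : Submodule ℝ (Matrix (Fin 2) (Fin 2) ℝ)}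

theorem out_mem_posSet (ν : DiscGroup detForm (planeLattice U)) :
    ((ν.out : dualLattice detForm (planeLattice U)) : Matrix (Fin 2) (Fin 2) ℝ) ∈ posSet U ν :=
  ⟨ν.out.2, Quotient.out_eq _⟩

theorem detForm_eq_zero {x y : Matrix (Fin 2) (Fin 2) ℝ} (hx : x ∈ U)
    (hy : y ∈ detForm.orthogonal U) : detForm x y = 0 :=
  (LinearMap.BilinForm.mem_orthogonal_iff.1 hy) x hx

theorem mem_of_mem_posSet (h : IsRationalPlane U) {ν : DiscGroup detForm (planeLattice U)}
    {x : Matrix (Fin 2) (Fin 2) ℝ} (hx : x ∈ posSet U ν) : x ∈ U :=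
  ((mem_dualLattice_iff h.span_eq).1 hx.1).1

theorem mem_of_mem_negSet (h : IsRationalPlane U) {ν : DiscGroup detForm (planeLattice U)}
    {x : Matrix (Fin 2) (Fin 2) ℝ} (hx : x ∈ negSet U ν) : x ∈ detForm.orthogonal U :=
  ((mem_dualLattice_iff h.span_orthogonal).1 hx.1).1

theorem posSet_sub_mem {ν : DiscGroup detForm (planeLattice U)}
    {x y : Matrix (Fin 2) (Fin 2) ℝ} (hx : x ∈ posSet U ν) (hy : y ∈ posSet U ν) :
    x - y ∈ planeLattice U := by
  obtain ⟨h1, h2⟩ := hx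
  obtain ⟨h3, h4⟩ := hy
  exact discGroup_mk_eq.1 (h2.trans h4.symm)

theorem posSet_add_mem (h : IsRationalPlane U) {ν : DiscGroup detForm (planeLattice U)}
    {x y : Matrix (Fin 2) (Fin 2) ℝ} (hx : x ∈ posSet U ν) (hy : y - x ∈ planeLattice U) :
    y ∈ posSet U ν := by
  obtain ⟨h1, rfl⟩ := hx
  have h2 : y ∈ dualLattice detForm (planeLattice U) := by
    have := Submodule.add_mem _ (planeLattice_le_dualLattice h.span_eq hy) h1
    rwa [sub_add_cancel] at this
  exact ⟨h2, discGroup_mk_eq.2 hy⟩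

theorem posSet_pairing (h : IsRationalPlane U) {μ ν : DiscGroup detForm (planeLattice U)}
    {x x' y y' : Matrix (Fin 2) (Fin 2) ℝ} (hx : x ∈ posSet U μ) (hx' : x' ∈ posSet U μ)
    (hy : y ∈ posSet U ν) (hy' : y' ∈ posSet U ν) :
    ∃ n : ℤ, detForm x y = detForm x' y' + n := by
  obtain ⟨m, hm⟩ := ((mem_dualLattice_iff h.span_eq).1 hy.1).2 _ (posSet_sub_mem hx hx')
  obtain ⟨n, hn⟩ := ((mem_dualLattice_iff h.span_eq).1 hx'.1).2 _ (posSet_sub_mem hy hy')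
  refine ⟨m + n, ?_⟩
  rw [map_sub] at hm hn
  rw [detForm_comm y x, detForm_comm y x'] at hm
  push_cast
  linarith

theorem e_pairing (h : IsRationalPlane U) {μ ν : DiscGroup detForm (planeLattice U)}
    {x y : Matrix (Fin 2) (Fin 2) ℝ} (hx : x ∈ posSet U μ) (hy : y ∈ posSet U ν) :
    e (-(detForm x y : ℝ)) = discPairing U μ ν := by
  obtain ⟨n, hn⟩ := h.posSet_pairing hx (out_mem_posSet μ) hy (out_mem_posSet ν)
  rw [discPairing, detForm_comm (ν.out : Matrix (Fin 2) (Fin 2) ℝ), hn, ← e_add_int _ n]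
  congr 1
  push_cast
  ring

/-- The cosets of `N` in `N'` form a coset system. -/
theorem exists_posSystem (h : IsRationalPlane U) :
    ∃ b₁ b₂, (∀ x, x ∈ planeLattice U ↔ ∃ m n : ℤ, x = m • b₁ + n • b₂) ∧
      (∀ x, x ∈ U ↔ ∃ u v : ℝ, x = u • b₁ + v • b₂) ∧
      IsCosetSystem detForm b₁ b₂ (posSet U) (discPairing U) := by
  obtain ⟨b₁, b₂, hN, hU, hli⟩ := exists_basis_planeLattice h.finrank_eq h.span_eq
  have hb₁ : b₁ ∈ planeLattice U := (hN _).2 ⟨1, 0, by simp⟩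
  have hb₂ : b₂ ∈ planeLattice U := (hN _).2 ⟨0, 1, by simp⟩
  refine ⟨b₁, b₂, hN, hU, detForm_isSymm, fun u v huv => ?_, fun ν => ⟨_, out_mem_posSet ν⟩, fun x => ?_,
    ?_, ?_, fun hx hy => h.e_pairing hx hy⟩
  · refine h.pos _ ((hU _).2 ⟨u, v, rfl⟩) fun h0 => ?_
    obtain ⟨h1, h2⟩ := hli u v h0
    simp [h1, h2] at huv
  · constructor
    · rintro ⟨ν, hx⟩
      have h1 := (mem_dualLattice_iff h.span_eq).1 hx.1
      exact ⟨(hU _).1 h1.1, h1.2 _ hb₁, h1.2 _ hb₂⟩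
    · rintro ⟨hx, ⟨p, hp⟩, ⟨q, hq⟩⟩
      refine ⟨_, (mem_dualLattice_iff h.span_eq).2 ⟨(hU _).2 hx, fun y hy => ?_⟩, rfl⟩
      obtain ⟨m, n, rfl⟩ := (hN _).1 hy
      exact ⟨m * p + n * q, by rw [detForm_zsmul_add, hp, hq]; push_cast; ring⟩
  · rintro μ ν x ⟨h1, rfl⟩ ⟨h2, rfl⟩
    rfl
  · intro ν x y hx
    constructor
    · intro hy
      obtain ⟨m, n, hmn⟩ := (hN _).1 (posSet_sub_mem hy hx)
      exact ⟨m, n, by rw [← hmn]; abel⟩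
    · rintro ⟨m, n, rfl⟩
      refine h.posSet_add_mem hx ?_
      rw [add_sub_cancel_left]
      exact (hN _).2 ⟨m, n, rfl⟩

theorem sub_mem_of_glue (h : IsRationalPlane U) {ν : DiscGroup detForm (planeLattice U)}
    {m m' : Matrix (Fin 2) (Fin 2) ℝ} (hm : m ∈ negSet U ν) (hm' : m' ∈ negSet U ν) :
    m - m' ∈ planeLattice (detForm.orthogonal U) := by
  obtain ⟨x, hx, hmx⟩ := hm.2
  obtain ⟨x', hx', hmx'⟩ := hm'.2
  refine ⟨Submodule.sub_mem _ (h.mem_of_mem_negSet hm) (h.mem_of_mem_negSet hm'), ?_⟩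
  have h1 := Submodule.sub_mem _ (Submodule.sub_mem _ hmx hmx') (posSet_sub_mem hx hx').2
  rwa [show m + x - (m' + x') - (x - x') = m - m' by abel] at h1

/-- The cross terms of $(m+x,m'+x')\in\mathbb Z$ vanish by orthogonality. Thus gluing reverses the
sign of the discriminant pairing, and the negated form on the $M$ side has the same pairing as
$N'/N$. -/
theorem glue_pairing (h : IsRationalPlane U) {μ ν : DiscGroup detForm (planeLattice U)}
    {m m' x x' : Matrix (Fin 2) (Fin 2) ℝ} (hm : m ∈ negSet U μ) (hm' : m' ∈ negSet U ν)
    (hx : x ∈ posSet U μ) (hx' : x' ∈ posSet U ν) (hmx : m + x ∈ matLattice)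
    (hmx' : m' + x' ∈ matLattice) : ∃ n : ℤ, detForm m m' = -detForm x x' + n := by
  obtain ⟨n, hn⟩ := detForm_int hmx hmx'
  refine ⟨n, ?_⟩
  have h1 := detForm_eq_zero (h.mem_of_mem_posSet hx) (h.mem_of_mem_negSet hm')
  have h2 := detForm_eq_zero (h.mem_of_mem_posSet hx') (h.mem_of_mem_negSet hm)
  rw [detForm_comm] at h2
  simp only [map_add, LinearMap.add_apply, h1, h2] at hn
  linarith

/-- The functional $(x,\cdot)$ on $N$ extends to the unimodular lattice and is represented there by
some $l$; the difference $l-x$ is the required partner. -/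
theorem exists_glue_neg (h : IsRationalPlane U) {x : Matrix (Fin 2) (Fin 2) ℝ}
    (hx : x ∈ dualLattice detForm (planeLattice U)) :
    ∃ m ∈ dualLattice detForm (planeLattice (detForm.orthogonal U)), m + x ∈ matLattice := by
  have hx' := (mem_dualLattice_iff h.span_eq).1 hx
  obtain ⟨l, hl, hlx⟩ := exists_lattice_representative h.span_eq hx'.2
  refine ⟨l - x, (mem_dualLattice_iff h.span_orthogonal).2 ⟨hlx, fun y hy => ?_⟩, by simpa⟩
  rw [map_sub, LinearMap.sub_apply, detForm_eq_zero hx'.1 hy.1, sub_zero]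
  exact detForm_int hl hy.2

/-- The same argument from the other side, which uses that the double orthogonal complement is $U$.
It shows that the glued cosets exhaust $M'$. -/
theorem exists_glue_pos (h : IsRationalPlane U) {m : Matrix (Fin 2) (Fin 2) ℝ}
    (hm : m ∈ dualLattice detForm (planeLattice (detForm.orthogonal U))) :
    ∃ x ∈ dualLattice detForm (planeLattice U), m + x ∈ matLattice := by
  have hm' := (mem_dualLattice_iff h.span_orthogonal).1 hm
  obtain ⟨l, hl, hlm⟩ := exists_lattice_representative h.span_orthogonal hm'.2
  rw [h.orthogonal_orthogonal] at hlm
  refine ⟨l - m, (mem_dualLattice_iff h.span_eq).2 ⟨hlm, fun y hy => ?_⟩, by simpa⟩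
  rw [map_sub, LinearMap.sub_apply, detForm_comm m, detForm_eq_zero hy.1 hm'.1, sub_zero]
  exact detForm_int hl hy.2

/-- The cosets glued to the elements of `N'/N` form a coset system for the negative of the form. -/
theorem exists_negSystem (h : IsRationalPlane U) :
    ∃ b₁ b₂, IsCosetSystem (-detForm) b₁ b₂ (negSet U) (discPairing U) := by
  obtain ⟨b₁, b₂, hN, hU, hli⟩ :=
    exists_basis_planeLattice h.finrank_orthogonal h.span_orthogonal
  have hb₁ : b₁ ∈ planeLattice (detForm.orthogonal U) := (hN _).2 ⟨1, 0, by simp⟩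
  have hb₂ : b₂ ∈ planeLattice (detForm.orthogonal U) := (hN _).2 ⟨0, 1, by simp⟩
  refine ⟨b₁, b₂, ⟨fun x y => ?_⟩, fun u v huv => ?_, fun ν => ?_, fun x => ?_, ?_, ?_, ?_⟩
  · simp [detForm_comm x y]
  · rw [LinearMap.neg_apply, LinearMap.neg_apply, neg_pos]
    refine h.neg _ ((hU _).2 ⟨u, v, rfl⟩) fun h0 => ?_
    obtain ⟨h1, h2⟩ := hli u v h0
    simp [h1, h2] at huv
  · obtain ⟨m, hm, hmx⟩ := h.exists_glue_neg ν.out.2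
    exact ⟨m, hm, _, out_mem_posSet ν, hmx⟩
  · constructor
    · rintro ⟨ν, hx⟩
      have h1 := (mem_dualLattice_iff h.span_orthogonal).1 hx.1
      refine ⟨(hU _).1 h1.1, ?_, ?_⟩
      · obtain ⟨n, hn⟩ := h1.2 _ hb₁
        exact ⟨-n, by simp [hn]⟩
      · obtain ⟨n, hn⟩ := h1.2 _ hb₂
        exact ⟨-n, by simp [hn]⟩
    · rintro ⟨hx, ⟨p, hp⟩, ⟨q, hq⟩⟩
      have hxm : x ∈ dualLattice detForm (planeLattice (detForm.orthogonal U)) := by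
        refine (mem_dualLattice_iff h.span_orthogonal).2 ⟨(hU _).2 hx, fun y hy => ?_⟩
        obtain ⟨m, n, rfl⟩ := (hN _).1 hy
        refine ⟨-(m * p + n * q), ?_⟩
        simp only [LinearMap.neg_apply] at hp hq
        rw [detForm_zsmul_add, show detForm x b₁ = -p by linarith,
          show detForm x b₂ = -q by linarith]
        push_cast
        ring
      obtain ⟨y, hy, hxy⟩ := h.exists_glue_pos hxm
      exact ⟨_, hxm, y, ⟨hy, rfl⟩, hxy⟩
  · rintro μ ν m ⟨-, x, ⟨hx, rfl⟩, hmx⟩ ⟨-, y, ⟨hy, rfl⟩, hmy⟩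
    have hU1 := ((mem_dualLattice_iff h.span_eq).1 hx).1
    have hU2 := ((mem_dualLattice_iff h.span_eq).1 hy).1
    refine discGroup_mk_eq.2 ⟨Submodule.sub_mem _ hU1 hU2, ?_⟩
    have := Submodule.sub_mem _ hmx hmy
    rwa [add_sub_add_left_eq_sub] at this
  · intro ν x y hx
    constructor
    · intro hy
      obtain ⟨m, n, hmn⟩ := (hN _).1 (h.sub_mem_of_glue hy hx)
      exact ⟨m, n, by rw [← hmn]; abel⟩
    · rintro ⟨m, n, rfl⟩
      have hd : m • b₁ + n • b₂ ∈ planeLattice (detForm.orthogonal U) := (hN _).2 ⟨m, n, rfl⟩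
      obtain ⟨z, hz, hxz⟩ := hx.2
      refine ⟨Submodule.add_mem _ hx.1 (planeLattice_le_dualLattice h.span_orthogonal hd), z, hz, ?_⟩
      rw [add_right_comm]
      exact Submodule.add_mem _ hxz hd.2
  · intro μ ν m m' hm hm'
    obtain ⟨x, hx, hmx⟩ := hm.2
    obtain ⟨x', hx', hmx'⟩ := hm'.2
    obtain ⟨n, hn⟩ := h.glue_pairing hm hm' hx hx' hmx hmx'
    rw [← h.e_pairing hx hx', LinearMap.neg_apply, LinearMap.neg_apply, hn, ← e_add_int _ (-n)]
    congr 1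
    push_cast
    ring

/-- Nondegeneracy of the discriminant pairing, $N''=N$: the pairings with the dual basis vectors are
the coordinates of $x$ in the lattice basis. -/
theorem mem_of_forall_pairing (h : IsRationalPlane U) {x : Matrix (Fin 2) (Fin 2) ℝ}
    (hx : x ∈ U)
    (hxy : ∀ y ∈ dualLattice detForm (planeLattice U), ∃ n : ℤ, detForm x y = n) :
    x ∈ planeLattice U := by
  obtain ⟨b₁, b₂, hN, hU, hs⟩ := h.exists_posSystem
  obtain ⟨u, v, huv⟩ := (hU x).1 hx
  obtain ⟨_, h1, -⟩ := hs.dualVector_mem 1 0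
  obtain ⟨_, h2, -⟩ := hs.dualVector_mem 0 1
  obtain ⟨m, hm⟩ := hxy _ h1
  obtain ⟨n, hn⟩ := hxy _ h2
  rw [detForm_comm, IsCosetSystem.apply_comb _ _ _ _ u v (hs.dualVector_fst _ _)
    (hs.dualVector_snd _ _) huv] at hm hn
  refine (hN x).2 ⟨m, n, ?_⟩
  rw [← Int.cast_smul_eq_zsmul ℝ, ← Int.cast_smul_eq_zsmul ℝ, ← hm, ← hn, huv]
  simp

/-- By Cramer's rule, an element of $N'$ whose pairings with a basis are divisible by the Gram
determinant lies in $N$. Hence a class is determined by two residues modulo that determinant. -/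
theorem finite_discGroup (h : IsRationalPlane U) :
    Finite (DiscGroup detForm (planeLattice U)) := by
  obtain ⟨b₁, b₂, hN, hU, hs⟩ := h.exists_posSystem
  have hb₁ : b₁ ∈ planeLattice U := (hN _).2 ⟨1, 0, by simp⟩
  have hb₂ : b₂ ∈ planeLattice U := (hN _).2 ⟨0, 1, by simp⟩
  obtain ⟨a, ha⟩ := detForm_int hb₁.2 hb₁.2
  obtain ⟨b, hb⟩ := detForm_int hb₁.2 hb₂.2
  obtain ⟨c, hc⟩ := detForm_int hb₂.2 hb₂.2
  have hb' : detForm b₂ b₁ = b := by rw [detForm_comm, hb]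
  have hΔ : a * c - b ^ 2 ≠ 0 := by
    have h1 := hs.pos_fst
    have h2 := hs.pos_snd
    have h3 := mul_pos h1 h2
    rw [mul_sub, mul_div_cancel₀ _ h1.ne', ha, hb, hc] at h3
    have h4 : (0 : ℝ) < ((a * c - b ^ 2 : ℤ) : ℝ) := by push_cast; linarith
    exact (by exact_mod_cast h4 : (0 : ℤ) < a * c - b ^ 2).ne'
  have hΔr : (a * c - b ^ 2 : ℝ) ≠ 0 := by exact_mod_cast hΔ
  set n := (a * c - b ^ 2).natAbs with hn
  have : NeZero n := ⟨by rw [hn]; exact Int.natAbs_ne_zero.2 hΔ⟩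
  have hint : ∀ ν : DiscGroup detForm (planeLattice U), ∃ p q : ℤ,
      detForm (ν.out : Matrix (Fin 2) (Fin 2) ℝ) b₁ = p ∧
      detForm (ν.out : Matrix (Fin 2) (Fin 2) ℝ) b₂ = q := fun ν => by
    have h1 := ((mem_dualLattice_iff h.span_eq).1 ν.out.2).2
    obtain ⟨p, hp⟩ := h1 _ hb₁
    obtain ⟨q, hq⟩ := h1 _ hb₂
    exact ⟨p, q, hp, hq⟩
  choose p q hp hq using hint
  refine Finite.of_injective (β := ZMod n × ZMod n) (fun ν => (p ν, q ν)) fun μ ν hμν => ?_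
  obtain ⟨h1, h2⟩ := Prod.ext_iff.1 hμν
  simp only [ZMod.intCast_eq_intCast_iff_dvd_sub, hn, Int.natCast_natAbs, abs_dvd] at h1 h2
  obtain ⟨s, hsΔ⟩ := h1
  obtain ⟨t, htΔ⟩ := h2
  have hsΔ' : (p ν - p μ : ℝ) = (a * c - b ^ 2) * s := by exact_mod_cast hsΔ
  have htΔ' : (q ν - q μ : ℝ) = (a * c - b ^ 2) * t := by exact_mod_cast htΔ
  have hd : (ν.out : Matrix (Fin 2) (Fin 2) ℝ) - μ.out ∈ planeLattice U := by
    obtain ⟨u, v, huv⟩ := (hU _).1 (U.sub_mem ((mem_dualLattice_iff h.span_eq).1 ν.out.2).1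
      ((mem_dualLattice_iff h.span_eq).1 μ.out.2).1)
    have e1 := congrArg (fun z => detForm z b₁) huv
    have e2 := congrArg (fun z => detForm z b₂) huv
    simp only [map_sub, LinearMap.sub_apply, hp, hq, map_add, map_smul, LinearMap.add_apply,
      LinearMap.smul_apply, smul_eq_mul, ha, hb, hc, hb', hsΔ', htΔ'] at e1 e2
    have hu : u = ((c * s - b * t : ℤ) : ℝ) := by
      refine mul_left_cancel₀ hΔr ?_
      push_cast
      linear_combination (b : ℝ) * e2 - (c : ℝ) * e1
    have hv : v = ((a * t - b * s : ℤ) : ℝ) := by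
      refine mul_left_cancel₀ hΔr ?_
      push_cast
      linear_combination (b : ℝ) * e1 - (a : ℝ) * e2
    exact (hN _).2 ⟨_, _, by rw [huv, hu, hv, Int.cast_smul_eq_zsmul, Int.cast_smul_eq_zsmul]⟩
  have h3 := discGroup_mk_eq.2 hd
  have e1 : ∀ ν : DiscGroup detForm (planeLattice U), Submodule.Quotient.mk ν.out = ν :=
    fun ν => Quotient.out_eq _
  rw [e1, e1] at h3
  exact h3.symm

theorem discPairing_zero (h : IsRationalPlane U) (μ : DiscGroup detForm (planeLattice U)) :
    discPairing U μ 0 = 1 := by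
  have h0 : (0 : Matrix (Fin 2) (Fin 2) ℝ) ∈ posSet U 0 := ⟨Submodule.zero_mem _, rfl⟩
  rw [← h.e_pairing (out_mem_posSet μ) h0]
  simp [e_zero]

theorem discPairing_add (h : IsRationalPlane U) (κ μ ν : DiscGroup detForm (planeLattice U)) :
    discPairing U κ (μ + ν) = discPairing U κ μ * discPairing U κ ν := by
  have h0 : (μ.out + ν.out : Matrix (Fin 2) (Fin 2) ℝ) ∈ posSet U (μ + ν) := by
    obtain ⟨h1, h2⟩ := out_mem_posSet μ
    obtain ⟨h3, h4⟩ := out_mem_posSet ν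
    refine ⟨Submodule.add_mem _ h1 h3, ?_⟩
    conv_rhs => rw [← h2, ← h4]
    rfl
  rw [← h.e_pairing (out_mem_posSet κ) h0, ← h.e_pairing (out_mem_posSet κ) (out_mem_posSet μ),
    ← h.e_pairing (out_mem_posSet κ) (out_mem_posSet ν), ← e_add]
  congr 1
  rw [map_add]
  push_cast
  ring

/-- Orthogonality of characters on the discriminant group. -/
theorem sum_discPairing (h : IsRationalPlane U) [Fintype (DiscGroup detForm (planeLattice U))]
    [DecidableEq (DiscGroup detForm (planeLattice U))] (κ : DiscGroup detForm (planeLattice U)) :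
    ∑ μ, discPairing U κ μ =
      if κ = 0 then (Fintype.card (DiscGroup detForm (planeLattice U)) : ℂ) else 0 := by
  have hsymm : ∀ μ ν, discPairing U μ ν = discPairing U ν μ := fun μ ν => by
    rw [discPairing, discPairing, detForm_comm]
  split_ifs with h0
  · subst h0
    simp [hsymm 0, h.discPairing_zero]
  -- If every value were $1$, a representative of $\kappa$ would pair integrally with all of $N'$
  -- and so lie in $N$. With such a $\nu$, translating the sum by $\nu$ multiplies it by a factor
  -- other than $1$.
  · obtain ⟨ν, hν⟩ : ∃ ν, discPairing U κ ν ≠ 1 := by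
      by_contra! hall
      obtain ⟨hκ, hκ'⟩ := out_mem_posSet κ
      have hmem := h.mem_of_forall_pairing (h.mem_of_mem_posSet (out_mem_posSet κ)) fun y hy => by
        have h1 := hall (Submodule.Quotient.mk ⟨y, hy⟩)
        rw [← h.e_pairing (out_mem_posSet κ) ⟨hy, rfl⟩, ← Complex.ofReal_neg, e_eq_one_iff] at h1
        obtain ⟨n, hn⟩ := h1
        exact ⟨-n, by push_cast; linarith⟩
      refine h0 ?_
      rw [← hκ']
      exact (Submodule.Quotient.mk_eq_zero _).2 hmem
    have h1 : ∑ μ, discPairing U κ μ = discPairing U κ ν * ∑ μ, discPairing U κ μ := by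
      rw [Finset.mul_sum, ← Equiv.sum_comp (Equiv.addLeft ν)]
      simp only [Equiv.coe_addLeft, h.discPairing_add]
    have h2 : (1 - discPairing U κ ν) * ∑ μ, discPairing U κ μ = 0 := by
      rw [sub_mul, one_mul, ← h1, sub_self]
    exact (mul_eq_zero.1 h2).resolve_left (sub_ne_zero.2 (Ne.symm hν))

end IsRationalPlane

/-! ### The plane `v⁺(τ₁, τ₂)` at CM points -/

theorem detForm_nondegenerate : LinearMap.BilinForm.Nondegenerate detForm := by
  have h : ∀ x, (∀ y, detForm x y = 0) → x = 0 := by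
    intro x hx
    have h1 := hx !![1, 0; 0, 0]
    have h2 := hx !![0, 1; 0, 0]
    have h3 := hx !![0, 0; 1, 0]
    have h4 := hx !![0, 0; 0, 1]
    simp [detForm_apply] at h1 h2 h3 h4
    ext i j
    fin_cases i <;> fin_cases j <;> simp [h1, h2, h3, h4]
  exact ⟨h, fun y hy => h y fun x => by rw [detForm_comm]; exact hy x⟩

/-- Elements of an imaginary quadratic field have rational real part, and imaginary part a rational
multiple of that of a fixed non-real element. -/
theorem exists_rat_of_mem {K : IntermediateField ℚ ℂ} (hK : Module.finrank ℚ K = 2) {t : ℂ}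
    (ht : t ∈ K) (ht0 : t.im ≠ 0) {z : ℂ} (hz : z ∈ K) :
    (∃ p : ℚ, z.re = p) ∧ ∃ q : ℚ, z.im = q * t.im := by
  have hfin : FiniteDimensional ℚ K := Module.finite_of_finrank_eq_succ hK
  have hli : LinearIndependent ℚ ![(1 : K), ⟨t, ht⟩] := by
    rw [LinearIndependent.pair_iff]
    intro a b hab
    have h1 : (a : ℂ) + b * t = 0 := by
      have := congrArg (fun x : K => (x : ℂ)) hab
      simpa [Algebra.smul_def] using this
    have h2 := congrArg Complex.im h1
    have h3 := congrArg Complex.re h1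
    simp at h2 h3
    have hb : b = 0 := h2.resolve_right ht0
    subst hb
    simpa using h3
  have hspan := hli.span_eq_top_of_card_eq_finrank' (by simp [hK])
  have hrep : ∀ z ∈ K, ∃ a b : ℚ, z = a + b * t := by
    intro z hz
    have h1 : (⟨z, hz⟩ : K) ∈ Submodule.span ℚ (Set.range ![(1 : K), ⟨t, ht⟩]) := by
      rw [hspan]; trivial
    rw [Matrix.range_cons_cons_empty, Submodule.mem_span_pair] at h1
    obtain ⟨a, b, hab⟩ := h1
    refine ⟨a, b, ?_⟩
    have := congrArg (fun x : K => (x : ℂ)) hab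
    simpa [Algebra.smul_def] using this.symm
  -- The imaginary part of $t^2=c+dt$ gives $2\operatorname{Re}t=d$, so the real part of the
  -- generator is rational.
  obtain ⟨c, d, hcd⟩ := hrep (t * t) (K.mul_mem ht ht)
  have hre : t.re = ((d / 2 : ℚ) : ℝ) := by
    have h1 := congrArg Complex.im hcd
    simp at h1
    push_cast
    have h2 : (2 * t.re - d) * t.im = 0 := by linear_combination h1
    linarith [(mul_eq_zero.1 h2).resolve_right ht0]
  obtain ⟨a, b, rfl⟩ := hrep z hz
  refine ⟨⟨a + b * (d / 2), ?_⟩, ⟨b, by simp⟩⟩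
  simp [hre]

theorem exists_smul_mem_matLattice {x : Matrix (Fin 2) (Fin 2) ℝ}
    (hx : ∀ i j, ∃ q : ℚ, x i j = q) : ∃ d : ℝ, d ≠ 0 ∧ d • x ∈ matLattice := by
  choose q hq using hx
  refine ⟨((∏ p : Fin 2 × Fin 2, (q p.1 p.2).den : ℕ) : ℝ), ?_, fun i j => ?_⟩
  · exact_mod_cast Finset.prod_ne_zero_iff.2 fun (p : Fin 2 × Fin 2) _ => (q p.1 p.2).den_nz
  · obtain ⟨c, hc⟩ := Finset.dvd_prod_of_mem (fun p : Fin 2 × Fin 2 => (q p.1 p.2).den)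
      (Finset.mem_univ (i, j))
    refine ⟨c * (q i j).num, ?_⟩
    rw [hc, Matrix.smul_apply, hq, smul_eq_mul]
    have h1 : ((q i j : ℚ) : ℝ) * (q i j).den = (q i j).num := by
      exact_mod_cast Rat.mul_den_eq_num (q i j)
    push_cast
    rw [← h1]
    ring

/-- Both $x$ and $s^{-1}y$ become integral after clearing denominators. In the application $x$ and
$y$ are the real and imaginary parts of a matrix over $K$, and $s=\operatorname{Im}\tau_1$ is the
common irrationality. -/
theorem span_planeLattice_of_rat {x y : Matrix (Fin 2) (Fin 2) ℝ} {s : ℝ} (hs : s ≠ 0)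
    (hx : ∀ i j, ∃ q : ℚ, x i j = q) (hy : ∀ i j, ∃ q : ℚ, y i j = q * s) :
    Submodule.span ℝ (planeLattice (Submodule.span ℝ {x, y}) : Set _) =
      Submodule.span ℝ {x, y} := by
  apply le_antisymm
  · rw [Submodule.span_le]
    exact fun z hz => hz.1
  · rw [Submodule.span_le]
    have key : ∀ z ∈ Submodule.span ℝ {x, y}, ∀ d : ℝ, d ≠ 0 → d • z ∈ matLattice →
        z ∈ Submodule.span ℝ (planeLattice (Submodule.span ℝ {x, y}) :
          Set (Matrix (Fin 2) (Fin 2) ℝ)) := fun z hz d hd hdz =>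
      (Submodule.smul_mem_iff _ hd).1
        (Submodule.subset_span ⟨Submodule.smul_mem _ _ hz, hdz⟩)
    rintro z (rfl | rfl)
    · obtain ⟨d, hd, hdz⟩ := exists_smul_mem_matLattice hx
      exact key _ (Submodule.subset_span (by simp)) d hd hdz
    · obtain ⟨d, hd, hdz⟩ := exists_smul_mem_matLattice (x := s⁻¹ • z) fun i j => by
        obtain ⟨q, hq⟩ := hy i j
        exact ⟨q, by rw [Matrix.smul_apply, hq, smul_eq_mul]; field_simp⟩
      rw [smul_smul] at hdz
      exact key _ (Submodule.subset_span (by simp)) _ (mul_ne_zero hd (inv_ne_zero hs)) hdz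

/-- The isotropic vector spanning the negative plane. -/
def Zneg (τ₁ τ₂ : ℍ) : Matrix (Fin 2) (Fin 2) ℂ :=
  !![(τ₁ : ℂ) * (starRingEnd ℂ) (τ₂ : ℂ), (τ₁ : ℂ); (starRingEnd ℂ) (τ₂ : ℂ), 1]

theorem detForm_neg_combination (τ₁ τ₂ : ℍ) (a b : ℝ) :
    detForm (a • (Zneg τ₁ τ₂).map Complex.re + b • (Zneg τ₁ τ₂).map Complex.im)
      (a • (Zneg τ₁ τ₂).map Complex.re + b • (Zneg τ₁ τ₂).map Complex.im) =
      -(2 * τ₁.im * τ₂.im * (a ^ 2 + b ^ 2)) := by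
  simp [detForm_apply, Zneg]
  ring

/-- Orthogonality is a direct computation with $Z$ and its variant in which $\tau_2$ is conjugated;
equality follows because both sides have dimension two. -/
theorem orthogonal_vPlus (τ₁ τ₂ : ℍ) : detForm.orthogonal (vPlus τ₁ τ₂).carrier =
    Submodule.span ℝ {(Zneg τ₁ τ₂).map Complex.re, (Zneg τ₁ τ₂).map Complex.im} := by
  symm
  apply Submodule.eq_of_le_of_finrank_eq
  · rw [Submodule.span_le]
    rintro z hz
    refine LinearMap.BilinForm.mem_orthogonal_iff.2 fun x hx => ?_
    obtain ⟨a, b, rfl⟩ := Submodule.mem_span_pair.1 hx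
    change detForm _ _ = 0
    rcases hz with rfl | rfl <;> simp [detForm_apply, Zneg, Xmat, Ymat, Zmat] <;> ring
  · have hli : LinearIndependent ℝ
        ![(Zneg τ₁ τ₂).map Complex.re, (Zneg τ₁ τ₂).map Complex.im] := by
      rw [LinearIndependent.pair_iff]
      intro a b hab
      by_contra h
      have := combination_pos τ₁ τ₂ h
      rw [← neg_neg (2 * τ₁.im * τ₂.im * (a ^ 2 + b ^ 2)), ← detForm_neg_combination, hab] at this
      simp at this
    have h1 := finrank_span_eq_card hli
    rw [Matrix.range_cons_cons_empty, Fintype.card_fin] at h1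
    rw [h1, LinearMap.BilinForm.finrank_orthogonal detForm_nondegenerate, (vPlus τ₁ τ₂).finrank_eq,
      Module.finrank_matrix]
    simp

/-- The place where both points must lie in one quadratic field: the entries of the two isotropic
matrices all belong to $K$. The second matrix also involves $\bar\tau_2$, which is in $K$ because
$\operatorname{Re}\tau_2$ is rational. -/
theorem isRationalPlane_vPlus {K : IntermediateField ℚ ℂ} (hK : Module.finrank ℚ K = 2)
    {τ₁ τ₂ : ℍ} (hτ₁ : (τ₁ : ℂ) ∈ K) (hτ₂ : (τ₂ : ℂ) ∈ K) :
    IsRationalPlane (vPlus τ₁ τ₂).carrier := by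
  have him : (τ₁ : ℂ).im ≠ 0 := τ₁.im_pos.ne'
  have hτ₂' : (starRingEnd ℂ) (τ₂ : ℂ) ∈ K := by
    obtain ⟨⟨p, hp⟩, -⟩ := exists_rat_of_mem hK hτ₁ him hτ₂
    have : (starRingEnd ℂ) (τ₂ : ℂ) = ((2 * p : ℚ) : ℂ) - τ₂ := by
      rw [Rat.cast_mul, show ((p : ℚ) : ℂ) = ((τ₂ : ℂ).re : ℂ) by rw [hp]; simp]
      apply Complex.ext <;> simp
      ring
    rw [this]
    exact K.sub_mem (by simpa using K.algebraMap_mem (2 * p)) hτ₂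
  have hrat : ∀ Z : Matrix (Fin 2) (Fin 2) ℂ, (∀ i j, Z i j ∈ K) →
      (∀ i j, ∃ q : ℚ, Z.map Complex.re i j = q) ∧
      ∀ i j, ∃ q : ℚ, Z.map Complex.im i j = q * (τ₁ : ℂ).im := fun Z hZ =>
    ⟨fun i j => (exists_rat_of_mem hK hτ₁ him (hZ i j)).1,
      fun i j => (exists_rat_of_mem hK hτ₁ him (hZ i j)).2⟩
  have hZ : ∀ i j, Zmat τ₁ τ₂ i j ∈ K := by
    intro i j
    fin_cases i <;> fin_cases j <;> simp [Zmat, hτ₁, hτ₂, K.mul_mem, K.one_mem]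
  have hZ' : ∀ i j, Zneg τ₁ τ₂ i j ∈ K := by
    intro i j
    fin_cases i <;> fin_cases j <;> simp [Zneg, hτ₁, hτ₂', K.mul_mem, K.one_mem]
  refine ⟨(vPlus τ₁ τ₂).finrank_eq, ?_, (vPlus τ₁ τ₂).pos, ?_,
    LinearMap.BilinForm.orthogonal_orthogonal detForm_nondegenerate detForm_isSymm.isRefl _,
    span_planeLattice_of_rat him (hrat _ hZ).1 (hrat _ hZ).2, ?_⟩
  · rw [LinearMap.BilinForm.finrank_orthogonal detForm_nondegenerate, (vPlus τ₁ τ₂).finrank_eq,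
      Module.finrank_matrix]
    simp
  · intro x hx hx0
    rw [orthogonal_vPlus] at hx
    obtain ⟨a, b, rfl⟩ := Submodule.mem_span_pair.1 hx
    rw [detForm_neg_combination, neg_lt_zero]
    refine combination_pos τ₁ τ₂ ?_
    rintro ⟨rfl, rfl⟩
    simp at hx0
  · rw [orthogonal_vPlus]
    exact span_planeLattice_of_rat him (hrat _ hZ').1 (hrat _ hZ').2

/-! ### The theta functions of a rational plane -/

/-- The theta function `∑_{x ∈ ν + N} e(τ x²/2)` of the positive definite lattice. -/
def posTheta (U : Submodule ℝ (Matrix (Fin 2) (Fin 2) ℝ)) (ν : DiscGroup detForm (planeLattice U)) :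
    ℍ → ℂ := setTheta detForm (posSet U ν)

/-- The theta function `∑_{m ∈ M' ∩ (-ν + L)} e(-τ m²/2)`. -/
def negTheta (U : Submodule ℝ (Matrix (Fin 2) (Fin 2) ℝ)) (ν : DiscGroup detForm (planeLattice U)) :
    ℍ → ℂ := setTheta (-detForm) (negSet U ν)

theorem complTheta_eq (U : Submodule ℝ (Matrix (Fin 2) (Fin 2) ℝ))
    (ν : DiscGroup detForm (planeLattice U)) :
    complTheta detForm matLattice (planeLattice U) (planeLattice (detForm.orthogonal U)) ν =
      negTheta U ν := by
  ext τ
  let E : {m : dualLattice detForm (planeLattice (detForm.orthogonal U)) //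
      ∃ x : dualLattice detForm (planeLattice U), (Submodule.Quotient.mk x :
        DiscGroup detForm (planeLattice U)) = ν ∧
        (m : Matrix (Fin 2) (Fin 2) ℝ) + (x : Matrix (Fin 2) (Fin 2) ℝ) ∈ matLattice} ≃
      negSet U ν :=
    { toFun := fun m => ⟨m.1, m.1.2, m.2.choose, ⟨m.2.choose.2, m.2.choose_spec.1⟩,
        m.2.choose_spec.2⟩
      invFun := fun m => ⟨⟨m.1, m.2.1⟩, by
        obtain ⟨x, ⟨h1, h2⟩, h3⟩ := m.2.2
        exact ⟨⟨x, h1⟩, h2, h3⟩⟩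
      left_inv := fun m => rfl
      right_inv := fun m => rfl }
  rw [complTheta, negTheta, setTheta, ← E.tsum_eq]
  refine tsum_congr fun m => ?_
  congr 1
  have : ((E m : negSet U ν) : Matrix (Fin 2) (Fin 2) ℝ) = m.1 := rfl
  rw [this, LinearMap.neg_apply, LinearMap.neg_apply]
  push_cast
  ring

theorem setTheta_vadd {V : Type*} [AddCommGroup V] [Module ℝ V] (E : LinearMap.BilinForm ℝ V)
    {S : Set V} {c : ℝ} (hS : ∀ x ∈ S, ∃ n : ℤ, E x x / 2 = c + n) (τ : ℍ) :
    setTheta E S ((1 : ℝ) +ᵥ τ) = e c * setTheta E S τ := by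
  rw [setTheta, setTheta, ← tsum_mul_left]
  refine tsum_congr fun x => ?_
  obtain ⟨n, hn⟩ := hS x x.2
  rw [← e_add, UpperHalfPlane.coe_vadd, ← e_add_int (_ + _) n]
  congr 1
  rw [hn]
  push_cast
  ring

/-- Half the norm of the chosen representative of `ν`. -/
def discNorm (U : Submodule ℝ (Matrix (Fin 2) (Fin 2) ℝ))
    (ν : DiscGroup detForm (planeLattice U)) : ℝ :=
  detForm (ν.out : Matrix (Fin 2) (Fin 2) ℝ) (ν.out : Matrix (Fin 2) (Fin 2) ℝ) / 2

namespace IsRationalPlane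

variable {U : Submodule ℝ (Matrix (Fin 2) (Fin 2) ℝ)}

theorem posSet_norm (h : IsRationalPlane U) {ν : DiscGroup detForm (planeLattice U)}
    {x y : Matrix (Fin 2) (Fin 2) ℝ} (hx : x ∈ posSet U ν) (hy : y ∈ posSet U ν) :
    ∃ n : ℤ, detForm x x / 2 = detForm y y / 2 + n := by
  have h1 := posSet_sub_mem hx hy
  obtain ⟨n, hn⟩ := detForm_even h1.2
  obtain ⟨m, hm⟩ := ((mem_dualLattice_iff h.span_eq).1 hy.1).2 _ h1
  refine ⟨n + m, ?_⟩
  have h2 := detForm_comm x y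
  simp only [map_sub, LinearMap.sub_apply] at hn hm
  push_cast
  linarith

/-- Since $m+x$ is a vector of an even lattice with $m\perp x$, one has $-m^2/2\equiv x^2/2$ modulo
$1$. Therefore $\vartheta_\nu$ and $\theta_\nu$ have the same character under $T$. -/
theorem negSet_norm (h : IsRationalPlane U) {ν : DiscGroup detForm (planeLattice U)}
    {m : Matrix (Fin 2) (Fin 2) ℝ} (hm : m ∈ negSet U ν) :
    ∃ n : ℤ, (-detForm) m m / 2 = discNorm U ν + n := by
  obtain ⟨x, hx, hmx⟩ := hm.2
  obtain ⟨n, hn⟩ := detForm_even hmx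
  obtain ⟨n', hn'⟩ := h.posSet_norm hx (out_mem_posSet ν)
  refine ⟨n' - n, ?_⟩
  have h1 := detForm_eq_zero (h.mem_of_mem_posSet hx) (h.mem_of_mem_negSet hm)
  have h2 := detForm_comm x m
  simp only [map_add, LinearMap.add_apply] at hn
  rw [LinearMap.neg_apply, LinearMap.neg_apply, discNorm]
  push_cast
  linarith

theorem posTheta_vadd (h : IsRationalPlane U) (ν : DiscGroup detForm (planeLattice U)) (τ : ℍ) :
    posTheta U ν ((1 : ℝ) +ᵥ τ) = e (discNorm U ν) * posTheta U ν τ :=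
  setTheta_vadd _ (fun _ hx => h.posSet_norm hx (out_mem_posSet ν)) τ

theorem negTheta_vadd (h : IsRationalPlane U) (ν : DiscGroup detForm (planeLattice U)) (τ : ℍ) :
    negTheta U ν ((1 : ℝ) +ᵥ τ) = e (discNorm U ν) * negTheta U ν τ :=
  setTheta_vadd _ (fun _ hx => h.negSet_norm hx) τ

theorem mdiff_posTheta (h : IsRationalPlane U) (ν : DiscGroup detForm (planeLattice U)) :
    MDiff (posTheta U ν) := by
  obtain ⟨b₁, b₂, -, -, hs⟩ := h.exists_posSystem
  exact hs.mdiff_setTheta ν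

theorem mdiff_negTheta (h : IsRationalPlane U) (ν : DiscGroup detForm (planeLattice U)) :
    MDiff (negTheta U ν) := by
  obtain ⟨b₁, b₂, hs⟩ := h.exists_negSystem
  exact hs.mdiff_setTheta ν

/-- All exponents are nonnegative and congruent modulo $1$, hence at least their common fractional
part. Dividing by that power of $q$ gives a function of $q$ that stays bounded at $q=0$. -/
theorem posTheta_isBoundedAtImInfty (h : IsRationalPlane U)
    (ν : DiscGroup detForm (planeLattice U)) :
    IsBoundedAtImInfty fun τ : ℍ =>
      e (-(Int.fract (discNorm U ν) : ℝ) * (τ : ℂ)) * posTheta U ν τ := by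
  obtain ⟨b₁, b₂, -, -, hs⟩ := h.exists_posSystem
  refine (hs.summableExponents ν).isBoundedAtImInfty fun x => ?_
  obtain ⟨n, hn⟩ := h.posSet_norm x.2 (out_mem_posSet ν)
  have h0 := (hs.summableExponents ν).nonneg x
  rw [hn] at h0 ⊢
  have h1 : discNorm U ν = ⌊discNorm U ν⌋ + Int.fract (discNorm U ν) :=
    (Int.floor_add_fract _).symm
  change 0 ≤ discNorm U ν + n at h0
  change _ ≤ discNorm U ν + n
  have h2 : (-1 : ℝ) < ((⌊discNorm U ν⌋ + n : ℤ) : ℝ) := by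
    push_cast
    linarith [Int.fract_lt_one (discNorm U ν)]
  have h3 : (0 : ℝ) ≤ ((⌊discNorm U ν⌋ + n : ℤ) : ℝ) := by
    have : (-1 : ℤ) < ⌊discNorm U ν⌋ + n := by exact_mod_cast h2
    exact_mod_cast (by omega : (0 : ℤ) ≤ ⌊discNorm U ν⌋ + n)
  push_cast at h3
  linarith

theorem negTheta_isBoundedAtImInfty (h : IsRationalPlane U)
    (ν : DiscGroup detForm (planeLattice U)) : IsBoundedAtImInfty (negTheta U ν) := by
  obtain ⟨b₁, b₂, hs⟩ := h.exists_negSystem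
  have := (hs.summableExponents ν).isBoundedAtImInfty (α := 0)
    (hs.summableExponents ν).nonneg
  simp only [Complex.ofReal_zero, neg_zero, zero_mul, e_zero, one_mul] at this
  exact this

theorem posTheta_negInv (h : IsRationalPlane U) [Fintype (DiscGroup detForm (planeLattice U))]
    (τ : ℍ) (ν : DiscGroup detForm (planeLattice U)) : posTheta U ν (negInv τ) =
      -I * τ * ((Fintype.card (DiscGroup detForm (planeLattice U)) : ℝ) ^ (-(1 / 2) : ℝ) : ℝ) *
        ∑ μ, discPairing U μ ν * posTheta U μ τ := by
  classical
  obtain ⟨b₁, b₂, -, -, hs⟩ := h.exists_posSystem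
  exact hs.setTheta_negInv h.sum_discPairing h.discPairing_zero τ ν

theorem negTheta_negInv (h : IsRationalPlane U) [Fintype (DiscGroup detForm (planeLattice U))]
    (τ : ℍ) (ν : DiscGroup detForm (planeLattice U)) : negTheta U ν (negInv τ) =
      -I * τ * ((Fintype.card (DiscGroup detForm (planeLattice U)) : ℝ) ^ (-(1 / 2) : ℝ) : ℝ) *
        ∑ μ, discPairing U μ ν * negTheta U μ τ := by
  classical
  obtain ⟨b₁, b₂, hs⟩ := h.exists_negSystem
  exact hs.setTheta_negInv h.sum_discPairing h.discPairing_zero τ ν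

end IsRationalPlane

/-! ### Siegel theta functions -/

theorem span_matLattice : Submodule.span ℝ (matLattice : Set (Matrix (Fin 2) (Fin 2) ℝ)) = ⊤ := by
  rw [eq_top_iff]
  intro x _
  rw [Matrix.matrix_eq_sum_single x]
  refine Submodule.sum_mem _ fun i _ => Submodule.sum_mem _ fun j _ => ?_
  rw [← mul_one (x i j), ← smul_eq_mul, ← Matrix.smul_single]
  refine Submodule.smul_mem _ _ (Submodule.subset_span fun k l => ?_)
  rw [Matrix.single_apply]
  split_ifs
  · exact ⟨1, by simp⟩
  · exact ⟨0, by simp⟩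

theorem dualLattice_matLattice : dualLattice detForm matLattice = matLattice := by
  ext x
  rw [dualLattice, span_matLattice, Submodule.mem_inf, LinearMap.BilinForm.mem_dualSubmodule]
  simp only [Submodule.mem_one, algebraMap_int_eq, eq_intCast]
  constructor
  · rintro ⟨hx, -⟩ i j
    have hs : ∀ p q : Fin 2, Matrix.single p q (1 : ℝ) ∈ matLattice := fun p q k l => by
      rw [Matrix.single_apply]
      split_ifs
      · exact ⟨1, by simp⟩
      · exact ⟨0, by simp⟩
    fin_cases i <;> fin_cases j
    · obtain ⟨n, hn⟩ := hx _ (hs 1 1)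
      exact ⟨-n, by simp [detForm_apply] at hn; simp [hn]⟩
    · obtain ⟨n, hn⟩ := hx _ (hs 1 0)
      exact ⟨n, by simp [detForm_apply] at hn; simp [hn]⟩
    · obtain ⟨n, hn⟩ := hx _ (hs 0 1)
      exact ⟨n, by simp [detForm_apply] at hn; simp [hn]⟩
    · obtain ⟨n, hn⟩ := hx _ (hs 0 0)
      exact ⟨-n, by simp [detForm_apply] at hn; simp [hn]⟩
  · intro hx
    refine ⟨fun y hy => ?_, by simp⟩
    obtain ⟨n, hn⟩ := detForm_int hx hy
    exact ⟨n, hn.symm⟩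

theorem discGroup_matLattice_eq_zero (ν : DiscGroup detForm matLattice) : ν = 0 := by
  obtain ⟨x, rfl⟩ := Submodule.Quotient.mk_surjective _ ν
  rw [Submodule.Quotient.mk_eq_zero]
  exact dualLattice_matLattice.le x.2

theorem negRank_matLattice : negRank matLattice = 2 := by
  rw [negRank, span_matLattice, finrank_top, Module.finrank_matrix]
  norm_num

theorem negRank_planeLattice {U : Submodule ℝ (Matrix (Fin 2) (Fin 2) ℝ)} (h : IsRationalPlane U) :
    negRank (planeLattice U) = 0 := by
  rw [negRank, h.span_eq, h.finrank_eq]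
  norm_num

theorem projPos_add {v : PosPlane detForm} {x m : Matrix (Fin 2) (Fin 2) ℝ}
    (hx : x ∈ v.carrier) (hm : m ∈ detForm.orthogonal v.carrier) :
    v.projPos detForm_isSymm (m + x) = x := by
  rw [PosPlane.projPos, map_add, Submodule.projection_apply_of_mem_left _ hx,
    (Submodule.projection_apply_eq_zero_iff _).2 hm, zero_add]

theorem projNeg_add {v : PosPlane detForm} {x m : Matrix (Fin 2) (Fin 2) ℝ}
    (hx : x ∈ v.carrier) (hm : m ∈ detForm.orthogonal v.carrier) :
    v.projNeg detForm_isSymm (m + x) = m := by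
  rw [PosPlane.projNeg, projPos_add hx hm, add_sub_cancel_right]

/-- Signature $(2,0)$: the power of $y$ is trivial and every vector is its own projection, so the
Siegel theta function is holomorphic. -/
theorem siegelTheta_planeLattice {v : PosPlane detForm} (h : IsRationalPlane v.carrier) (τ : ℍ)
    (ν : DiscGroup detForm (planeLattice v.carrier)) :
    siegelTheta detForm_isSymm (planeLattice v.carrier) v τ ν = posTheta v.carrier ν τ := by
  let E : {l : dualLattice detForm (planeLattice v.carrier) // (Submodule.Quotient.mk l :
      DiscGroup detForm (planeLattice v.carrier)) = ν} ≃ posSet v.carrier ν :=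
    { toFun := fun l => ⟨l.1, l.1.2, l.2⟩
      invFun := fun l => ⟨⟨l.1, l.2.1⟩, l.2.2⟩
      left_inv := fun l => rfl
      right_inv := fun l => rfl }
  rw [siegelTheta, negRank_planeLattice h, zero_div, Real.rpow_zero, Complex.ofReal_one, one_mul,
    posTheta, setTheta, ← E.tsum_eq]
  refine tsum_congr fun l => ?_
  have hl := h.mem_of_mem_posSet (E l).2
  have h1 : v.projPos detForm_isSymm (l.1 : Matrix (Fin 2) (Fin 2) ℝ) = l.1 := by
    have := projPos_add hl (Submodule.zero_mem (detForm.orthogonal v.carrier))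
    rwa [zero_add] at this
  rw [PosPlane.projNeg, h1, sub_self, map_zero]
  have : ((E l : posSet v.carrier ν) : Matrix (Fin 2) (Fin 2) ℝ) = l.1 := rfl
  rw [this]
  congr 1
  push_cast
  ring

/-- A lattice vector splits uniquely into glued components. -/
def splitEquiv {v : PosPlane detForm} (h : IsRationalPlane v.carrier)
    (κ : DiscGroup detForm matLattice) :
    (Σ μ : DiscGroup detForm (planeLattice v.carrier), posSet v.carrier μ × negSet v.carrier μ) ≃
      {l : dualLattice detForm matLattice //
        (Submodule.Quotient.mk l : DiscGroup detForm matLattice) = κ} :=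
  Equiv.ofBijective (fun z => ⟨⟨z.2.2 + z.2.1, by
      rw [dualLattice_matLattice]
      obtain ⟨x, hx, hmx⟩ := z.2.2.2.2
      have := Submodule.add_mem _ hmx (IsRationalPlane.posSet_sub_mem z.2.1.2 hx).2
      rwa [show ((z.2.2 : Matrix (Fin 2) (Fin 2) ℝ) + x + (z.2.1 - x)) = z.2.2 + z.2.1 by abel]
        at this⟩,
      (discGroup_matLattice_eq_zero _).trans (discGroup_matLattice_eq_zero _).symm⟩) <| by
    constructor
    · rintro ⟨μ, ⟨x, hx⟩, ⟨m, hm⟩⟩ ⟨μ', ⟨x', hx'⟩, ⟨m', hm'⟩⟩ hz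
      have hz' : m + x = m' + x' := congrArg (fun z => (z.1 : Matrix (Fin 2) (Fin 2) ℝ)) hz
      have h1 := projPos_add (h.mem_of_mem_posSet hx) (h.mem_of_mem_negSet hm)
      rw [hz', projPos_add (h.mem_of_mem_posSet hx') (h.mem_of_mem_negSet hm')] at h1
      subst h1
      obtain rfl := add_right_cancel hz'
      obtain rfl : μ = μ' := by
        obtain ⟨_, rfl⟩ := hx
        obtain ⟨_, rfl⟩ := hx'
        rfl
      rfl
    · rintro ⟨⟨l, hl⟩, hκ⟩
      have hl' : l ∈ matLattice := dualLattice_matLattice.le hl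
      have hx : v.projPos detForm_isSymm l ∈ v.carrier := Submodule.projection_apply_mem _ _
      have hm : l - v.projPos detForm_isSymm l ∈ detForm.orthogonal v.carrier :=
        Submodule.sub_projection_mem _ _
      have hx2 : v.projPos detForm_isSymm l ∈ dualLattice detForm (planeLattice v.carrier) := by
        refine (mem_dualLattice_iff h.span_eq).2 ⟨hx, fun y hy => ?_⟩
        obtain ⟨n, hn⟩ := detForm_int hl' hy.2
        refine ⟨n, ?_⟩
        rw [← hn, ← sub_eq_zero, ← LinearMap.sub_apply, ← map_sub, ← neg_sub l, map_neg,
          LinearMap.neg_apply, detForm_comm, IsRationalPlane.detForm_eq_zero hy.1 hm, neg_zero]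
      have hm2 : l - v.projPos detForm_isSymm l ∈
          dualLattice detForm (planeLattice (detForm.orthogonal v.carrier)) := by
        refine (mem_dualLattice_iff h.span_orthogonal).2 ⟨hm, fun y hy => ?_⟩
        rw [map_sub, LinearMap.sub_apply, IsRationalPlane.detForm_eq_zero hx hy.1, sub_zero]
        exact detForm_int hl' hy.2
      refine ⟨⟨Submodule.Quotient.mk ⟨_, hx2⟩, ⟨_, hx2, rfl⟩, ⟨_, hm2, _, ⟨hx2, rfl⟩, by simpa⟩⟩, ?_⟩
      ext1
      ext1
      simp

/-- The Siegel theta function of `M₂(ℤ)` splits at a rational plane. -/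
theorem conj_siegelTheta_matLattice {v : PosPlane detForm} (h : IsRationalPlane v.carrier)
    [Fintype (DiscGroup detForm (planeLattice v.carrier))] (τ : ℍ)
    (κ : DiscGroup detForm matLattice) :
    (starRingEnd ℂ) (siegelTheta detForm_isSymm matLattice v τ κ) =
      τ.im * ∑ μ, (starRingEnd ℂ) (posTheta v.carrier μ τ) * negTheta v.carrier μ τ := by
  rw [siegelTheta, negRank_matLattice, div_self two_ne_zero, Real.rpow_one, map_mul,
    Complex.conj_ofReal]
  congr 1
  rw [Complex.conj_tsum, ← (splitEquiv h κ).tsum_eq]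
  obtain ⟨b₁, b₂, -, -, hs⟩ := h.exists_posSystem
  obtain ⟨c₁, c₂, hs'⟩ := h.exists_negSystem
  let F : (Σ μ : DiscGroup detForm (planeLattice v.carrier),
      posSet v.carrier μ × negSet v.carrier μ) → ℂ := fun z =>
    (starRingEnd ℂ) (e ((τ : ℂ) * (detForm z.2.1 z.2.1 / 2 : ℝ))) *
      e ((τ : ℂ) * ((-detForm) z.2.2 z.2.2 / 2 : ℝ))
  have hfib : ∀ μ, Summable fun z : posSet v.carrier μ × negSet v.carrier μ =>
      ‖F ⟨μ, z⟩‖ := fun μ => by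
    refine (((hs.summableExponents μ).summable_norm τ).mul_of_nonneg
      ((hs'.summableExponents μ).summable_norm τ) (fun _ => norm_nonneg _)
      (fun _ => norm_nonneg _)).congr fun z => ?_
    simp only [F]
    rw [norm_mul, RCLike.norm_conj]
  have hsum : Summable F := Summable.of_norm <|
    (summable_sigma_of_nonneg fun _ => norm_nonneg _).2 ⟨hfib, (hasSum_fintype _).summable⟩
  have hF : ∀ z, (starRingEnd ℂ) (e ((τ : ℂ) *
      (detForm (v.projPos detForm_isSymm ((splitEquiv h κ z).1 : Matrix (Fin 2) (Fin 2) ℝ))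
        (v.projPos detForm_isSymm ((splitEquiv h κ z).1 : Matrix (Fin 2) (Fin 2) ℝ)) : ℂ) / 2 +
      (starRingEnd ℂ) (τ : ℂ) *
      (detForm (v.projNeg detForm_isSymm ((splitEquiv h κ z).1 : Matrix (Fin 2) (Fin 2) ℝ))
        (v.projNeg detForm_isSymm ((splitEquiv h κ z).1 : Matrix (Fin 2) (Fin 2) ℝ)) : ℂ) / 2)) =
      F z := by
    intro z
    have h1 : ((splitEquiv h κ z).1 : Matrix (Fin 2) (Fin 2) ℝ) = z.2.2 + z.2.1 := rfl
    rw [h1, projPos_add (h.mem_of_mem_posSet z.2.1.2) (h.mem_of_mem_negSet z.2.2.2),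
      projNeg_add (h.mem_of_mem_posSet z.2.1.2) (h.mem_of_mem_negSet z.2.2.2)]
    simp only [F]
    rw [e_add, map_mul]
    congr 1
    · push_cast
      rw [mul_div_assoc]
    -- Conjugation turns $e(\bar\tau m^2/2)$ into $e(-\tau m^2/2)$, a term of the holomorphic theta
    -- series of the negated form.
    · rw [conj_e]
      congr 1
      rw [LinearMap.neg_apply, LinearMap.neg_apply]
      simp [Complex.conj_ofNat]
      ring
  rw [tsum_congr hF, hsum.tsum_sigma, tsum_fintype]
  refine Finset.sum_congr rfl fun μ _ => ?_
  rw [posTheta, negTheta, setTheta, setTheta, Complex.conj_tsum,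
    tsum_mul_tsum_of_summable_norm]
  · simpa using (hs.summableExponents μ).summable_norm τ
  · exact (hs'.summableExponents μ).summable_norm τ

/-! ### Smooth functions on the upper half plane and the operator `∂/∂τ` -/

/-- Real smoothness of a function on the upper half plane. -/
def RSmooth (F : ℍ → ℂ) : Prop := ∀ τ : ℍ, ContDiffAt ℝ (⊤ : ℕ∞) (F ∘ ofComplex) (τ : ℂ)

theorem RSmooth.differentiableAt {F : ℍ → ℂ} (hF : RSmooth F) (τ : ℍ) :
    DifferentiableAt ℝ (F ∘ ofComplex) (τ : ℂ) := (hF τ).differentiableAt (by simp)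

theorem RSmooth.congr_of_coe {F : ℍ → ℂ} {f : ℂ → ℂ} (hf : ∀ τ : ℍ, ContDiffAt ℝ (⊤ : ℕ∞) f τ)
    (h : ∀ τ : ℍ, F τ = f τ) : RSmooth F := fun τ => by
  refine (hf τ).congr_of_eventuallyEq ?_
  filter_upwards [isOpen_upperHalfPlaneSet.mem_nhds τ.im_pos] with z hz
  rw [Function.comp_apply, ofComplex_apply_of_im_pos hz, h]

theorem RSmooth.of_mdiff {F : ℍ → ℂ} (hF : MDiff F) : RSmooth F := fun τ => by
  rw [UpperHalfPlane.mdifferentiable_iff] at hF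
  have h1 : AnalyticAt ℂ (F ∘ ofComplex) τ :=
    hF.analyticAt (isOpen_upperHalfPlaneSet.mem_nhds τ.im_pos)
  exact (h1.contDiffAt (n := (⊤ : ℕ∞))).restrict_scalars ℝ

theorem RSmooth.add {F G : ℍ → ℂ} (hF : RSmooth F) (hG : RSmooth G) :
    RSmooth fun τ => F τ + G τ := fun τ => (hF τ).add (hG τ)

theorem RSmooth.mul {F G : ℍ → ℂ} (hF : RSmooth F) (hG : RSmooth G) :
    RSmooth fun τ => F τ * G τ := fun τ => (hF τ).mul (hG τ)

theorem RSmooth.const (c : ℂ) : RSmooth fun _ => c := fun _ => contDiffAt_const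

theorem RSmooth.sum {ι : Type*} (s : Finset ι) {F : ι → ℍ → ℂ} (hF : ∀ i ∈ s, RSmooth (F i)) :
    RSmooth fun τ => ∑ i ∈ s, F i τ := fun τ => ContDiffAt.sum fun i hi => hF i hi τ

theorem RSmooth.conj {F : ℍ → ℂ} (hF : RSmooth F) : RSmooth fun τ => (starRingEnd ℂ) (F τ) :=
  fun τ => Complex.conjCLE.contDiff.contDiffAt.comp _ (hF τ)

theorem RSmooth.continuous {F : ℍ → ℂ} (hF : RSmooth F) : Continuous F := by
  rw [continuous_iff_continuousAt]
  intro τ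
  have h1 := (hF τ).continuousAt.comp (f := UpperHalfPlane.coe) UpperHalfPlane.continuous_coe.continuousAt
  exact h1.congr (Eventually.of_forall fun σ => by simp [ofComplex_apply])

theorem dTau_eq {F : ℍ → ℂ} {τ : ℍ} {f' : ℂ →L[ℝ] ℂ} (h : HasFDerivAt (F ∘ ofComplex) f' (τ : ℂ)) :
    dTau F τ = (f' 1 - I * f' I) / 2 := by rw [dTau, h.fderiv]

theorem hasFDerivAt_of_coe {F : ℍ → ℂ} {f : ℂ → ℂ} {τ : ℍ} {f' : ℂ →L[ℝ] ℂ}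
    (hf : HasFDerivAt f f' (τ : ℂ)) (h : ∀ τ : ℍ, F τ = f τ) :
    HasFDerivAt (F ∘ ofComplex) f' (τ : ℂ) := by
  refine hf.congr_of_eventuallyEq ?_
  filter_upwards [isOpen_upperHalfPlaneSet.mem_nhds τ.im_pos] with z hz
  rw [Function.comp_apply, ofComplex_apply_of_im_pos hz, h]

theorem dTau_add {F G : ℍ → ℂ} (hF : RSmooth F) (hG : RSmooth G) (τ : ℍ) :
    dTau (fun τ => F τ + G τ) τ = dTau F τ + dTau G τ := by
  rw [dTau_eq (F := fun τ => F τ + G τ) ((hF.differentiableAt τ).hasFDerivAt.add (hG.differentiableAt τ).hasFDerivAt), dTau,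
    dTau]
  simp only [_root_.add_apply]
  ring

theorem dTau_mul {F G : ℍ → ℂ} (hF : RSmooth F) (hG : RSmooth G) (τ : ℍ) :
    dTau (fun τ => F τ * G τ) τ = dTau F τ * G τ + F τ * dTau G τ := by
  rw [dTau_eq (F := fun τ => F τ * G τ) ((hF.differentiableAt τ).hasFDerivAt.mul (hG.differentiableAt τ).hasFDerivAt), dTau,
    dTau]
  simp [ofComplex_apply]
  ring

theorem dTau_const (c : ℂ) (τ : ℍ) : dTau (fun _ => c) τ = 0 := by
  rw [dTau_eq (F := fun _ => c) (hasFDerivAt_const c (τ : ℂ))]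
  simp

theorem dTau_const_mul (c : ℂ) {F : ℍ → ℂ} (hF : RSmooth F) (τ : ℍ) :
    dTau (fun τ => c * F τ) τ = c * dTau F τ := by
  rw [dTau_mul (RSmooth.const c) hF, dTau_const]
  ring

theorem dTau_sum {ι : Type*} (s : Finset ι) {F : ι → ℍ → ℂ} (hF : ∀ i ∈ s, RSmooth (F i)) (τ : ℍ) :
    dTau (fun τ => ∑ i ∈ s, F i τ) τ = ∑ i ∈ s, dTau (F i) τ := by
  classical
  induction s using Finset.induction_on with
  | empty => simpa using dTau_const 0 τ
  | insert i s hi ih =>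
    simp only [Finset.sum_insert hi]
    rw [dTau_add (hF i (by simp)) (RSmooth.sum s fun j hj => hF j (by simp [hj])),
      ih fun j hj => hF j (by simp [hj])]

theorem dTau_of_mdiff {F : ℍ → ℂ} (hF : MDiff F) (τ : ℍ) :
    dTau F τ = deriv (F ∘ ofComplex) (τ : ℂ) := by
  have h1 := (UpperHalfPlane.mdifferentiableAt_iff.1 (hF τ)).hasDerivAt.hasFDerivAt.restrictScalars ℝ
  rw [dTau_eq h1]
  simp
  linear_combination -(deriv (F ∘ ofComplex) (τ : ℂ)) / 2 * I_mul_I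

/-- An antiholomorphic function is a constant for $\partial/\partial\tau$; this is how
$\overline{\theta_\nu}$ passes through the raising operators. -/
theorem dTau_conj_of_mdiff {F : ℍ → ℂ} (hF : MDiff F) (τ : ℍ) :
    dTau (fun τ => (starRingEnd ℂ) (F τ)) τ = 0 := by
  have h1 := (UpperHalfPlane.mdifferentiableAt_iff.1 (hF τ)).hasDerivAt.hasFDerivAt.restrictScalars ℝ
  have h2 := Complex.conjCLE.toContinuousLinearMap.hasFDerivAt.comp (τ : ℂ) h1
  rw [dTau_eq (F := fun τ => (starRingEnd ℂ) (F τ)) h2]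
  simp
  linear_combination (starRingEnd ℂ) (deriv (F ∘ ofComplex) (τ : ℂ)) * I_mul_I

theorem normalizedDeriv_eq {F : ℍ → ℂ} (hF : MDiff F) (τ : ℍ) :
    Derivative.normalizedDerivOfComplex F τ = (2 * Real.pi * I)⁻¹ * dTau F τ := by
  rw [dTau_of_mdiff hF]; rfl

theorem mdiff_iterate {F : ℍ → ℂ} (hF : MDiff F) (n : ℕ) :
    MDiff (Derivative.normalizedDerivOfComplex^[n] F) := by
  induction n with
  | zero => exact hF
  | succ n ih =>
    rw [Function.iterate_succ_apply']
    exact Derivative.normalizedDerivOfComplex_mdifferentiable ih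

/-- Pull-back of `∂/∂τ` along a holomorphic map. -/
theorem dTau_comp {F : ℍ → ℂ} (hF : RSmooth F) {φ : ℍ → ℍ} {f : ℂ → ℂ} {c : ℂ} {τ : ℍ}
    (hφ : ∀ τ : ℍ, ((φ τ : ℍ) : ℂ) = f τ) (hf : HasDerivAt f c (τ : ℂ)) :
    dTau (fun τ => F (φ τ)) τ = c * dTau F (φ τ) := by
  have h1 : HasFDerivAt (F ∘ ofComplex) (fderiv ℝ (F ∘ ofComplex) (φ τ)) (f τ) := by
    rw [← hφ]; exact (hF.differentiableAt _).hasFDerivAt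
  have h2 := h1.comp (τ : ℂ) (hf.hasFDerivAt.restrictScalars ℝ)
  rw [dTau_eq (hasFDerivAt_of_coe (F := fun τ => F (φ τ)) h2 fun σ => by
    rw [Function.comp_apply, Function.comp_apply, ← hφ, ofComplex_apply]), dTau]
  have h3 : ∀ z : ℂ, fderiv ℝ (F ∘ ofComplex) (φ τ) z =
      z.re * fderiv ℝ (F ∘ ofComplex) (φ τ) 1 + z.im * fderiv ℝ (F ∘ ofComplex) (φ τ) I := by
    intro z
    conv_lhs => rw [show z = z.re • (1 : ℂ) + z.im • I by simp [Complex.re_add_im]]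
    rw [map_add, map_smul, map_smul, Complex.real_smul, Complex.real_smul]
  simp only [ContinuousLinearMap.comp_apply, ContinuousLinearMap.coe_restrictScalars',
    ContinuousLinearMap.toSpanSingleton_apply, smul_eq_mul]
  rw [h3 (1 * c), h3 (I * c)]
  simp
  linear_combination ((c.im : ℂ) / 2 * fderiv ℝ (F ∘ ofComplex) (φ τ) I) * I_mul_I +
    (fderiv ℝ (F ∘ ofComplex) (φ τ) 1 - I * fderiv ℝ (F ∘ ofComplex) (φ τ) I) / 2 *
      Complex.re_add_im c

/-- The function `-1/(4πy)`. -/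
def cy (τ : ℍ) : ℂ := (2 * Real.pi * I)⁻¹ * ((τ : ℂ) - (starRingEnd ℂ) (τ : ℂ))⁻¹

theorem sub_conj_ne_zero (τ : ℍ) : (τ : ℂ) - (starRingEnd ℂ) (τ : ℂ) ≠ 0 := by
  rw [Complex.sub_conj]
  have := τ.im_pos.ne'
  simp [this]

theorem cy_eq (τ : ℍ) : cy τ = ((-1 / (4 * Real.pi * τ.im) : ℝ) : ℂ) := by
  rw [cy, Complex.sub_conj]
  have h1 : (τ.im : ℂ) ≠ 0 := by exact_mod_cast τ.im_pos.ne'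
  have h2 : (Real.pi : ℂ) ≠ 0 := by exact_mod_cast Real.pi_ne_zero
  push_cast
  rw [coe_im]
  field_simp
  rw [I_sq]
  norm_num

theorem hasFDerivAt_sub_conj_inv (τ : ℍ) : HasFDerivAt
    (fun z : ℂ => (2 * Real.pi * I)⁻¹ * (z - (starRingEnd ℂ) z)⁻¹)
    ((2 * Real.pi * I : ℂ)⁻¹ • (-(((τ : ℂ) - (starRingEnd ℂ) (τ : ℂ)) ^ 2)⁻¹ •
      (ContinuousLinearMap.id ℝ ℂ - Complex.conjCLE.toContinuousLinearMap))) (τ : ℂ) := by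
  have h1 : HasFDerivAt (fun z : ℂ => z - (starRingEnd ℂ) z)
      (ContinuousLinearMap.id ℝ ℂ - Complex.conjCLE.toContinuousLinearMap) (τ : ℂ) :=
    (hasFDerivAt_id (τ : ℂ)).sub Complex.conjCLE.toContinuousLinearMap.hasFDerivAt
  have h2 := ((hasDerivAt_inv (sub_conj_ne_zero τ)).comp_hasFDerivAt (τ : ℂ) h1).const_mul
    (2 * Real.pi * I : ℂ)⁻¹
  exact h2

theorem rsmooth_cy : RSmooth cy := by
  refine RSmooth.congr_of_coe (f := fun z : ℂ => (2 * Real.pi * I)⁻¹ * (z - (starRingEnd ℂ) z)⁻¹)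
    (fun τ => ?_) fun τ => rfl
  have h1 : ContDiffAt ℝ (⊤ : ℕ∞) (fun z : ℂ => z - (starRingEnd ℂ) z) (τ : ℂ) :=
    contDiffAt_id.sub Complex.conjCLE.contDiff.contDiffAt
  exact contDiffAt_const.mul (h1.inv (sub_conj_ne_zero τ))

/-- This Riccati equation keeps everything polynomial: powers of `cy` differentiate to powers of
`cy`, so iterated raising produces polynomials in `cy`. -/
theorem dTau_cy (τ : ℍ) : (2 * Real.pi * I)⁻¹ * dTau cy τ = -cy τ ^ 2 := by
  rw [dTau_eq (hasFDerivAt_of_coe (F := cy) (hasFDerivAt_sub_conj_inv τ) fun _ => rfl), cy]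
  simp
  ring_nf
  simp
  ring

/-! ### The raising operator -/

theorem raise_eq (w : ℤ) (F : ℍ → ℂ) (τ : ℍ) :
    raise w F τ = (2 * Real.pi * I)⁻¹ * dTau F τ + w * cy τ * F τ := by
  rw [raise, cy]; ring

theorem RSmooth.raise {F : ℍ → ℂ} (hF : RSmooth F) (w : ℤ) : RSmooth (raise w F) := by
  have h1 : RSmooth (dTau F) := by
    refine RSmooth.congr_of_coe (f := fun z : ℂ => (fderiv ℝ (F ∘ ofComplex) z 1 -
      I * fderiv ℝ (F ∘ ofComplex) z I) / 2) (fun τ => ?_) fun τ => rfl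
    have h2 : ContDiffAt ℝ (⊤ : ℕ∞) (fderiv ℝ (F ∘ ofComplex)) (τ : ℂ) :=
      (hF τ).fderiv_right (by simp)
    have h3 : ∀ v : ℂ, ContDiffAt ℝ (⊤ : ℕ∞) (fun z => fderiv ℝ (F ∘ ofComplex) z v) (τ : ℂ) :=
      fun v => h2.clm_apply contDiffAt_const
    exact ((h3 1).sub (contDiffAt_const.mul (h3 I))).div_const 2
  have h2 := ((RSmooth.const (2 * Real.pi * I : ℂ)⁻¹).mul h1).add
    (((RSmooth.const (w : ℂ)).mul rsmooth_cy).mul hF)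
  rwa [show (fun τ => (2 * Real.pi * I : ℂ)⁻¹ * dTau F τ + w * cy τ * F τ) = CMGreen.raise w F from
    funext fun τ => (raise_eq w F τ).symm] at h2

theorem RSmooth.raiseIter {F : ℍ → ℂ} (hF : RSmooth F) (w : ℤ) (n : ℕ) :
    RSmooth (raiseIter w n F) := by
  induction n with
  | zero => exact hF
  | succ n ih => exact ih.raise _

/-- Leibniz rule: the correction term of the raising operator is linear in the weight, and weights
add under multiplication. -/
theorem raise_mul {F G : ℍ → ℂ} (hF : RSmooth F) (hG : RSmooth G) (v w : ℤ) (τ : ℍ) :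
    raise (v + w) (fun τ => F τ * G τ) τ = raise v F τ * G τ + F τ * raise w G τ := by
  rw [raise_eq, raise_eq, raise_eq, dTau_mul hF hG]
  push_cast
  ring

theorem raise_sum {ι : Type*} (s : Finset ι) (c : ι → ℂ) {F : ι → ℍ → ℂ}
    (hF : ∀ i ∈ s, RSmooth (F i)) (w : ℤ) (τ : ℍ) :
    raise w (fun τ => ∑ i ∈ s, c i * F i τ) τ = ∑ i ∈ s, c i * raise w (F i) τ := by
  rw [raise_eq, dTau_sum s fun i hi => (RSmooth.const (c i)).mul (hF i hi), Finset.mul_sum,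
    Finset.mul_sum, ← Finset.sum_add_distrib]
  refine Finset.sum_congr rfl fun i hi => ?_
  rw [dTau_const_mul _ (hF i hi), raise_eq]
  ring

theorem raiseIter_sum {ι : Type*} (s : Finset ι) (c : ι → ℂ) {F : ι → ℍ → ℂ}
    (hF : ∀ i ∈ s, RSmooth (F i)) (w : ℤ) (n : ℕ) (τ : ℍ) :
    raiseIter w n (fun τ => ∑ i ∈ s, c i * F i τ) τ = ∑ i ∈ s, c i * raiseIter w n (F i) τ := by
  induction n generalizing τ with
  | zero => rfl
  | succ n ih =>
    have h1 : raiseIter w n (fun τ => ∑ i ∈ s, c i * F i τ) =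
      fun τ => ∑ i ∈ s, c i * raiseIter w n (F i) τ := funext ih
    rw [raiseIter, h1, raise_sum s c (fun i hi => (hF i hi).raiseIter w n)]
    rfl

theorem hasDerivAt_neg_inv {z : ℂ} (hz : z ≠ 0) : HasDerivAt (fun z : ℂ => -1 / z) (1 / z ^ 2) z := by
  have := (hasDerivAt_inv hz).const_mul (-1)
  refine (this.congr_deriv (by field_simp)).congr_of_eventuallyEq ?_
  exact Eventually.of_forall fun w => by simp [div_eq_mul_inv]

/-- Equivariance of the raising operator under `τ ↦ -1/τ`. -/
theorem raise_negInv {F G : ℍ → ℂ} (hF : RSmooth F) (hG : RSmooth G) {w : ℤ}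
    (h : ∀ τ, F (negInv τ) = (τ : ℂ) ^ w * G τ) (τ : ℍ) :
    raise w F (negInv τ) = (τ : ℂ) ^ (w + 2) * raise w G τ := by
  have hτ := τ.ne_zero
  have h1 : dTau (fun τ => F (negInv τ)) τ = 1 / (τ : ℂ) ^ 2 * dTau F (negInv τ) :=
    dTau_comp hF coe_negInv (hasDerivAt_neg_inv hτ)
  have hz : RSmooth fun τ : ℍ => (τ : ℂ) ^ w := by
    refine RSmooth.congr_of_coe (f := fun z => z ^ w) (fun τ => ?_) fun _ => rfl
    have h3 : AnalyticAt ℂ (fun z : ℂ => z ^ w) τ := analyticAt_id.zpow τ.ne_zero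
    exact (h3.contDiffAt (n := (⊤ : ℕ∞))).restrict_scalars ℝ
  have hzd : dTau (fun τ : ℍ => (τ : ℂ) ^ w) τ = w * (τ : ℂ) ^ (w - 1) := by
    rw [dTau_eq (hasFDerivAt_of_coe (F := fun τ : ℍ => (τ : ℂ) ^ w)
      ((hasDerivAt_zpow w (τ : ℂ) (Or.inl hτ)).hasFDerivAt.restrictScalars ℝ) fun _ => rfl)]
    simp
    linear_combination -(w * (τ : ℂ) ^ (w - 1)) / 2 * I_mul_I
  have h2 : dTau F (negInv τ) = (τ : ℂ) ^ 2 *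
      (w * (τ : ℂ) ^ (w - 1) * G τ + (τ : ℂ) ^ w * dTau G τ) := by
    rw [← hzd, ← dTau_mul hz hG, ← funext h, h1]
    field_simp
  have hcy : cy (negInv τ) = (τ : ℂ) * (starRingEnd ℂ) (τ : ℂ) * cy τ := by
    rw [cy, cy, coe_negInv]
    have h4 : (starRingEnd ℂ) (τ : ℂ) ≠ 0 := by simpa using hτ
    have h5 : -1 / (τ : ℂ) - (starRingEnd ℂ) (-1 / (τ : ℂ)) =
        ((τ : ℂ) - (starRingEnd ℂ) (τ : ℂ)) / ((τ : ℂ) * (starRingEnd ℂ) (τ : ℂ)) := by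
      rw [map_div₀, map_neg, map_one]
      field_simp
      ring
    rw [h5, inv_div]
    ring
  -- Replacing $\bar\tau$ by $\tau$ next to `cy` costs a constant. This makes `cy` quasimodular of
  -- weight two, and the defect cancels the derivative of $\tau^w$.
  have hcy2 : 2 * Real.pi * I * (cy τ * (starRingEnd ℂ) (τ : ℂ)) =
      2 * Real.pi * I * cy τ * τ - 1 := by
    have := sub_conj_ne_zero τ
    have h6 := Complex.two_pi_I_ne_zero
    rw [cy]
    field_simp
    ring
  rw [raise_eq, raise_eq, h2, h, hcy, zpow_sub_one₀ hτ, zpow_add₀ hτ]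
  have : (τ : ℂ) ^ (2 : ℤ) = (τ : ℂ) ^ 2 := by norm_cast
  rw [this]
  field_simp
  linear_combination (w * G τ) * hcy2

/-- Keeping $F$ and $G$ distinct covers vector-valued transformations, where $G$ is a linear
combination of several components. -/
theorem raiseIter_negInv {F G : ℍ → ℂ} (hF : RSmooth F) (hG : RSmooth G) {w : ℤ}
    (h : ∀ τ, F (negInv τ) = (τ : ℂ) ^ w * G τ) (n : ℕ) (τ : ℍ) :
    raiseIter w n F (negInv τ) = (τ : ℂ) ^ (w + 2 * n) * raiseIter w n G τ := by
  induction n generalizing τ with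
  | zero => simpa [raiseIter] using h τ
  | succ n ih =>
    rw [raiseIter, raiseIter, raise_negInv (hF.raiseIter w n) (hG.raiseIter w n) ih]
    congr 2
    push_cast
    ring

/-- Equivariance of `∂/∂τ` under `τ ↦ τ + 1`. -/
theorem dTau_vadd {F : ℍ → ℂ} (hF : RSmooth F) {c : ℂ} (h : ∀ τ, F ((1 : ℝ) +ᵥ τ) = c * F τ)
    (τ : ℍ) : dTau F ((1 : ℝ) +ᵥ τ) = c * dTau F τ := by
  have h1 : dTau (fun τ => F ((1 : ℝ) +ᵥ τ)) τ = 1 * dTau F ((1 : ℝ) +ᵥ τ) :=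
    dTau_comp hF (f := fun z => ((1 : ℝ) : ℂ) + z) (UpperHalfPlane.coe_vadd 1)
      ((hasDerivAt_id (τ : ℂ)).const_add _)
  rw [← dTau_const_mul c hF, ← funext h, h1, one_mul]

theorem cy_vadd (τ : ℍ) : cy ((1 : ℝ) +ᵥ τ) = cy τ := by
  rw [cy_eq, cy_eq, UpperHalfPlane.vadd_im]

theorem raiseIter_vadd {F : ℍ → ℂ} (hF : RSmooth F) {c : ℂ}
    (h : ∀ τ, F ((1 : ℝ) +ᵥ τ) = c * F τ) (w : ℤ) (n : ℕ) (τ : ℍ) :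
    raiseIter w n F ((1 : ℝ) +ᵥ τ) = c * raiseIter w n F τ := by
  induction n generalizing τ with
  | zero => exact h τ
  | succ n ih =>
    rw [raiseIter, raise_eq, raise_eq, dTau_vadd (hF.raiseIter w n) ih, ih, cy_vadd]
    ring

theorem iterate_normalizedDeriv_vadd {F : ℍ → ℂ} (hF : MDiff F) {c : ℂ}
    (h : ∀ τ, F ((1 : ℝ) +ᵥ τ) = c * F τ) (n : ℕ) (τ : ℍ) :
    Derivative.normalizedDerivOfComplex^[n] F ((1 : ℝ) +ᵥ τ) =
      c * Derivative.normalizedDerivOfComplex^[n] F τ := by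
  induction n generalizing τ with
  | zero => exact h τ
  | succ n ih =>
    simp only [Function.iterate_succ_apply']
    rw [normalizedDeriv_eq (mdiff_iterate hF n), normalizedDeriv_eq (mdiff_iterate hF n),
      dTau_vadd (RSmooth.of_mdiff (mdiff_iterate hF n)) ih]
    ring

/-! ### Rankin–Cohen brackets and raising operators -/

/-- The falling factorial `x (x - 1) ⋯ (x - j + 1)`. -/
def fallingProd (x : ℂ) (j : ℕ) : ℂ := ∏ i ∈ Finset.range j, (x - i)

theorem fallingProd_succ (x : ℂ) (j : ℕ) : fallingProd x (j + 1) = fallingProd x j * (x - j) :=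
  Finset.prod_range_succ _ _

theorem fallingProd_succ' (x : ℂ) (j : ℕ) :
    fallingProd x (j + 1) = x * fallingProd (x - 1) j := by
  rw [fallingProd, Finset.prod_range_succ', fallingProd]
  simp only [Nat.cast_zero, sub_zero, Nat.cast_add, Nat.cast_one]
  rw [mul_comm]
  congr 1
  exact Finset.prod_congr rfl fun i _ => by ring

/-- The coefficients in the expansion of an iterated raising operator. -/
def raiseCoeff (w : ℂ) (n j : ℕ) : ℂ := n.choose j * fallingProd (w + n - 1) j

theorem raiseCoeff_zero (w : ℂ) (n : ℕ) : raiseCoeff w n 0 = 1 := by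
  simp [raiseCoeff, fallingProd]

theorem raiseCoeff_succ_self (w : ℂ) (n : ℕ) : raiseCoeff w n (n + 1) = 0 := by
  simp [raiseCoeff]

theorem natCast_choose_succ_mul (n j : ℕ) :
    (n.choose (j + 1) : ℂ) * (j + 1) = n.choose j * (n - j) := by
  rcases le_or_gt j n with h | h
  · have := Nat.choose_succ_right_eq n j
    rw [← Nat.cast_sub h]
    exact_mod_cast this
  · rw [Nat.choose_eq_zero_of_lt h, Nat.choose_eq_zero_of_lt (by omega)]
    simp

/-- The recursion produced by one more raising: the weight contributes $w+2n$ and the derivative of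
the $j$-th power of `cy` contributes $-j$. -/
theorem raiseCoeff_succ_succ (w : ℂ) (n j : ℕ) :
    raiseCoeff w (n + 1) (j + 1) = raiseCoeff w n (j + 1) + (w + 2 * n - j) * raiseCoeff w n j := by
  simp only [raiseCoeff]
  rw [fallingProd_succ', fallingProd_succ]
  have h2 := natCast_choose_succ_mul n j
  push_cast [Nat.choose_succ_succ]
  rw [show w + ((n : ℂ) + 1) - 1 - 1 = w + n - 1 by ring]
  linear_combination fallingProd (w + n - 1) j * h2

/-- Coefficient form of the differential equation satisfied by `raisePoly` in its last variable,
which drives `bracketSum_raisePoly`. -/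
theorem succ_mul_raiseCoeff (w : ℂ) (n j : ℕ) :
    (j + 1) * raiseCoeff w (n + 1) (j + 1) = (n + 1) * (w + n) * raiseCoeff w n j := by
  simp only [raiseCoeff]
  rw [fallingProd_succ']
  have h2 : ((n : ℂ) + 1) * n.choose j = (n + 1).choose (j + 1) * (j + 1) := by
    exact_mod_cast Nat.add_one_mul_choose_eq n j
  push_cast
  rw [show w + ((n : ℂ) + 1) - 1 - 1 = w + n - 1 by ring]
  linear_combination -(w + n) * fallingProd (w + n - 1) j * h2

/-- The polynomial `∑ a_j c^j f_{n-j}` expressing an iterated raising operator. -/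
def raisePoly (w : ℂ) (f : ℕ → ℂ) (n : ℕ) (c : ℂ) : ℂ :=
  ∑ j ∈ Finset.range (n + 1), raiseCoeff w n j * c ^ j * f (n - j)

theorem raisePoly_zero (w : ℂ) (f : ℕ → ℂ) (n : ℕ) : raisePoly w f n 0 = f n := by
  rw [raisePoly, Finset.sum_range_succ']
  simp [raiseCoeff_zero]

theorem hasDerivAt_raisePoly_zero (w : ℂ) (f : ℕ → ℂ) (c : ℂ) :
    HasDerivAt (raisePoly w f 0) 0 c := by
  have : raisePoly w f 0 = fun _ => f 0 := by
    funext c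
    simp [raisePoly, raiseCoeff_zero]
  rw [this]
  exact hasDerivAt_const _ _

theorem hasDerivAt_raisePoly_succ (w : ℂ) (f : ℕ → ℂ) (n : ℕ) (c : ℂ) :
    HasDerivAt (raisePoly w f (n + 1)) ((n + 1) * (w + n) * raisePoly w f n c) c := by
  have h1 : ∀ j ∈ Finset.range (n + 1 + 1), HasDerivAt
      (fun c : ℂ => raiseCoeff w (n + 1) j * c ^ j * f (n + 1 - j))
      (raiseCoeff w (n + 1) j * (j * c ^ (j - 1)) * f (n + 1 - j)) c := fun j _ =>
    ((hasDerivAt_pow j c).const_mul _).mul_const _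
  have h2 := HasDerivAt.fun_sum h1
  refine h2.congr_deriv ?_
  rw [Finset.sum_range_succ', raisePoly, Finset.mul_sum]
  simp only [Nat.cast_zero, zero_mul, mul_zero, add_zero]
  refine Finset.sum_congr rfl fun j _ => ?_
  rw [Nat.add_sub_cancel, Nat.add_sub_add_right]
  push_cast
  linear_combination c ^ j * f (n - j) * succ_mul_raiseCoeff w n j

theorem rsmooth_cy_pow (j : ℕ) : RSmooth fun τ => cy τ ^ j := by
  induction j with
  | zero => simpa using RSmooth.const 1
  | succ j ih => simpa only [pow_succ] using ih.mul rsmooth_cy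

theorem dTau_cy_pow (j : ℕ) (τ : ℍ) :
    (2 * Real.pi * I)⁻¹ * dTau (fun τ => cy τ ^ j) τ = -j * cy τ ^ (j + 1) := by
  induction j with
  | zero => simp [dTau_const]
  | succ j ih =>
    simp only [pow_succ]
    rw [dTau_mul (rsmooth_cy_pow j) rsmooth_cy]
    push_cast
    linear_combination cy τ * ih + cy τ ^ j * dTau_cy τ

/-- Holomorphy turns $\partial/\partial\tau$ into the ordinary derivative, so by induction all
nonholomorphic dependence sits in powers of `cy`, with the coefficients governed by
`raiseCoeff_succ_succ`. -/
theorem raiseIter_eq_raisePoly (w : ℤ) {F : ℍ → ℂ} (hF : MDiff F) (n : ℕ) (τ : ℍ) :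
    raiseIter w n F τ =
      raisePoly w (fun m => Derivative.normalizedDerivOfComplex^[m] F τ) n (cy τ) := by
  induction n generalizing τ with
  | zero => simp [raiseIter, raisePoly, raiseCoeff_zero]
  | succ n ih =>
    set D : ℕ → ℍ → ℂ := fun m => Derivative.normalizedDerivOfComplex^[m] F with hD
    have hsm : ∀ m, RSmooth (D m) := fun m => RSmooth.of_mdiff (mdiff_iterate hF m)
    have hDs : ∀ m τ, (2 * Real.pi * I)⁻¹ * dTau (D m) τ = D (m + 1) τ := fun m τ => by
      rw [← normalizedDeriv_eq (mdiff_iterate hF m), hD]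
      simp only [Function.iterate_succ_apply']
    have h1 : raiseIter w n F = fun τ => ∑ j ∈ Finset.range (n + 1),
        raiseCoeff w n j * (cy τ ^ j * D (n - j) τ) := by
      funext τ
      rw [ih, raisePoly]
      exact Finset.sum_congr rfl fun j _ => mul_assoc _ _ _
    rw [raiseIter, h1, raise_sum _ _ fun j _ => (rsmooth_cy_pow j).mul (hsm _)]
    have h2 : ∀ j ∈ Finset.range (n + 1), raiseCoeff w n j *
        raise (w + 2 * n) (fun τ => cy τ ^ j * D (n - j) τ) τ =
        (w + 2 * n - j) * raiseCoeff w n j * cy τ ^ (j + 1) * D (n + 1 - (j + 1)) τ +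
          raiseCoeff w n j * cy τ ^ j * D (n + 1 - j) τ := by
      intro j hj
      have hj' : j ≤ n := Nat.lt_succ_iff.1 (Finset.mem_range.1 hj)
      rw [raise_eq, dTau_mul (rsmooth_cy_pow j) (hsm _), Nat.add_sub_add_right,
        Nat.sub_add_comm hj', ← hDs]
      push_cast
      linear_combination raiseCoeff w n j * D (n - j) τ * dTau_cy_pow j τ
    rw [Finset.sum_congr rfl h2, Finset.sum_add_distrib]
    have h3 : ∑ j ∈ Finset.range (n + 1), raiseCoeff w n j * cy τ ^ j * D (n + 1 - j) τ =
        ∑ j ∈ Finset.range (n + 1 + 1), raiseCoeff w n j * cy τ ^ j * D (n + 1 - j) τ := by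
      rw [Finset.sum_range_succ _ (n + 1), raiseCoeff_succ_self]
      ring
    rw [h3, raisePoly, Finset.sum_range_succ' _ (n + 1), Finset.sum_range_succ' _ (n + 1), ← add_assoc,
      ← Finset.sum_add_distrib, raiseCoeff_zero, raiseCoeff_zero]
    congr 1
    refine Finset.sum_congr rfl fun j _ => ?_
    rw [raiseCoeff_succ_succ]
    ring

theorem succ_mul_intChoose (x : ℤ) (s : ℕ) :
    ((s : ℂ) + 1) * (Ring.choose x (s + 1) : ℤ) = (x - s) * (Ring.choose x s : ℤ) := by
  have h := Ring.choose_smul_choose x (n := s + 1) (k := s) (Nat.le_succ s)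
  rw [Nat.choose_succ_self_right, Nat.add_sub_cancel_left, Ring.choose_one_right, nsmul_eq_mul] at h
  have h' := congrArg (fun z : ℤ => (z : ℂ)) h
  push_cast at h'
  rw [h']
  ring

/-- The Rankin–Cohen bracket with the derivatives replaced by arbitrary sequences. -/
def bracketSum (k l : ℤ) (r : ℕ) (f g : ℕ → ℂ) : ℂ :=
  ∑ s ∈ Finset.range (r + 1), (-1 : ℂ) ^ s * (Ring.choose (k + r - 1) s : ℤ) *
    (Ring.choose (l + r - 1) (r - s) : ℤ) * f (r - s) * g s

/-- The variable $c$ is treated as free. The derivative of the bracket in $c$ vanishes identically,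
so $c$ may be set to zero, where each raising polynomial reduces to the plain derivative. -/
theorem bracketSum_raisePoly (k l : ℤ) (r : ℕ) (f g : ℕ → ℂ) (c : ℂ) :
    bracketSum k l r (fun n => raisePoly k f n c) (fun n => raisePoly l g n c) =
      bracketSum k l r f g := by
  cases r with
  | zero =>
    simp [bracketSum, raisePoly, raiseCoeff_zero]
  | succ r =>
  set A : ℕ → ℂ → ℂ := raisePoly k f with hA
  set B : ℕ → ℂ → ℂ := raisePoly l g with hB
  let A' : ℕ → ℂ → ℂ := fun n c => n * (k + n - 1) * A (n - 1) c
  let B' : ℕ → ℂ → ℂ := fun n c => n * (l + n - 1) * B (n - 1) c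
  have hA' : ∀ n c, HasDerivAt (A n) (A' n c) c := by
    rintro (_ | n) c
    · simpa [A'] using hasDerivAt_raisePoly_zero k f c
    · refine (hasDerivAt_raisePoly_succ k f n c).congr_deriv ?_
      simp only [A', Nat.add_sub_cancel]
      push_cast
      ring
  have hB' : ∀ n c, HasDerivAt (B n) (B' n c) c := by
    rintro (_ | n) c
    · simpa [B'] using hasDerivAt_raisePoly_zero l g c
    · refine (hasDerivAt_raisePoly_succ l g n c).congr_deriv ?_
      simp only [B', Nat.add_sub_cancel]
      push_cast
      ring
  let C : ℕ → ℂ := fun s => (Ring.choose (k + (r + 1 : ℕ) - 1) s : ℤ)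
  let E : ℕ → ℂ := fun s => (Ring.choose (l + (r + 1 : ℕ) - 1) s : ℤ)
  have hC : ∀ s : ℕ, ((s : ℂ) + 1) * C (s + 1) = (k + r - s) * C s := fun s => by
    refine (succ_mul_intChoose (k + (r + 1 : ℕ) - 1) s).trans ?_
    change _ * C s = _ * C s
    congr 1
    push_cast
    ring
  have hE : ∀ s : ℕ, ((s : ℂ) + 1) * E (s + 1) = (l + r - s) * E s := fun s => by
    refine (succ_mul_intChoose (l + (r + 1 : ℕ) - 1) s).trans ?_
    change _ * E s = _ * E s
    congr 1
    push_cast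
    ring
  have hd : ∀ c, HasDerivAt (fun c => bracketSum k l (r + 1) (fun n => A n c) (fun n => B n c)) 0 c := by
    intro c
    have h1 : ∀ s ∈ Finset.range (r + 1 + 1), HasDerivAt
        (fun c : ℂ => (-1 : ℂ) ^ s * C s * E (r + 1 - s) * A (r + 1 - s) c * B s c)
        ((-1 : ℂ) ^ s * C s * E (r + 1 - s) * A' (r + 1 - s) c * B s c +
          (-1 : ℂ) ^ s * C s * E (r + 1 - s) * A (r + 1 - s) c * B' s c) c := fun s _ =>
      ((hA' (r + 1 - s) c).const_mul _).mul (hB' s c)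
    refine (HasDerivAt.fun_sum h1).congr_deriv ?_
    rw [Finset.sum_add_distrib, Finset.sum_range_succ _ (r + 1), Finset.sum_range_succ' _ (r + 1)]
    simp only [A', B', Nat.sub_self, Nat.cast_zero, zero_mul, mul_zero, add_zero]
    rw [← Finset.sum_add_distrib]
    -- With $m=r-s$, both halves are multiples of $A_mB_s$ once the second is reindexed. The
    -- recurrences for the two binomial coefficients make them cancel.
    refine Finset.sum_eq_zero fun s hs => ?_
    obtain ⟨m, rfl⟩ := Nat.exists_eq_add_of_le (Nat.lt_succ_iff.1 (Finset.mem_range.1 hs))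
    rw [show s + m + 1 - s = m + 1 by omega, show s + m + 1 - (s + 1) = m by omega,
      Nat.add_sub_cancel, Nat.add_sub_cancel]
    have e1 := hC s
    have e2 := hE m
    push_cast at e1 e2 ⊢
    rw [pow_succ]
    linear_combination ((-1 : ℂ) ^ s * C s * (k + m) * A m c * B s c) * e2 -
      ((-1 : ℂ) ^ s * E m * (l + s) * A m c * B s c) * e1
  have hconst := is_const_of_deriv_eq_zero (fun c => (hd c).differentiableAt)
    (fun c => (hd c).deriv) c 0
  simp only [hA, hB, raisePoly_zero] at hconst
  exact hconst

/-- In a Rankin–Cohen bracket, derivatives may be replaced by raising operators. -/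
theorem rankinCohen_eq_raise (k l : ℤ) (r : ℕ) {F G : ℍ → ℂ} (hF : MDiff F) (hG : MDiff G) (τ : ℍ) :
    rankinCohen k l r F G τ =
      bracketSum k l r (fun n => raiseIter k n F τ) (fun n => raiseIter l n G τ) := by
  simp only [raiseIter_eq_raisePoly _ hF, raiseIter_eq_raisePoly _ hG, bracketSum_raisePoly]
  rfl

/-- The coefficients of `(-1)^r [·,·]_r` in weights `-2r` and `1`. -/
def bracketCoeff (r s : ℕ) : ℂ :=
  (-1 : ℂ) ^ r * (-1 : ℂ) ^ s * (Ring.choose (-(r : ℤ) - 1) s : ℤ) * (Ring.choose (r : ℤ) (r - s) : ℤ)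

/-- Chu–Vandermonde: $\sum_s\binom{-r-1}{s}\binom{r}{r-s}=\binom{-1}{r}=(-1)^r$. This is why the
normalization $(-1)^{k-1}$ makes the lifts equal rather than merely proportional. -/
theorem sum_bracketCoeff (r : ℕ) :
    ∑ s ∈ Finset.range (r + 1), (-1 : ℂ) ^ s * bracketCoeff r s = 1 := by
  have h1 := Ring.add_choose_eq r (Commute.all (-(r : ℤ) - 1) r)
  rw [show -(r : ℤ) - 1 + r = -1 by ring, Ring.choose_neg', Ring.multichoose_one,
    Finset.Nat.sum_antidiagonal_eq_sum_range_succ_mk] at h1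
  have h2 : ∀ s, (-1 : ℂ) ^ s * bracketCoeff r s = (-1 : ℂ) ^ r *
      ((Ring.choose (-(r : ℤ) - 1) s * Ring.choose (r : ℤ) (r - s) : ℤ) : ℂ) := fun s => by
    have h3 : ((-1 : ℂ) ^ s) * (-1) ^ s = 1 := by rw [← mul_pow]; simp
    rw [bracketCoeff]
    push_cast
    linear_combination ((-1 : ℂ) ^ r * (Ring.choose (-(r : ℤ) - 1) s : ℤ) *
      (Ring.choose (r : ℤ) (r - s) : ℤ)) * h3
  rw [Finset.sum_congr rfl fun s _ => h2 s, ← Finset.mul_sum, ← Int.cast_sum, ← h1]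
  rw [Units.smul_def, Int.negOnePow_def, zpow_natCast]
  push_cast
  rw [smul_eq_mul, mul_one]
  push_cast
  rw [← mul_pow]
  simp

/-- Modulo sums of neighbours, each term is the negative of its predecessor, so
$t_s\equiv(-1)^st_0$. -/
theorem alternating_sub (t : ℕ → ℂ) (s : ℕ) :
    t s - (-1) ^ s * t 0 = -∑ i ∈ Finset.range s, (-1) ^ (s + i) * (t i + t (i + 1)) := by
  induction s with
  | zero => simp
  | succ s ih =>
    rw [Finset.sum_range_succ]
    have h1 : ∑ i ∈ Finset.range s, (-1 : ℂ) ^ (s + 1 + i) * (t i + t (i + 1)) =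
        -∑ i ∈ Finset.range s, (-1 : ℂ) ^ (s + i) * (t i + t (i + 1)) := by
      rw [← Finset.sum_neg_distrib]
      exact Finset.sum_congr rfl fun i _ => by ring
    have h3 : (-1 : ℂ) ^ (s + 1 + s) = -1 := by
      rw [show s + 1 + s = 2 * s + 1 by ring, pow_succ, pow_mul]; simp
    rw [h1, h3, pow_succ]
    linear_combination -ih

/-- Modulo sums of neighbouring terms, the bracket in weights `-2r` and `1` equals its first
term. -/
theorem exists_bracketSum_eq (r : ℕ) : ∃ b : ℕ → ℂ, ∀ f g : ℕ → ℂ,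
    (-1) ^ r * bracketSum (-2 * r) 1 r f g = f r * g 0 +
      ∑ i ∈ Finset.range r, b i * (f (r - i) * g i + f (r - (i + 1)) * g (i + 1)) := by
  -- The pair with index $i$ is used in reducing every $t_s$ with $s>i$ to $t_0$; exchanging the
  -- summations collects these contributions into $b_i$.
  refine ⟨fun i => ∑ s ∈ (Finset.range (r + 1)).filter (i < ·), -bracketCoeff r s * (-1) ^ (s + i),
    fun f g => ?_⟩
  let t : ℕ → ℂ := fun s => f (r - s) * g s
  have h1 : (-1) ^ r * bracketSum (-2 * r) 1 r f g =
      ∑ s ∈ Finset.range (r + 1), bracketCoeff r s * t s := by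
    rw [bracketSum, Finset.mul_sum]
    refine Finset.sum_congr rfl fun s _ => ?_
    rw [bracketCoeff, show -2 * (r : ℤ) + r - 1 = -(r : ℤ) - 1 by ring,
      show (1 : ℤ) + r - 1 = r by ring]
    ring
  have h2 : ∀ s, bracketCoeff r s * t s = (-1) ^ s * bracketCoeff r s * t 0 +
      ∑ i ∈ Finset.range s, -bracketCoeff r s * (-1) ^ (s + i) * (t i + t (i + 1)) := fun s => by
    simp only [mul_assoc, ← Finset.mul_sum]
    linear_combination bracketCoeff r s * alternating_sub t s
  rw [h1, Finset.sum_congr rfl fun s _ => h2 s, Finset.sum_add_distrib, ← Finset.sum_mul,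
    sum_bracketCoeff, one_mul]
  congr 1
  simp only [Finset.sum_mul]
  rw [Finset.sum_comm']
  intro s i
  simp only [Finset.mem_range, Finset.mem_filter]
  omega

/-! ### Meromorphy at the cusp -/

theorem isMeromorphicAtCusp_iff {F : ℍ → ℂ} : IsMeromorphicAtCusp F ↔
    ∃ n : ℕ, ∃ C A : ℝ, ∀ τ : ℍ, A ≤ τ.im → ‖F τ‖ ≤ C * Real.exp (2 * Real.pi * n * τ.im) := by
  refine exists_congr fun n => ?_
  rw [UpperHalfPlane.isBoundedAtImInfty_iff]
  refine exists_congr fun C => exists_congr fun A => forall_congr' fun τ => imp_congr_right fun _ => ?_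
  rw [norm_mul, norm_e]
  have : -(2 * Real.pi * ((n : ℂ) * (τ : ℂ)).im) = -(2 * Real.pi * n * τ.im) := by
    simp
    ring
  rw [this, Real.exp_neg, inv_mul_le_iff₀ (Real.exp_pos _), mul_comm C]

theorem IsMeromorphicAtCusp.of_isBounded {F : ℍ → ℂ} (h : IsBoundedAtImInfty F) :
    IsMeromorphicAtCusp F := ⟨0, by simpa [e_zero] using h⟩

theorem IsMeromorphicAtCusp.mul {F G : ℍ → ℂ} (hF : IsMeromorphicAtCusp F)
    (hG : IsMeromorphicAtCusp G) : IsMeromorphicAtCusp fun τ => F τ * G τ := by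
  obtain ⟨m, hm⟩ := hF
  obtain ⟨n, hn⟩ := hG
  refine ⟨m + n, ?_⟩
  have h1 := hm.mul hn
  refine h1.congr_left fun τ => ?_
  simp only [Pi.mul_apply]
  push_cast
  rw [add_mul, e_add]
  ring

theorem IsMeromorphicAtCusp.const (c : ℂ) : IsMeromorphicAtCusp fun _ => c :=
  .of_isBounded (const_boundedAtFilter _ c)

theorem IsMeromorphicAtCusp.add {F G : ℍ → ℂ} (hF : IsMeromorphicAtCusp F)
    (hG : IsMeromorphicAtCusp G) : IsMeromorphicAtCusp fun τ => F τ + G τ := by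
  rw [isMeromorphicAtCusp_iff] at *
  obtain ⟨m, C, A, hm⟩ := hF
  obtain ⟨n, D, B, hn⟩ := hG
  refine ⟨m + n, |C| + |D|, max A B, fun τ hτ => ?_⟩
  have h0 := τ.im_pos.le
  have h1 : Real.exp (2 * Real.pi * m * τ.im) ≤ Real.exp (2 * Real.pi * (m + n : ℕ) * τ.im) := by
    gcongr
    exact Nat.le_add_right _ _
  have h2 : Real.exp (2 * Real.pi * n * τ.im) ≤ Real.exp (2 * Real.pi * (m + n : ℕ) * τ.im) := by
    gcongr
    exact Nat.le_add_left _ _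
  calc ‖F τ + G τ‖ ≤ ‖F τ‖ + ‖G τ‖ := norm_add_le _ _
    _ ≤ C * Real.exp (2 * Real.pi * m * τ.im) + D * Real.exp (2 * Real.pi * n * τ.im) :=
      add_le_add (hm τ ((le_max_left _ _).trans hτ)) (hn τ ((le_max_right _ _).trans hτ))
    _ ≤ |C| * Real.exp (2 * Real.pi * (m + n : ℕ) * τ.im) +
        |D| * Real.exp (2 * Real.pi * (m + n : ℕ) * τ.im) := by
      gcongr
      · exact le_abs_self C
      · exact le_abs_self D
    _ = _ := by ring

theorem IsMeromorphicAtCusp.sum {ι : Type*} (s : Finset ι) {F : ι → ℍ → ℂ}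
    (hF : ∀ i ∈ s, IsMeromorphicAtCusp (F i)) : IsMeromorphicAtCusp fun τ => ∑ i ∈ s, F i τ := by
  classical
  induction s using Finset.induction_on with
  | empty => simpa using IsMeromorphicAtCusp.const 0
  | insert i s hi ih =>
    simp only [Finset.sum_insert hi]
    exact (hF i (by simp)).add (ih fun j hj => hF j (by simp [hj]))

/-- Cauchy's estimate on the unit circle around $\tau$ preserves the exponential growth rate. -/
theorem IsMeromorphicAtCusp.normalizedDeriv {F : ℍ → ℂ} (hF : MDiff F)
    (h : IsMeromorphicAtCusp F) :
    IsMeromorphicAtCusp (Derivative.normalizedDerivOfComplex F) := by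
  rw [isMeromorphicAtCusp_iff] at *
  obtain ⟨n, C, A, hm⟩ := h
  -- The height $\max(A,0)+2$ keeps the closed unit disc inside the half plane and where the bound
  -- on $F$ holds; $e^{2\pi n}$ absorbs a rise of at most one in height.
  refine ⟨n, ‖(2 * Real.pi * I : ℂ)⁻¹‖ * (|C| * Real.exp (2 * Real.pi * n)), max A 0 + 2,
    fun τ hτ => ?_⟩
  have hmax := le_max_left A 0
  have hmax' := le_max_right A 0
  have hsub : ∀ z ∈ Metric.closedBall (τ : ℂ) 1, max A 0 + 1 ≤ z.im ∧ z.im ≤ τ.im + 1 := by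
    intro z hz
    have h1 : |(z - τ).im| ≤ 1 := (Complex.abs_im_le_norm _).trans (by simpa [dist_eq_norm] using hz)
    rw [sub_im, abs_le, coe_im] at h1
    constructor <;> linarith [h1.1, h1.2]
  have hd : DiffContOnCl ℂ (F ∘ ofComplex) (Metric.ball (τ : ℂ) 1) := by
    refine DifferentiableOn.diffContOnCl ?_
    rw [closure_ball _ one_ne_zero]
    refine (UpperHalfPlane.mdifferentiable_iff.1 hF).mono fun z hz => ?_
    have := (hsub z hz).1
    exact (show 0 < z.im by linarith)
  have hC : ∀ z ∈ Metric.sphere (τ : ℂ) 1,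
      ‖(F ∘ ofComplex) z‖ ≤ |C| * Real.exp (2 * Real.pi * n) * Real.exp (2 * Real.pi * n * τ.im) := by
    intro z hz
    obtain ⟨h1, h2⟩ := hsub z (Metric.sphere_subset_closedBall hz)
    have h3 : 0 < z.im := by linarith
    rw [Function.comp_apply, ofComplex_apply_of_im_pos h3]
    refine (hm ⟨z, h3⟩ (show A ≤ z.im by linarith)).trans ?_
    rw [mul_assoc |C|, ← Real.exp_add]
    refine mul_le_mul (le_abs_self C) ?_ (Real.exp_pos _).le (abs_nonneg C)
    refine Real.exp_le_exp.2 ?_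
    change 2 * Real.pi * n * z.im ≤ _
    have : 0 ≤ 2 * Real.pi * n := by positivity
    nlinarith
  have h4 := Complex.norm_deriv_le_of_forall_mem_sphere_norm_le one_pos hd hC
  rw [div_one] at h4
  rw [normalizedDeriv_eq hF, dTau_of_mdiff hF, norm_mul]
  exact (mul_le_mul_of_nonneg_left h4 (norm_nonneg _)).trans_eq (by ring)

theorem IsMeromorphicAtCusp.iterate {F : ℍ → ℂ} (hF : MDiff F) (h : IsMeromorphicAtCusp F) (n : ℕ) :
    IsMeromorphicAtCusp (Derivative.normalizedDerivOfComplex^[n] F) := by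
  induction n with
  | zero => exact h
  | succ n ih =>
    rw [Function.iterate_succ_apply']
    exact ih.normalizedDeriv (mdiff_iterate hF n)

/-! ### Rankin–Cohen brackets of modular objects -/

theorem mdiff_rankinCohen (k l : ℤ) (r : ℕ) {F G : ℍ → ℂ} (hF : MDiff F) (hG : MDiff G) :
    MDiff (rankinCohen k l r F G) := by
  have h1 : rankinCohen k l r F G = ∑ s ∈ Finset.range (r + 1), ((-1 : ℂ) ^ s *
      (Ring.choose (k + r - 1) s : ℤ) * (Ring.choose (l + r - 1) (r - s) : ℤ)) •
      (Derivative.normalizedDerivOfComplex^[r - s] F * Derivative.normalizedDerivOfComplex^[s] G) := by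
    funext τ
    simp only [rankinCohen, Finset.sum_apply, Pi.smul_apply, Pi.mul_apply, smul_eq_mul]
    exact Finset.sum_congr rfl fun s _ => by ring
  rw [h1]
  exact MDifferentiable.sum fun s _ =>
    ((mdiff_iterate hF (r - s)).mul (mdiff_iterate hG s)).const_smul _

theorem isMeromorphicAtCusp_rankinCohen (k l : ℤ) (r : ℕ) {F G : ℍ → ℂ} (hF : MDiff F) (hG : MDiff G)
    (hF' : IsMeromorphicAtCusp F) (hG' : IsMeromorphicAtCusp G) :
    IsMeromorphicAtCusp (rankinCohen k l r F G) :=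
  IsMeromorphicAtCusp.sum _ fun s _ => ((IsMeromorphicAtCusp.const _).mul
    (hF'.iterate hF (r - s))).mul (hG'.iterate hG s)

theorem rankinCohen_vadd (k l : ℤ) (r : ℕ) {F G : ℍ → ℂ} (hF : MDiff F) (hG : MDiff G) {c : ℂ}
    (hF' : ∀ τ, F ((1 : ℝ) +ᵥ τ) = F τ) (hG' : ∀ τ, G ((1 : ℝ) +ᵥ τ) = c * G τ) (τ : ℍ) :
    rankinCohen k l r F G ((1 : ℝ) +ᵥ τ) = c * rankinCohen k l r F G τ := by
  rw [rankinCohen, rankinCohen, Finset.mul_sum]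
  refine Finset.sum_congr rfl fun s _ => ?_
  rw [iterate_normalizedDeriv_vadd hF (c := 1) (by simpa using hF'),
    iterate_normalizedDeriv_vadd hG hG']
  ring

/-- Written with raising operators, every summand is equivariant by itself, with weights $k+2(r-s)$
and $l+2s$ whose sum does not depend on $s$. -/
theorem rankinCohen_negInv (k l : ℤ) (r : ℕ) {F : ℍ → ℂ} {ι : Type*} [Fintype ι] {G : ι → ℍ → ℂ}
    {c : ι → ℂ} {i : ι} (hF : MDiff F) (hG : ∀ i, MDiff (G i))
    (hF' : ∀ τ, F (negInv τ) = (τ : ℂ) ^ k * F τ)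
    (hG' : ∀ τ, G i (negInv τ) = (τ : ℂ) ^ l * ∑ j, c j * G j τ) (τ : ℍ) :
    rankinCohen k l r F (G i) (negInv τ) =
      (τ : ℂ) ^ (k + l + 2 * r) * ∑ j, c j * rankinCohen k l r F (G j) τ := by
  have hs : ∀ j, RSmooth (G j) := fun j => .of_mdiff (hG j)
  have h1 := raiseIter_negInv (.of_mdiff hF) (.of_mdiff hF) hF'
  have h2 := raiseIter_negInv (hs i)
    (RSmooth.sum Finset.univ fun j _ => (RSmooth.const (c j)).mul (hs j)) hG'
  simp only [raiseIter_sum Finset.univ c (fun j _ => hs j)] at h2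
  simp only [rankinCohen_eq_raise k l r hF (hG _), bracketSum, Finset.mul_sum]
  rw [Finset.sum_comm]
  refine Finset.sum_congr rfl fun s hs => ?_
  have hs' : s ≤ r := Nat.lt_succ_iff.1 (Finset.mem_range.1 hs)
  rw [h1, h2, Finset.mul_sum, Finset.mul_sum]
  refine Finset.sum_congr rfl fun j _ => ?_
  have h3 : (τ : ℂ) ^ (k + l + 2 * (r : ℤ)) =
      (τ : ℂ) ^ (k + 2 * (r - s : ℕ)) * (τ : ℂ) ^ (l + 2 * (s : ℤ)) := by
    rw [← zpow_add₀ τ.ne_zero]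
    congr 1
    push_cast [Nat.cast_sub hs']
    ring
  rw [h3]
  ring

/-! ### The generators of the modular group and the Weil representation -/

theorem modular_S_eq_negInv (τ : ℍ) : ModularGroup.S • τ = negInv τ := by
  rw [modular_S_smul]
  ext
  change (-(τ : ℂ))⁻¹ = -1 / τ
  rw [inv_neg, neg_div, one_div]

theorem denom_mul_eq (p q : SL(2, ℤ)) (τ : ℍ) :
    denom (p * q : SL(2, ℤ)) τ = denom p (q • τ : ℍ) * denom q τ := by
  have h1 : denom q τ ≠ 0 := denom_ne_zero _ τ
  rw [ModularGroup.denom_apply] at h1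
  rw [ModularGroup.denom_apply, ModularGroup.denom_apply, ModularGroup.denom_apply,
    UpperHalfPlane.coe_specialLinearGroup_apply]
  simp only [algebraMap_int_eq, eq_intCast, ofReal_intCast, Matrix.SpecialLinearGroup.coe_mul,
    Matrix.mul_apply, Fin.sum_univ_two]
  rw [add_mul, mul_assoc, div_mul_cancel₀ _ h1]
  push_cast
  ring

theorem denom_T_eq (τ : ℍ) : denom ModularGroup.T τ = 1 := by
  rw [ModularGroup.denom_apply]
  simp [ModularGroup.T]

theorem IsWeaklyHolomorphicForm.negInv {w : ℤ} {g : ℍ → ℂ} (hg : IsWeaklyHolomorphicForm w g)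
    (τ : ℍ) : g (negInv τ) = (τ : ℂ) ^ w * g τ := by
  have := (ModularForm.slash_action_eq'_iff w g ModularGroup.S τ).1 (by rw [hg.slash])
  rw [modular_S_eq_negInv] at this
  simpa [ModularGroup.S] using this

theorem IsWeaklyHolomorphicForm.vadd {w : ℤ} {g : ℍ → ℂ} (hg : IsWeaklyHolomorphicForm w g)
    (τ : ℍ) : g ((1 : ℝ) +ᵥ τ) = g τ := by
  have := (ModularForm.slash_action_eq'_iff w g ModularGroup.T τ).1 (by rw [hg.slash])
  rw [modular_T_smul] at this
  simpa [ModularGroup.T] using this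

section

variable {V : Type*} [AddCommGroup V] [Module ℝ V] (B : LinearMap.BilinForm ℝ V) (L : Submodule ℤ V)

theorem weilGraph_transform {w : ℤ} {f : DiscGroup B L → ℍ → ℂ} [Finite (DiscGroup B L)]
    (hT : ∀ τ ν, f ν (ModularGroup.T • τ) = weilT B L (fun μ => f μ τ) ν)
    (hS : ∀ τ ν, f ν (ModularGroup.S • τ) = (τ : ℂ) ^ w * weilS B L (fun μ => f μ τ) ν)
    {p : SL(2, ℤ) × Function.End (DiscGroup B L → ℂ)} (hp : p ∈ weilGraph B L) (τ : ℍ)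
    (ν : DiscGroup B L) : f ν (p.1 • τ) = denom p.1 τ ^ w * p.2 (fun μ => f μ τ) ν := by
  -- The endomorphisms in the graph are bare functions, so homogeneity is carried along in the
  -- induction; it moves the automorphy factor of one element through the action of the other.
  have key : (∀ (c : ℂ) φ, p.2 (fun μ => c * φ μ) = fun μ => c * p.2 φ μ) ∧
      ∀ τ ν, f ν (p.1 • τ) = denom p.1 τ ^ w * p.2 (fun μ => f μ τ) ν := by
    induction hp using Submonoid.closure_induction with
    | mem p hp =>
      rcases hp with rfl | rfl
      · refine ⟨fun c φ => ?_, fun τ ν => ?_⟩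
        · funext μ
          simp only [weilT]
          ring
        · rw [hT, denom_T_eq, one_zpow, one_mul]
      · refine ⟨fun c φ => ?_, fun τ ν => ?_⟩
        · have := Fintype.ofFinite (DiscGroup B L)
          funext μ
          simp only [weilS]
          rw [finsum_eq_sum_of_fintype, finsum_eq_sum_of_fintype, Finset.mul_sum, Finset.mul_sum,
            Finset.mul_sum]
          exact Finset.sum_congr rfl fun _ _ => by ring
        · rw [hS, ModularGroup.denom_S]
    | one =>
      refine ⟨fun c φ => rfl, fun τ ν => ?_⟩
      rw [Prod.fst_one, one_smul]
      simp [Prod.snd_one, denom]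
      rfl
    | mul p q _ _ hp hq =>
      refine ⟨fun c φ => ?_, fun τ ν => ?_⟩
      · change p.2 (q.2 _) = fun μ => c * p.2 (q.2 φ) μ
        rw [hq.1, hp.1]
      · rw [Prod.fst_mul, mul_smul, hp.2]
        simp only [hq.2]
        rw [hp.1]
        rw [denom_mul_eq, mul_zpow, mul_assoc]
        rfl
  exact key.2 τ ν

end

variable {U : Submodule ℝ (Matrix (Fin 2) (Fin 2) ℝ)}

/-- Rankin–Cohen brackets of a weakly holomorphic form with the theta functions of the negative
definite lattice are weakly holomorphic for the Weil representation. -/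
theorem IsRationalPlane.isWeaklyHolomorphicVector (h : IsRationalPlane U) {r : ℕ} {g : ℍ → ℂ}
    (hg : IsWeaklyHolomorphicForm (-2 * r) g) (c : ℂ) :
    IsWeaklyHolomorphicVector detForm (planeLattice U) 1
      fun ν τ => c * rankinCohen (-2 * r) 1 r g (negTheta U ν) τ := by
  have hfin := h.finite_discGroup
  have := Fintype.ofFinite (DiscGroup detForm (planeLattice U))
  refine ⟨fun ν => ?_, fun p hp => ?_, fun ν => ?_⟩
  · exact (mdiff_rankinCohen _ _ r hg.holo (h.mdiff_negTheta ν)).const_smul c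
  · refine weilGraph_transform (w := 1)
      (f := fun ν τ => c * rankinCohen (-2 * r) 1 r g (negTheta U ν) τ) detForm (planeLattice U) (fun τ ν => ?_) (fun τ ν => ?_) hp
    · rw [modular_T_smul, rankinCohen_vadd _ _ r hg.holo (h.mdiff_negTheta ν) hg.vadd
        (h.negTheta_vadd ν)]
      simp only [weilT, discNorm]
      push_cast
      ring
    · rw [modular_S_eq_negInv, rankinCohen_negInv (-2 * r) 1 r (i := ν) (G := negTheta U)
        (c := fun μ => -I * ((Fintype.card (DiscGroup detForm (planeLattice U)) : ℝ) ^
          (-(1 / 2) : ℝ) : ℝ) * discPairing U μ ν) hg.holo (h.mdiff_negTheta) hg.negInv fun τ => by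
          rw [h.negTheta_negInv, zpow_one, Finset.mul_sum, Finset.mul_sum]
          exact Finset.sum_congr rfl fun _ _ => by ring]
      simp only [weilS, negRank_planeLattice h]
      rw [finsum_eq_sum_of_fintype, Nat.card_eq_fintype_card]
      have h1 : e (((0 - 2) / 8 : ℝ)) = -I := by
        rw [e, show 2 * (Real.pi : ℂ) * I * (((0 - 2) / 8 : ℝ) : ℂ) = -(Real.pi / 2 * I) by
          push_cast; ring, exp_neg, exp_pi_div_two_mul_I, inv_I]
      rw [h1, show -2 * (r : ℤ) + 1 + 2 * r = 1 by ring, zpow_one]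
      simp only [Finset.mul_sum]
      refine Finset.sum_congr rfl fun μ _ => ?_
      rw [discPairing]
      ring
  · exact (IsMeromorphicAtCusp.const c).mul (isMeromorphicAtCusp_rankinCohen _ _ r hg.holo
      (h.mdiff_negTheta ν) hg.mero (.of_isBounded (h.negTheta_isBoundedAtImInfty ν)))

/-! ### Circle averages near the cusp -/

theorem norm_circleAverage_le {f : ℂ → ℂ} {ρ C : ℝ} (hρ : 0 ≤ ρ) (h : ∀ q : ℂ, ‖q‖ = ρ → ‖f q‖ ≤ C) :
    ‖Real.circleAverage f 0 ρ‖ ≤ C := by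
  have hpi := Real.pi_pos
  have h1 : ‖∫ θ in (0 : ℝ)..2 * Real.pi, f (circleMap 0 ρ θ)‖ ≤ C * |2 * Real.pi - 0| :=
    intervalIntegral.norm_integral_le_of_norm_le_const fun θ _ => h _ (by simp [abs_of_nonneg hρ])
  rw [Real.circleAverage, norm_smul, norm_inv, Real.norm_of_nonneg (by positivity)]
  rw [sub_zero, abs_of_pos (by positivity)] at h1
  rw [inv_mul_le_iff₀ (by positivity), mul_comm _ C]
  exact h1

theorem circleIntegrable_of_continuousOn_ball {f : ℂ → ℂ} {ρ : ℝ} (hρ : 0 < ρ) (hρ1 : ρ < 1)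
    (hf : ContinuousOn f (Metric.ball 0 1 \ {0})) : CircleIntegrable f 0 ρ := by
  refine ContinuousOn.circleIntegrable hρ.le (hf.mono fun q hq => ?_)
  have : ‖q‖ = ρ := by simpa using hq
  refine ⟨by simp [this, hρ1], ?_⟩
  rintro rfl
  simp at this
  exact hρ.ne this

/-- Induction on the pole order. Write $H=H(0)+q\tilde H$. On $|q|=\rho$ one has
$q^{-(n+1)}=\rho^{-2(n+1)}\bar q^{\,n+1}$, so the part with $H(0)$ is a multiple of the conjugate of
a holomorphic function vanishing at $0$ and has mean zero; what remains has a pole of order $n$.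
With no pole left, the mean differs from its value at the centre by $O(\rho)$. -/
theorem circleAverage_mul_conj {H Θ : ℂ → ℂ} (hH : DifferentiableOn ℂ H (Metric.ball 0 1))
    (hΘ : DifferentiableOn ℂ Θ (Metric.ball 0 1)) (n : ℕ) :
    ∃ c : ℂ, (fun ρ : ℝ => Real.circleAverage
      (fun q => (q ^ n)⁻¹ * H q * (starRingEnd ℂ) (Θ q)) 0 ρ - c) =O[𝓝[>] 0] fun ρ => ρ := by
  have hball : Metric.ball (0 : ℂ) 1 ∈ 𝓝 (0 : ℂ) := Metric.ball_mem_nhds _ one_pos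
  have hsmall : ∀ᶠ ρ : ℝ in 𝓝[>] 0, 0 < ρ ∧ ρ < 1 :=
    Ioo_mem_nhdsGT one_pos
  have hconj : Continuous (starRingEnd ℂ : ℂ → ℂ) := Complex.continuous_conj
  have hcont : ∀ {n : ℕ} {H : ℂ → ℂ}, DifferentiableOn ℂ H (Metric.ball 0 1) → ContinuousOn
      (fun q => (q ^ n)⁻¹ * H q * (starRingEnd ℂ) (Θ q)) (Metric.ball 0 1 \ {0}) := by
    intro n H hH
    refine (ContinuousOn.mul (ContinuousOn.inv₀ (by fun_prop) fun q hq =>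
      pow_ne_zero _ hq.2) (hH.continuousOn.mono Set.sdiff_subset)).mul ?_
    exact hconj.comp_continuousOn (hΘ.continuousOn.mono Set.sdiff_subset)
  induction n generalizing H with
  | zero =>
    refine ⟨H 0 * (starRingEnd ℂ) (Θ 0), ?_⟩
    have h1 : (fun q => H q * (starRingEnd ℂ) (Θ q) - H 0 * (starRingEnd ℂ) (Θ 0)) =O[𝓝 0]
        fun q => q := by
      have h2 := ((hH.differentiableAt hball).restrictScalars ℝ).mul
        (Complex.conjCLE.differentiableAt.comp (0 : ℂ)
          ((hΘ.differentiableAt hball).restrictScalars ℝ))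
      simpa using h2.isBigO_sub
    obtain ⟨C, hC⟩ := h1.bound
    obtain ⟨ε, hε, hεC⟩ := Metric.eventually_nhds_iff.1 hC
    refine Asymptotics.IsBigO.of_bound C ?_
    filter_upwards [hsmall, Ioo_mem_nhdsGT hε] with ρ hρ hρε
    have h3 : Real.circleAverage (fun q => (q ^ 0)⁻¹ * H q * (starRingEnd ℂ) (Θ q)) 0 ρ -
        H 0 * (starRingEnd ℂ) (Θ 0) = Real.circleAverage (fun q => (q ^ 0)⁻¹ * H q *
          (starRingEnd ℂ) (Θ q) - H 0 * (starRingEnd ℂ) (Θ 0)) 0 ρ := by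
      rw [Real.circleAverage_fun_sub (circleIntegrable_of_continuousOn_ball hρ.1 hρ.2 (hcont hH))
        (circleIntegrable_const _ _ _), Real.circleAverage_const]
    rw [h3]
    refine norm_circleAverage_le hρ.1.le fun q hq => ?_
    have := hεC (y := q) (by rw [dist_zero_right, hq]; exact hρε.2)
    rw [hq] at this
    simpa [abs_of_pos hρ.1] using this
  | succ n ih =>
    have hd : DifferentiableOn ℂ (dslope H 0) (Metric.ball 0 1) :=
      (Complex.differentiableOn_dslope hball).2 hH
    obtain ⟨c, hc⟩ := ih hd
    refine ⟨c, hc.congr' ?_ EventuallyEq.rfl⟩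
    filter_upwards [hsmall] with ρ hρ
    congr 1
    have hne : ∀ q ∈ Metric.sphere (0 : ℂ) |ρ|, q ≠ 0 := by
      rintro q hq rfl
      simp only [mem_sphere_iff_norm, sub_self, norm_zero] at hq
      exact (abs_pos.2 hρ.1.ne').ne hq
    have h1 : Set.EqOn (fun q => (q ^ (n + 1))⁻¹ * H q * (starRingEnd ℂ) (Θ q))
        (fun q => (H 0 * ((ρ : ℂ) ^ (2 * (n + 1)))⁻¹) • (starRingEnd ℂ) (q ^ (n + 1) * Θ q) +
          (q ^ n)⁻¹ * dslope H 0 q * (starRingEnd ℂ) (Θ q)) (Metric.sphere 0 |ρ|) := by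
      intro q hq
      have hq0 := hne q hq
      have hqρ : q * (starRingEnd ℂ) q = (ρ : ℂ) ^ 2 := by
        rw [Complex.mul_conj, Complex.normSq_eq_norm_sq]
        have : ‖q‖ = |ρ| := by simpa using hq
        rw [this, sq_abs]
        push_cast
        rfl
      have hH' : H q = H 0 + q * dslope H 0 q := by
        have := sub_smul_dslope H 0 q
        rw [sub_zero, smul_eq_mul] at this
        rw [this]; ring
      have hρ0 : (starRingEnd ℂ) q ≠ 0 := by simpa using hq0
      simp only [smul_eq_mul, map_mul, map_pow]
      rw [pow_mul, ← hqρ, hH', mul_pow]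
      field_simp
      ring
    rw [Real.circleAverage_congr_sphere h1, Real.circleAverage_fun_add, Real.circleAverage_fun_smul]
    · have h2 : Real.circleAverage (fun q => (starRingEnd ℂ) (q ^ (n + 1) * Θ q)) 0 ρ = 0 := by
        have h3 : DifferentiableOn ℂ (fun q => q ^ (n + 1) * Θ q) (Metric.ball 0 1) :=
          (differentiableOn_pow _).mul hΘ
        have h4 := Complex.conjCLE.toContinuousLinearMap.circleAverage_comp_comm
          (circleIntegrable_of_continuousOn_ball hρ.1 hρ.2 (h3.continuousOn.mono Set.sdiff_subset))
        have h5 : DiffContOnCl ℂ (fun q => q ^ (n + 1) * Θ q) (Metric.ball 0 |ρ|) := by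
          refine DifferentiableOn.diffContOnCl (h3.mono ?_)
          rw [abs_of_pos hρ.1]
          exact Metric.closure_ball_subset_closedBall.trans (Metric.closedBall_subset_ball hρ.2)
        rw [h5.circleAverage] at h4
        simpa [Function.comp_def] using h4
      rw [h2, smul_zero, zero_add]
    · refine circleIntegrable_of_continuousOn_ball hρ.1 hρ.2 ?_
      simp only [smul_eq_mul]
      refine continuousOn_const.mul (hconj.comp_continuousOn ?_)
      exact ((differentiableOn_pow _).mul hΘ).continuousOn.mono Set.sdiff_subset
    · exact circleIntegrable_of_continuousOn_ball hρ.1 hρ.2 (hcont hd)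

/-- The integral of a function over a horizontal segment of length one. -/
def slice (F : ℍ → ℂ) (y : ℝ) : ℂ :=
  ∫ x in (-(1 / 2) : ℝ)..1 / 2, F (ofComplex (x + y * I))

theorem integral_e_eq_circleAverage (f : ℂ → ℂ) (y : ℝ) :
    ∫ x in (-(1 / 2) : ℝ)..1 / 2, f (e (x + y * I)) =
      Real.circleAverage f 0 (Real.exp (-(2 * Real.pi * y))) := by
  -- The rotation by $-\pi$ matches $x=-\frac12$ with the start of the angular interval $[0,2\pi]$.
  rw [Real.circleAverage_eq_integral_add (-Real.pi)]
  have h1 := intervalIntegral.integral_comp_mul_add (a := -(1 / 2)) (b := 1 / 2)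
    (fun θ => f (circleMap 0 (Real.exp (-(2 * Real.pi * y))) (θ + -Real.pi)))
    (c := 2 * Real.pi) (by positivity) Real.pi
  rw [show 2 * Real.pi * -(1 / 2) + Real.pi = 0 by ring,
    show 2 * Real.pi * (1 / 2) + Real.pi = 2 * Real.pi by ring] at h1
  rw [← h1]
  refine intervalIntegral.integral_congr fun x _ => ?_
  simp only [circleMap, e]
  rw [zero_add, add_neg_cancel_right, ofReal_exp, ← Complex.exp_add]
  congr 2
  push_cast
  linear_combination (2 * Real.pi * y) * I_mul_I

/-! ### Expansions at the cusp -/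

/-- The mean over horizontal segments is a polynomial in `1/y` without constant term, up to a
rapidly decreasing function. -/
structure HasCuspExpansion (F : ℍ → ℂ) : Prop where
  cont : Continuous F
  asymp : ∃ p : Polynomial ℂ, ∀ m : ℕ,
    (fun y : ℝ => slice F y - (y : ℂ)⁻¹ * p.eval (y : ℂ)⁻¹) =O[atTop] fun y : ℝ => (y ^ m)⁻¹

theorem continuousOn_horizontal {F : ℍ → ℂ} (hF : Continuous F) {y : ℝ} (hy : 0 < y) :
    Continuous fun x : ℝ => F (ofComplex (x + y * I)) := by
  have h1 : ∀ x : ℝ, 0 < ((x : ℂ) + y * I).im := fun x => by simpa using hy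
  have h2 : (fun x : ℝ => F (ofComplex (x + y * I))) = fun x : ℝ => F ⟨x + y * I, h1 x⟩ := by
    funext x
    rw [ofComplex_apply_of_im_pos (h1 x)]
  rw [h2]
  refine hF.comp ?_
  rw [UpperHalfPlane.isEmbedding_coe.continuous_iff]
  change Continuous fun x : ℝ => (x : ℂ) + y * I
  fun_prop

theorem slice_add {F G : ℍ → ℂ} (hF : Continuous F) (hG : Continuous G) {y : ℝ} (hy : 0 < y) :
    slice (fun τ => F τ + G τ) y = slice F y + slice G y :=
  intervalIntegral.integral_add ((continuousOn_horizontal hF hy).intervalIntegrable _ _)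
    ((continuousOn_horizontal hG hy).intervalIntegrable _ _)

theorem slice_const_mul (c : ℂ) (F : ℍ → ℂ) (y : ℝ) :
    slice (fun τ => c * F τ) y = c * slice F y :=
  intervalIntegral.integral_const_mul c _

theorem HasCuspExpansion.add {F G : ℍ → ℂ} (hF : HasCuspExpansion F) (hG : HasCuspExpansion G) :
    HasCuspExpansion fun τ => F τ + G τ := by
  obtain ⟨p, hp⟩ := hF.asymp
  obtain ⟨q, hq⟩ := hG.asymp
  refine ⟨hF.cont.add hG.cont, p + q, fun m => ((hp m).add (hq m)).congr' ?_ EventuallyEq.rfl⟩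
  filter_upwards [eventually_gt_atTop 0] with y hy
  rw [slice_add hF.cont hG.cont hy, Polynomial.eval_add]
  ring

theorem HasCuspExpansion.const_mul {F : ℍ → ℂ} (hF : HasCuspExpansion F) (c : ℂ) :
    HasCuspExpansion fun τ => c * F τ := by
  obtain ⟨p, hp⟩ := hF.asymp
  refine ⟨continuous_const.mul hF.cont, Polynomial.C c * p, fun m =>
    ((hp m).const_mul_left c).congr_left fun y => ?_⟩
  rw [slice_const_mul, Polynomial.eval_mul, Polynomial.eval_C]
  ring

theorem HasCuspExpansion.zero : HasCuspExpansion fun _ => 0 :=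
  ⟨continuous_const, 0, fun m => by simpa [slice] using Asymptotics.isBigO_zero _ _⟩

theorem HasCuspExpansion.sum {ι : Type*} (s : Finset ι) {F : ι → ℍ → ℂ}
    (hF : ∀ i ∈ s, HasCuspExpansion (F i)) : HasCuspExpansion fun τ => ∑ i ∈ s, F i τ := by
  classical
  induction s using Finset.induction_on with
  | empty => simpa using HasCuspExpansion.zero
  | insert i s hi ih =>
    simp only [Finset.sum_insert hi]
    exact (hF i (by simp)).add (ih fun j hj => hF j (by simp [hj]))

theorem slice_im_inv_mul (F : ℍ → ℂ) {y : ℝ} (hy : 0 < y) :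
    slice (fun τ => (τ.im : ℂ)⁻¹ * F τ) y = (y : ℂ)⁻¹ * slice F y := by
  rw [slice, slice, ← intervalIntegral.integral_const_mul]
  refine intervalIntegral.integral_congr fun x _ => ?_
  have : 0 < ((x : ℂ) + y * I).im := by simpa using hy
  simp only [ofComplex_apply_of_im_pos this]
  congr 3
  change ((x : ℂ) + y * I).im = y
  simp

theorem continuous_im_inv : Continuous fun τ : ℍ => (τ.im : ℂ)⁻¹ :=
  (Complex.continuous_ofReal.comp UpperHalfPlane.continuous_im).inv₀ fun τ =>
    Complex.ofReal_ne_zero.2 τ.im_pos.ne'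

theorem isBigO_ofReal_inv_one : (fun y : ℝ => (y : ℂ)⁻¹) =O[atTop] fun _ : ℝ => (1 : ℝ) := by
  refine Asymptotics.IsBigO.of_bound 1 ?_
  filter_upwards [eventually_ge_atTop 1] with y hy
  rw [norm_inv, Complex.norm_real, Real.norm_of_nonneg (by linarith), norm_one, mul_one]
  exact inv_le_one_of_one_le₀ hy

theorem HasCuspExpansion.im_inv_mul {F : ℍ → ℂ} (hF : HasCuspExpansion F) :
    HasCuspExpansion fun τ => (τ.im : ℂ)⁻¹ * F τ := by
  obtain ⟨p, hp⟩ := hF.asymp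
  refine ⟨continuous_im_inv.mul hF.cont, Polynomial.X * p, fun m => ?_⟩
  refine ((isBigO_ofReal_inv_one.mul (hp m)).congr_right fun y => one_mul _).congr' ?_ EventuallyEq.rfl
  filter_upwards [eventually_gt_atTop 0] with y hy
  rw [slice_im_inv_mul F hy, Polynomial.eval_mul, Polynomial.eval_X]
  ring

theorem HasCuspExpansion.cy_pow_mul {F : ℍ → ℂ} (hF : HasCuspExpansion F) (j : ℕ) :
    HasCuspExpansion fun τ => cy τ ^ j * F τ := by
  induction j with
  | zero => simpa using hF
  | succ j ih =>
    have := ih.im_inv_mul.const_mul (-1 / (4 * Real.pi))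
    convert! this using 2 with τ
    have h1 : (τ.im : ℂ) ≠ 0 := by exact_mod_cast τ.im_pos.ne'
    have h2 : (Real.pi : ℂ) ≠ 0 := by exact_mod_cast Real.pi_ne_zero
    rw [pow_succ]
    conv_lhs => rw [cy_eq τ]
    rw [cy_eq τ]
    push_cast
    field_simp

/-- The missing constant term is exactly what makes the boundary contribution in Stokes' theorem
disappear. -/
theorem HasCuspExpansion.tendsto_slice {F : ℍ → ℂ} (hF : HasCuspExpansion F) :
    Tendsto (slice F) atTop (𝓝 0) := by
  obtain ⟨p, hp⟩ := hF.asymp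
  have h1 : Tendsto (fun y : ℝ => (y : ℂ)⁻¹) atTop (𝓝 0) := by
    have := (Complex.continuous_ofReal.tendsto 0).comp tendsto_inv_atTop_zero
    simpa [Function.comp_def] using this
  have h2 : Tendsto (fun y : ℝ => (y : ℂ)⁻¹ * p.eval (y : ℂ)⁻¹) atTop (𝓝 0) := by
    have := h1.mul ((p.continuous.tendsto 0).comp h1)
    simpa using this
  have h3 := (hp 1).trans_tendsto (by simpa using tendsto_inv_atTop_zero)
  simpa using h3.add h2

theorem periodic_of_vadd {f : ℍ → ℂ} (h : ∀ τ, f ((1 : ℝ) +ᵥ τ) = f τ) :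
    Function.Periodic (f ∘ ofComplex) ((1 : ℝ) : ℂ) := by
  intro w
  by_cases hw : 0 < w.im
  · have h2 : 0 < (w + ((1 : ℝ) : ℂ)).im := by simpa using hw
    simp only [Function.comp_apply, ofComplex_apply_of_im_pos h2, ofComplex_apply_of_im_pos hw]
    rw [← h ⟨w, hw⟩]
    congr 1
    ext
    rw [UpperHalfPlane.coe_vadd]
    exact add_comm w ((1 : ℝ) : ℂ)
  · have h2 : (w + ((1 : ℝ) : ℂ)).im ≤ 0 := by simpa using hw
    simp only [Function.comp_apply, ofComplex_apply_of_im_nonpos h2,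
      ofComplex_apply_of_im_nonpos (not_lt.1 hw)]

theorem mdiff_e_mul (c : ℂ) : MDiff fun τ : ℍ => e (c * (τ : ℂ)) := by
  rw [UpperHalfPlane.mdifferentiable_iff]
  have h1 : Differentiable ℂ fun z : ℂ => e (c * z) :=
    differentiable_e.comp (differentiable_id.const_mul c)
  refine h1.differentiableOn.congr fun z hz => ?_
  rw [Function.comp_apply, ofComplex_apply_of_im_pos hz]

theorem isMeromorphicAtCusp_e (c : ℝ) : IsMeromorphicAtCusp fun τ : ℍ => e (c * (τ : ℂ)) := by
  rw [isMeromorphicAtCusp_iff]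
  refine ⟨⌈-c⌉₊, 1, 0, fun τ hτ => ?_⟩
  rw [norm_e, one_mul]
  refine Real.exp_le_exp.2 ?_
  have h1 : ((c : ℂ) * (τ : ℂ)).im = c * τ.im := by simp
  rw [h1]
  have h2 : -c ≤ ⌈-c⌉₊ := Nat.le_ceil _
  have h3 : 0 ≤ 2 * Real.pi * τ.im := by positivity
  nlinarith

theorem isBigO_exp_neg_mul {a : ℝ} (ha : 0 < a) (m : ℕ) :
    (fun y : ℝ => Real.exp (-(a * y))) =O[atTop] fun y : ℝ => (y ^ m)⁻¹ := by
  have h1 := (isLittleO_exp_neg_mul_rpow_atTop ha (-(m : ℝ))).isBigO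
  refine (h1.congr_left fun y => by rw [neg_mul]).congr' EventuallyEq.rfl ?_
  filter_upwards [eventually_gt_atTop 0] with y hy
  rw [Real.rpow_neg hy.le, Real.rpow_natCast]

theorem e_fract (α : ℝ) : e ((Int.fract α : ℝ) : ℂ) = e α := by
  rw [← e_add_int _ ⌊α⌋, ← ofReal_intCast, ← ofReal_add, Int.fract_add_floor]

theorem cuspFunction_e {f : ℍ → ℂ} (h : ∀ τ, f ((1 : ℝ) +ᵥ τ) = f τ) (τ : ℍ) :
    UpperHalfPlane.cuspFunction 1 f (e τ) = f τ := by
  have := UpperHalfPlane.eq_cuspFunction τ one_ne_zero (periodic_of_vadd h)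
  rw [← this, e, Function.Periodic.qParam]
  simp

theorem e_conj_mul (a : ℝ) (τ : ℍ) :
    e (a * (τ : ℂ)) * (starRingEnd ℂ) (e (a * (τ : ℂ))) =
      (Real.exp (-(4 * Real.pi * a * τ.im)) : ℝ) := by
  rw [Complex.mul_conj, Complex.normSq_eq_norm_sq, norm_e, ← Real.exp_nat_mul]
  congr 2
  have h1 : ((a : ℂ) * (τ : ℂ)).im = a * τ.im := by simp
  rw [h1]
  push_cast
  ring

/-- With $a$ the fractional part of $\alpha$, the twist by $q^{-a}$ makes $h$ and $\theta$ periodic,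
and $q^n$ removes the pole of $h$. Both become holomorphic functions of $q$ on the unit disc, and
the horizontal mean is $e^{-4\pi ay}$ times a circle average over $|q|=e^{-2\pi y}$. -/
theorem exists_slice_mul_conj {α : ℝ} {h θ : ℍ → ℂ} (hh : MDiff h) (hθ : MDiff θ)
    (hper : ∀ τ, h ((1 : ℝ) +ᵥ τ) = e α * h τ) (θper : ∀ τ, θ ((1 : ℝ) +ᵥ τ) = e α * θ τ)
    (hmer : IsMeromorphicAtCusp h)
    (θbdd : IsBoundedAtImInfty fun τ : ℍ => e (-(Int.fract α : ℝ) * (τ : ℂ)) * θ τ) :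
    ∃ c : ℂ, ∀ m : ℕ, (fun y : ℝ => slice (fun τ => h τ * (starRingEnd ℂ) (θ τ)) y - c) =O[atTop]
      fun y : ℝ => (y ^ m)⁻¹ := by
  set a : ℝ := Int.fract α with ha
  have ha0 : 0 ≤ a := Int.fract_nonneg α
  obtain ⟨n, hn⟩ := (isMeromorphicAtCusp_e (-a)).mul hmer
  have hshift : ∀ (c : ℂ) (τ : ℍ), e (c * (((1 : ℝ) +ᵥ τ : ℍ) : ℂ)) = e c * e (c * τ) := by
    intro c τ
    rw [← e_add, UpperHalfPlane.coe_vadd]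
    congr 1
    push_cast
    ring
  have hea : e (-(a : ℂ)) * e α = 1 := by
    rw [← e_fract, ← e_add, neg_add_cancel, e_zero]
  let H₀ : ℍ → ℂ := fun τ => e (n * (τ : ℂ)) * (e ((-a : ℝ) * (τ : ℂ)) * h τ)
  let Θ₀ : ℍ → ℂ := fun τ => e (-a * (τ : ℂ)) * θ τ
  have H₀per : ∀ τ, H₀ ((1 : ℝ) +ᵥ τ) = H₀ τ := fun τ => by
    simp only [H₀, hshift, hper]
    have : e (n : ℂ) = 1 := by simpa using e_int n
    rw [this]
    push_cast
    linear_combination (e (n * (τ : ℂ)) * e (-a * (τ : ℂ)) * h τ) * hea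
  have Θ₀per : ∀ τ, Θ₀ ((1 : ℝ) +ᵥ τ) = Θ₀ τ := fun τ => by
    simp only [Θ₀, hshift, θper]
    linear_combination (e (-a * (τ : ℂ)) * θ τ) * hea
  have hHd := UpperHalfPlane.differentiableOn_cuspFunction_ball one_pos (periodic_of_vadd H₀per)
    ((mdiff_e_mul n).mul ((mdiff_e_mul (-a : ℝ)).mul hh)) hn
  have hΘd := UpperHalfPlane.differentiableOn_cuspFunction_ball one_pos (periodic_of_vadd Θ₀per)
    ((mdiff_e_mul (-a)).mul hθ) θbdd
  obtain ⟨c, hc⟩ := circleAverage_mul_conj hHd hΘd n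
  set A : ℝ → ℂ := fun ρ => Real.circleAverage (fun q => (q ^ n)⁻¹ *
    UpperHalfPlane.cuspFunction 1 H₀ q * (starRingEnd ℂ) (UpperHalfPlane.cuspFunction 1 Θ₀ q)) 0 ρ
    with hA
  have hslice : ∀ y : ℝ, 0 < y → slice (fun τ => h τ * (starRingEnd ℂ) (θ τ)) y =
      (Real.exp (-(4 * Real.pi * a * y)) : ℝ) * A (Real.exp (-(2 * Real.pi * y))) := by
    intro y hy
    simp only [hA]
    rw [← integral_e_eq_circleAverage, slice, ← intervalIntegral.integral_const_mul]
    refine intervalIntegral.integral_congr fun x _ => ?_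
    have hpos : 0 < ((x : ℂ) + y * I).im := by simpa using hy
    simp only [ofComplex_apply_of_im_pos hpos]
    set τ : ℍ := ⟨(x : ℂ) + y * I, hpos⟩ with hτ
    have him : τ.im = y := by
      change ((x : ℂ) + y * I).im = y
      simp
    change _ = _ * ((e τ ^ n)⁻¹ * UpperHalfPlane.cuspFunction 1 H₀ (e τ) *
      (starRingEnd ℂ) (UpperHalfPlane.cuspFunction 1 Θ₀ (e τ)))
    rw [cuspFunction_e H₀per, cuspFunction_e Θ₀per, ← him, ← e_conj_mul]
    have h1 : e (n * (τ : ℂ)) = e τ ^ n := by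
      rw [e, e, ← Complex.exp_nat_mul]
      congr 1
      ring
    have h2 : e ((a : ℂ) * τ) * e (-a * (τ : ℂ)) = 1 := by
      rw [← e_add, ← add_mul, add_neg_cancel, zero_mul, e_zero]
    have h3 := congrArg (starRingEnd ℂ) h2
    rw [map_mul, map_one] at h3
    have h4 : (e τ ^ n)⁻¹ * e τ ^ n = 1 := inv_mul_cancel₀ (pow_ne_zero _ (e_ne_zero _))
    simp only [H₀, Θ₀, h1, map_mul]
    push_cast
    linear_combination (-(h τ * (starRingEnd ℂ) (θ τ))) * (h4 + (e τ ^ n)⁻¹ * e τ ^ n * h2 +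
      (e τ ^ n)⁻¹ * e τ ^ n * e ((a : ℂ) * τ) * e (-a * (τ : ℂ)) * h3)
  have hρ : Tendsto (fun y : ℝ => Real.exp (-(2 * Real.pi * y))) atTop (𝓝[>] 0) := by
    refine tendsto_nhdsWithin_iff.2 ⟨Real.tendsto_exp_neg_atTop_nhds_zero.comp
      (tendsto_id.const_mul_atTop (by positivity)), Eventually.of_forall fun y => Real.exp_pos _⟩
  have hcA := hc.comp_tendsto hρ
  simp only [Function.comp_def] at hcA
  have hpos := eventually_gt_atTop (0 : ℝ)
  -- If $a=0$, the error $O(\rho)$ of the circle average is exponentially small in $y$. If $a>0$,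
  -- the factor $e^{-4\pi ay}$ kills the whole mean, and the constant is $0$.
  rcases ha0.eq_or_lt with h0 | h0
  · refine ⟨c, fun m => (hcA.trans (isBigO_exp_neg_mul Real.two_pi_pos m)).congr' ?_ EventuallyEq.rfl⟩
    filter_upwards [hpos] with y hy
    rw [hslice y hy, ← h0]
    simp [hA]
  · refine ⟨0, fun m => ?_⟩
    have h1 : (fun y : ℝ => A (Real.exp (-(2 * Real.pi * y)))) =O[atTop] fun _ : ℝ => (1 : ℝ) := by
      have h2 : (fun y : ℝ => Real.exp (-(2 * Real.pi * y))) =O[atTop] fun _ : ℝ => (1 : ℝ) := by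
        simpa using isBigO_exp_neg_mul Real.two_pi_pos 0
      have h3 := (hcA.trans h2).add (Asymptotics.isBigO_const_const c (one_ne_zero (α := ℝ)) atTop)
      exact h3.congr_left fun y => by rw [hA]; ring
    have h4 : (fun y : ℝ => ((Real.exp (-(4 * Real.pi * a * y)) : ℝ) : ℂ)) =O[atTop]
        fun y : ℝ => (y ^ m)⁻¹ :=
      (Asymptotics.isBigO_norm_left.1 (((isBigO_exp_neg_mul (a := 4 * Real.pi * a)
        (by positivity) m).norm_left).congr_left fun y => by rw [Complex.norm_real]))
    refine ((h4.mul h1).congr_right fun y => mul_one _).congr' ?_ EventuallyEq.rfl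
    filter_upwards [hpos] with y hy
    rw [hslice y hy, sub_zero]

theorem hasCuspExpansion_mul_conj {α : ℝ} {h θ : ℍ → ℂ} (hh : MDiff h) (hθ : MDiff θ)
    (hper : ∀ τ, h ((1 : ℝ) +ᵥ τ) = e α * h τ) (θper : ∀ τ, θ ((1 : ℝ) +ᵥ τ) = e α * θ τ)
    (hmer : IsMeromorphicAtCusp h)
    (θbdd : IsBoundedAtImInfty fun τ : ℍ => e (-(Int.fract α : ℝ) * (τ : ℂ)) * θ τ) :
    HasCuspExpansion fun τ => (τ.im : ℂ)⁻¹ * (h τ * (starRingEnd ℂ) (θ τ)) := by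
  obtain ⟨c, hc⟩ := exists_slice_mul_conj hh hθ hper θper hmer θbdd
  refine ⟨continuous_im_inv.mul ((RSmooth.of_mdiff hh).mul (RSmooth.of_mdiff hθ).conj).continuous,
    Polynomial.C c, fun m => ?_⟩
  refine ((isBigO_ofReal_inv_one.mul (hc m)).congr_right fun y => one_mul _).congr' ?_
    EventuallyEq.rfl
  filter_upwards [eventually_gt_atTop 0] with y hy
  rw [slice_im_inv_mul _ hy, Polynomial.eval_C]
  ring

/-- Products of raised forms with a conjugated theta function have a cusp expansion. -/
theorem hasCuspExpansion_raise {α : ℝ} {g ϑ θ : ℍ → ℂ} (hg : MDiff g) (hϑ : MDiff ϑ) (hθ : MDiff θ)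
    (gper : ∀ τ, g ((1 : ℝ) +ᵥ τ) = g τ) (ϑper : ∀ τ, ϑ ((1 : ℝ) +ᵥ τ) = e α * ϑ τ)
    (θper : ∀ τ, θ ((1 : ℝ) +ᵥ τ) = e α * θ τ) (gmer : IsMeromorphicAtCusp g)
    (ϑmer : IsMeromorphicAtCusp ϑ)
    (θbdd : IsBoundedAtImInfty fun τ : ℍ => e (-(Int.fract α : ℝ) * (τ : ℂ)) * θ τ)
    (v w : ℤ) (m n : ℕ) :
    HasCuspExpansion fun τ => (τ.im : ℂ)⁻¹ *
      (raiseIter v m g τ * raiseIter w n ϑ τ * (starRingEnd ℂ) (θ τ)) := by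
  have h1 : ∀ i j : ℕ, HasCuspExpansion fun τ => (τ.im : ℂ)⁻¹ *
      (Derivative.normalizedDerivOfComplex^[i] g τ * Derivative.normalizedDerivOfComplex^[j] ϑ τ *
        (starRingEnd ℂ) (θ τ)) := fun i j =>
    hasCuspExpansion_mul_conj ((mdiff_iterate hg i).mul (mdiff_iterate hϑ j)) hθ (fun τ => by
      have e1 := iterate_normalizedDeriv_vadd hg (c := 1) (by simpa using gper) i τ
      have e2 := iterate_normalizedDeriv_vadd hϑ ϑper j τ
      simp only [e1, e2]
      ring) θper ((gmer.iterate hg i).mul (ϑmer.iterate hϑ j)) θbdd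
  have h2 := HasCuspExpansion.sum (Finset.range (m + 1)) fun i _ =>
    HasCuspExpansion.sum (Finset.range (n + 1)) fun j _ =>
      ((h1 (m - i) (n - j)).cy_pow_mul (i + j)).const_mul (raiseCoeff v m i * raiseCoeff w n j)
  convert! h2 using 2 with τ
  rw [raiseIter_eq_raisePoly v hg, raiseIter_eq_raisePoly w hϑ, raisePoly, raisePoly,
    Finset.sum_mul_sum, Finset.sum_mul, Finset.mul_sum]
  refine Finset.sum_congr rfl fun i _ => ?_
  rw [Finset.sum_mul, Finset.mul_sum]
  refine Finset.sum_congr rfl fun j _ => ?_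
  rw [pow_add]
  ring

/-! ### Regularization by Mellin transforms -/

theorem cpow_neg_mul_inv_pow {y : ℝ} (hy : 0 < y) (s : ℂ) (j : ℕ) :
    (y : ℂ) ^ (-s) * (y : ℂ)⁻¹ ^ (j + 1) = (y : ℂ) ^ (-(s + j) - 1) := by
  have hy' : (y : ℂ) ≠ 0 := by exact_mod_cast hy.ne'
  rw [show -(s + j) - 1 = -s + -((j + 1 : ℕ) : ℂ) by push_cast; ring, cpow_add _ _ hy', cpow_neg _
    ((j + 1 : ℕ) : ℂ), cpow_natCast, inv_pow]

theorem integrableOn_cpow_mul_inv_pow {s : ℂ} {j : ℕ} (hs : -(j : ℝ) < s.re) :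
    IntegrableOn (fun y : ℝ => (y : ℂ) ^ (-s) * (y : ℂ)⁻¹ ^ (j + 1)) (Set.Ioi 1) := by
  refine (integrableOn_Ioi_cpow_of_lt (a := -(s + j) - 1) (by simp; linarith) one_pos).congr_fun
    (fun y hy => (cpow_neg_mul_inv_pow (one_pos.trans hy) s j).symm) measurableSet_Ioi

theorem integral_cpow_mul_inv_pow {s : ℂ} {j : ℕ} (hs : -(j : ℝ) < s.re) :
    ∫ y : ℝ in Set.Ioi 1, (y : ℂ) ^ (-s) * (y : ℂ)⁻¹ ^ (j + 1) = (s + j)⁻¹ := by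
  rw [setIntegral_congr_fun measurableSet_Ioi
    fun y hy => cpow_neg_mul_inv_pow (one_pos.trans hy) s j,
    integral_Ioi_cpow_of_lt (a := -(s + j) - 1) (by simp; linarith) one_pos]
  rw [ofReal_one, one_cpow, sub_add_cancel, neg_div_neg_eq, one_div]

/-- Vanishing near $0$ and rapid decay at infinity remove both edges of the Mellin strip, so the
transform is entire. -/
theorem mellin_differentiable_of_rapid_decay {ψ : ℝ → ℂ} (hloc : LocallyIntegrableOn ψ (Set.Ioi 0))
    (h0 : ∀ y ≤ 1 / 2, ψ y = 0) (htop : ∀ m : ℕ, ψ =O[atTop] fun y : ℝ => (y ^ m)⁻¹) (s : ℂ) :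
    MellinConvergent ψ s ∧ DifferentiableAt ℂ (mellin ψ) s := by
  obtain ⟨m, hm⟩ := exists_nat_gt s.re
  have h1 : ψ =O[atTop] fun y : ℝ => y ^ (-(m : ℝ)) := by
    refine (htop m).congr' EventuallyEq.rfl ?_
    filter_upwards [eventually_gt_atTop 0] with y hy
    rw [Real.rpow_neg hy.le, Real.rpow_natCast]
  have h2 : ψ =O[𝓝[>] 0] fun y : ℝ => y ^ (-(s.re - 1)) := by
    refine (Asymptotics.isBigO_zero (fun y : ℝ => y ^ (-(s.re - 1))) (𝓝[>] 0)).congr' ?_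
      EventuallyEq.rfl
    filter_upwards [Ioo_mem_nhdsGT (show (0 : ℝ) < 1 / 2 by norm_num)] with y hy
    exact (h0 y hy.2.le).symm
  exact ⟨mellinConvergent_of_isBigO_rpow hloc h1 hm h2 (by linarith),
    mellin_differentiableAt_of_isBigO_rpow hloc h1 hm h2 (by linarith)⟩

theorem locallyIntegrableOn_of_integrableOn_Iio {w : ℝ → ℂ}
    (h : ∀ t, IntegrableOn w (Set.Iio t)) (s : Set ℝ) : LocallyIntegrableOn w s := fun y _ =>
  ⟨Set.Iio (y + 1), mem_nhdsWithin_of_mem_nhds (Iio_mem_nhds (by linarith)), h _⟩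

theorem integrableOn_inv_pow_Ioc (j : ℕ) (t : ℝ) :
    IntegrableOn (fun y : ℝ => (y : ℂ)⁻¹ ^ (j + 1)) (Set.Ioc 1 t) := by
  refine (ContinuousOn.integrableOn_Icc ?_).mono_set Set.Ioc_subset_Icc_self
  refine ContinuousOn.pow (ContinuousOn.inv₀ (by fun_prop) fun y hy => ?_) _
  have : (0 : ℝ) < y := by linarith [hy.1]
  exact_mod_cast this.ne'

/-- The Mellin-type regularization of a function with a polynomial expansion in `1/y`. -/
theorem exists_regularization {w : ℝ → ℂ} (h0 : ∀ y ≤ 1 / 2, w y = 0)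
    (hint : ∀ t, IntegrableOn w (Set.Iio t)) (p : Polynomial ℂ)
    (hp : ∀ m : ℕ, (fun y : ℝ => w y - (y : ℂ)⁻¹ * p.eval (y : ℂ)⁻¹) =O[atTop]
      fun y : ℝ => (y ^ m)⁻¹) :
    ∃ (G : ℂ → ℂ) (a : ℂ), MeromorphicOn G Set.univ ∧ ContinuousAt G 0 ∧
      (∀ s : ℂ, 0 < s.re → IntegrableOn (fun y : ℝ => (y : ℂ) ^ (-s) * w y) (Set.Ioi 0) ∧
        ∫ y : ℝ in Set.Ioi 0, (y : ℂ) ^ (-s) * w y = G s + a * s⁻¹) ∧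
      Tendsto (fun t : ℝ => (∫ y in (0 : ℝ)..t, w y) - a * Real.log t) atTop (𝓝 (G 0)) := by
  -- Separates the coefficient of $1/y$, the only term that produces a pole at $s=0$ and a logarithm
  -- in $t$, from the terms of order $y^{-2}$ and beyond.
  set q := p.divX with hq
  have hpq : ∀ z : ℂ, z * p.eval z = p.coeff 0 * z + ∑ j ∈ Finset.range (q.natDegree + 1),
      q.coeff j * z ^ (j + 1 + 1) := by
    intro z
    conv_lhs => rw [← Polynomial.divX_mul_X_add p]
    rw [Polynomial.eval_add, Polynomial.eval_mul, Polynomial.eval_X, Polynomial.eval_C,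
      Polynomial.eval_eq_sum_range, mul_add, Finset.sum_mul, Finset.mul_sum, add_comm]
    congr 1
    · ring
    · exact Finset.sum_congr rfl fun j _ => by ring
  set Q : ℝ → ℂ := fun y => ∑ j ∈ Finset.range (q.natDegree + 1), q.coeff j * (y : ℂ)⁻¹ ^ (j + 1 + 1)
    with hQ
  set a := p.coeff 0 with ha
  -- The expansion is subtracted only for $y>1$, so $\psi$ still vanishes for $y\le\frac12$ and has
  -- an entire Mellin transform.
  set ψ : ℝ → ℂ := fun y => w y - (Set.Ioi 1).indicator (fun y : ℝ => a * (y : ℂ)⁻¹ ^ (0 + 1) + Q y) y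
    with hψ
  have hψ0 : ∀ y ≤ 1 / 2, ψ y = 0 := fun y hy => by
    have : y ∉ Set.Ioi (1 : ℝ) := by simp; linarith
    rw [hψ]
    simp only [Set.indicator_of_notMem this, h0 y hy, sub_zero]
  have hψint : ∀ t, IntegrableOn ψ (Set.Iio t) := fun t => by
    refine (hint t).sub ?_
    rw [IntegrableOn, integrable_indicator_iff measurableSet_Ioi, IntegrableOn,
      Measure.restrict_restrict measurableSet_Ioi]
    have h1 : Set.Ioi 1 ∩ Set.Iio t ⊆ Set.Ioc 1 t := fun y hy => ⟨hy.1, hy.2.le⟩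
    refine IntegrableOn.mono_set ?_ h1
    refine ((integrableOn_inv_pow_Ioc 0 t).const_mul a).add (integrable_finsetSum _ fun j _ => ?_)
    exact (integrableOn_inv_pow_Ioc (j + 1) t).const_mul _
  have hψtop : ∀ m : ℕ, ψ =O[atTop] fun y : ℝ => (y ^ m)⁻¹ := fun m => by
    refine (hp m).congr' ?_ EventuallyEq.rfl
    filter_upwards [eventually_gt_atTop 1] with y hy
    simp only [hψ, Set.indicator_of_mem (Set.mem_Ioi.2 hy), hpq, hQ, zero_add, pow_one]
  have hmel := mellin_differentiable_of_rapid_decay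
    (locallyIntegrableOn_of_integrableOn_Iio hψint _) hψ0 hψtop
  -- Integrating $y^{-s}y^{-(j+2)}$ over $(1,\infty)$ gives $1/(s+j+1)$, whose pole lies strictly
  -- left of $0$.
  set R : ℂ → ℂ := fun s => ∑ j ∈ Finset.range (q.natDegree + 1),
    q.coeff j * (s + ((j + 1 : ℕ) : ℂ))⁻¹ with hR
  set G : ℂ → ℂ := fun s => mellin ψ (1 - s) + R s with hG
  have hdiff : Differentiable ℂ fun s => mellin ψ (1 - s) := fun s =>
    (hmel (1 - s)).2.comp s (by fun_prop)
  -- Everything except the $1/y$ term. Its integral converges for $\operatorname{Re}s>-1$, in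
  -- particular at $s=0$, which links the continuation to the truncated integrals.
  set w' : ℝ → ℂ := fun y => ψ y + (Set.Ioi 1).indicator Q y with hw'
  have hww' : ∀ y, w y = w' y + (Set.Ioi 1).indicator (fun y : ℝ => a * (y : ℂ)⁻¹ ^ (0 + 1)) y :=
    fun y => by
      simp only [hw', hψ]
      by_cases hy : y ∈ Set.Ioi (1 : ℝ)
      · simp only [Set.indicator_of_mem hy]; ring
      · simp only [Set.indicator_of_notMem hy]; ring
  have hsub : Set.Ioi (0 : ℝ) ∩ Set.Ioi 1 = Set.Ioi 1 := by
    rw [Set.Ioi_inter_Ioi]; norm_num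
  have hind : ∀ (s : ℂ) (f : ℝ → ℂ), (fun y : ℝ => (y : ℂ) ^ (-s) * (Set.Ioi 1).indicator f y) =
      (Set.Ioi 1).indicator fun y : ℝ => (y : ℂ) ^ (-s) * f y := fun s f => by
    funext y
    rw [Set.indicator_mul_right]
  have hindI : ∀ f : ℝ → ℂ, IntegrableOn f (Set.Ioi 1) →
      IntegrableOn ((Set.Ioi 1).indicator f) (Set.Ioi 0) ∧
      ∫ y in Set.Ioi 0, (Set.Ioi 1).indicator f y = ∫ y in Set.Ioi 1, f y := fun f hf => by
    refine ⟨?_, ?_⟩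
    · rw [IntegrableOn, integrable_indicator_iff measurableSet_Ioi, IntegrableOn,
        Measure.restrict_restrict measurableSet_Ioi, Set.inter_comm, hsub]
      exact hf
    · rw [setIntegral_indicator measurableSet_Ioi, hsub]
  have hterm : ∀ s : ℂ, -1 < s.re → ∀ j : ℕ, -((j + 1 : ℕ) : ℝ) < s.re := fun s hs j => by
    push_cast
    have : (0 : ℝ) ≤ j := Nat.cast_nonneg j
    linarith
  have hmain : ∀ s : ℂ, -1 < s.re →
      IntegrableOn (fun y : ℝ => (y : ℂ) ^ (-s) * w' y) (Set.Ioi 0) ∧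
        ∫ y : ℝ in Set.Ioi 0, (y : ℂ) ^ (-s) * w' y = G s := by
    intro s hs
    have h1 : (fun y : ℝ => (y : ℂ) ^ (-s) * w' y) = fun y : ℝ => (y : ℂ) ^ (-s) * ψ y +
        (Set.Ioi 1).indicator (fun y : ℝ => (y : ℂ) ^ (-s) * Q y) y := by
      funext y
      rw [← hind]
      simp only [hw', mul_add]
    have h2 : IntegrableOn (fun y : ℝ => (y : ℂ) ^ (-s) * ψ y) (Set.Ioi 0) := by
      have := (hmel (1 - s)).1
      simp only [MellinConvergent, sub_sub_cancel_left, smul_eq_mul] at this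
      exact this
    have h4 : (fun y : ℝ => (y : ℂ) ^ (-s) * Q y) = fun y : ℝ =>
        ∑ j ∈ Finset.range (q.natDegree + 1), q.coeff j *
          ((y : ℂ) ^ (-s) * (y : ℂ)⁻¹ ^ (j + 1 + 1)) := by
      funext y
      rw [hQ, Finset.mul_sum]
      exact Finset.sum_congr rfl fun j _ => by ring
    have h5 : ∀ j ∈ Finset.range (q.natDegree + 1), IntegrableOn (fun y : ℝ => q.coeff j *
          ((y : ℂ) ^ (-s) * (y : ℂ)⁻¹ ^ (j + 1 + 1))) (Set.Ioi 1) := fun j _ =>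
      (integrableOn_cpow_mul_inv_pow (hterm s hs j)).const_mul _
    have h3 : IntegrableOn (fun y : ℝ => (y : ℂ) ^ (-s) * Q y) (Set.Ioi 1) := by
      rw [h4]
      exact integrable_finsetSum _ h5
    obtain ⟨h6, h7⟩ := hindI _ h3
    rw [h1]
    refine ⟨h2.add h6, ?_⟩
    rw [integral_add h2 h6, h7, h4, integral_finsetSum _ h5, hG, hR]
    congr 1
    · simp only [mellin, sub_sub_cancel_left, smul_eq_mul]
    · refine Finset.sum_congr rfl fun j _ => ?_
      rw [integral_const_mul, integral_cpow_mul_inv_pow (hterm s hs j)]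
  refine ⟨G, a, ?_, ?_, fun s hs => ?_, ?_⟩
  · intro s _
    refine MeromorphicAt.add ?_ ?_
    · exact (hdiff.analyticAt s).meromorphicAt
    · refine MeromorphicAt.fun_sum fun j _ => ?_
      exact (MeromorphicAt.const _ s).mul ((MeromorphicAt.id s).add (MeromorphicAt.const _ s)).inv
  · refine hdiff.continuous.continuousAt.add ?_
    refine tendsto_finsetSum _ fun j _ => ?_
    refine continuousAt_const.mul (ContinuousAt.inv₀ (by fun_prop) ?_)
    rw [zero_add]
    exact_mod_cast Nat.succ_ne_zero j
  · obtain ⟨h1, h2⟩ := hmain s (by linarith)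
    have h3 : (fun y : ℝ => (y : ℂ) ^ (-s) * w y) = fun y : ℝ => (y : ℂ) ^ (-s) * w' y +
        (Set.Ioi 1).indicator (fun y : ℝ => (y : ℂ) ^ (-s) * (a * (y : ℂ)⁻¹ ^ (0 + 1))) y := by
      funext y
      rw [← hind, hww' y]
      ring
    have hs' : -((0 : ℕ) : ℝ) < s.re := by simpa using hs
    have h4 : (fun y : ℝ => (y : ℂ) ^ (-s) * (a * (y : ℂ)⁻¹ ^ (0 + 1))) = fun y : ℝ =>
        a * ((y : ℂ) ^ (-s) * (y : ℂ)⁻¹ ^ (0 + 1)) := by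
      funext y
      ring
    have h5 := (integrableOn_cpow_mul_inv_pow hs').const_mul a
    obtain ⟨h6, h7⟩ := hindI _ h5
    rw [h3, h4]
    refine ⟨h1.add h6, ?_⟩
    rw [integral_add h1 h6, h7, h2, integral_const_mul, integral_cpow_mul_inv_pow hs']
    simp
  -- At $s=0$ the removed term $a/y$ integrates to $a\log t$ over $(1,t)$.
  · obtain ⟨h1, h2⟩ := hmain 0 (by simp)
    simp only [neg_zero, cpow_zero, one_mul] at h1 h2
    have h3 := intervalIntegral_tendsto_integral_Ioi 0 h1 tendsto_id
    rw [h2] at h3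
    refine h3.congr' ?_
    filter_upwards [eventually_gt_atTop 1] with t ht
    have ht0 : (0 : ℝ) ≤ t := by linarith
    have h4 : ∫ y in (0 : ℝ)..t, (Set.Ioi 1).indicator (fun y : ℝ => a * (y : ℂ)⁻¹ ^ (0 + 1)) y =
        a * Real.log t := by
      rw [intervalIntegral.integral_of_le ht0, setIntegral_indicator measurableSet_Ioi,
        show Set.Ioc 0 t ∩ Set.Ioi 1 = Set.Ioc 1 t by
          ext y; simp only [Set.mem_inter_iff, Set.mem_Ioc, Set.mem_Ioi]
          constructor
          · rintro ⟨⟨_, h⟩, h'⟩; exact ⟨h', h⟩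
          · rintro ⟨h, h'⟩; exact ⟨⟨by linarith, h'⟩, h⟩,
        ← intervalIntegral.integral_of_le ht.le]
      simp only [zero_add, pow_one]
      rw [intervalIntegral.integral_const_mul]
      have : ∫ y in (1 : ℝ)..t, (y : ℂ)⁻¹ = ((∫ y in (1 : ℝ)..t, y⁻¹ : ℝ) : ℂ) := by
        rw [← intervalIntegral.integral_ofReal]
        simp
      rw [this, integral_inv_of_pos one_pos (by linarith), div_one]
    have h5 : IntervalIntegrable w' volume 0 t := by
      rw [intervalIntegrable_iff_integrableOn_Ioc_of_le ht0]
      exact h1.mono_set fun y hy => hy.1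
    have h6 : IntervalIntegrable ((Set.Ioi 1).indicator fun y : ℝ => a * (y : ℂ)⁻¹ ^ (0 + 1))
        volume 0 t := by
      rw [intervalIntegrable_iff_integrableOn_Ioc_of_le ht0, IntegrableOn,
        integrable_indicator_iff measurableSet_Ioi, IntegrableOn,
        Measure.restrict_restrict measurableSet_Ioi]
      refine IntegrableOn.mono_set ((integrableOn_inv_pow_Ioc 0 t).const_mul a) ?_
      exact fun y hy => ⟨hy.1, hy.2.2⟩
    rw [← h4, intervalIntegral.integral_congr fun y _ => hww' y,
      intervalIntegral.integral_add h5 h6, add_sub_cancel_right]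
    rfl

/-! ### Regularized integrals -/

theorem continuousOn_comp_ofComplex {F : ℍ → ℂ} (hF : Continuous F) :
    ContinuousOn (fun z : ℂ => F (ofComplex z)) {z | 0 < z.im} := by
  intro z hz
  have h1 : ContinuousAt ((fun z : ℂ => F (ofComplex z)) ∘ UpperHalfPlane.coe) (⟨z, hz⟩ : ℍ) := by
    have : ((fun z : ℂ => F (ofComplex z)) ∘ UpperHalfPlane.coe) = F := by
      funext τ
      simp [ofComplex_apply]
    rw [this]
    exact hF.continuousAt
  exact ((UpperHalfPlane.isOpenEmbedding_coe.continuousAt_iff).1 h1).continuousWithinAt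

theorem integrableOn_truncatedDomain_of_continuousOn {f : ℂ → ℂ}
    (hf : ContinuousOn f {z | 0 < z.im}) (t : ℝ) : IntegrableOn f (truncatedDomain t) := by
  let K : Set ℂ := {z | |z.re| ≤ 1 / 2 ∧ 1 ≤ ‖z‖ ∧ 0 ≤ z.im ∧ z.im ≤ t}
  have hsub : truncatedDomain t ⊆ K := fun z hz =>
    ⟨abs_le.2 ⟨by linarith [hz.1], hz.2.1.le⟩, hz.2.2.1.le, hz.2.2.2.1.le, hz.2.2.2.2.le⟩
  have hpos : K ⊆ {z | 0 < z.im} := by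
    rintro z ⟨h1, h2, h3, -⟩
    -- A real point with $|{\operatorname{Re}z}|\le\frac12$ cannot satisfy $|z|\ge1$. Thus the
    -- compact set containing $F_t$ stays off the real axis.
    refine lt_of_le_of_ne h3 fun h4 => ?_
    have h5 := Complex.norm_le_abs_re_add_abs_im z
    rw [← h4, abs_zero] at h5
    linarith
  have hcomp : IsCompact K := by
    refine Metric.isCompact_of_isClosed_isBounded ?_ ?_
    · have c1 : IsClosed {z : ℂ | |z.re| ≤ 1 / 2} :=
        isClosed_le (continuous_abs.comp continuous_re) continuous_const
      have c2 : IsClosed {z : ℂ | 1 ≤ ‖z‖} := isClosed_le continuous_const continuous_norm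
      have c3 : IsClosed {z : ℂ | 0 ≤ z.im} := isClosed_le continuous_const continuous_im
      have c4 : IsClosed {z : ℂ | z.im ≤ t} := isClosed_le continuous_im continuous_const
      exact c1.inter (c2.inter (c3.inter c4))
    · refine (Metric.isBounded_closedBall (x := (0 : ℂ)) (r := 1 / 2 + t)).subset ?_
      rintro z ⟨h1, -, h3, h4⟩
      rw [mem_closedBall_zero_iff]
      refine (Complex.norm_le_abs_re_add_abs_im z).trans ?_
      rw [abs_of_nonneg h3]
      exact add_le_add h1 h4
  exact ((hf.mono hpos).integrableOn_compact hcomp).mono_set hsub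

theorem integrableOn_truncatedDomain {F : ℍ → ℂ} (hF : Continuous F) (s : ℂ) (t : ℝ) :
    IntegrableOn (fun z : ℂ => F (ofComplex z) * (z.im : ℂ) ^ (-s)) (truncatedDomain t) := by
  refine integrableOn_truncatedDomain_of_continuousOn
    ((continuousOn_comp_ofComplex hF).mul fun z hz => ?_) t
  have h1 : ContinuousAt (fun y : ℝ => (y : ℂ) ^ (-s)) z.im :=
    Complex.continuousAt_ofReal_cpow_const _ _ (Or.inr hz.ne')
  exact (h1.comp continuous_im.continuousAt).continuousWithinAt

theorem measurableSet_truncatedDomain (t : ℝ) : MeasurableSet (truncatedDomain t) := by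
  have c1 : IsOpen {z : ℂ | -(1 / 2) < z.re} := isOpen_lt continuous_const continuous_re
  have c2 : IsOpen {z : ℂ | z.re < 1 / 2} := isOpen_lt continuous_re continuous_const
  have c3 : IsOpen {z : ℂ | 1 < ‖z‖} := isOpen_lt continuous_const continuous_norm
  have c4 : IsOpen {z : ℂ | 0 < z.im} := isOpen_lt continuous_const continuous_im
  have c5 : IsOpen {z : ℂ | z.im < t} := isOpen_lt continuous_im continuous_const
  exact (c1.inter (c2.inter (c3.inter (c4.inter c5)))).measurableSet

/-- The standard fundamental domain for `SL₂(ℤ)`. -/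
def fundDomain : Set ℂ := {z | -(1 / 2) < z.re ∧ z.re < 1 / 2 ∧ 1 < ‖z‖ ∧ 0 < z.im}

/-- The integral over the horizontal slices of the standard fundamental domain. -/
def domainSlice (F : ℍ → ℂ) (y : ℝ) : ℂ :=
  ∫ x : ℝ, fundDomain.indicator (fun z => F (ofComplex z)) (x + y * I)

/-- The truncation only restricts $y<t$ and the factor $y^{-s}$ depends on $y$ alone, so a slice
function independent of $t$ and $s$ carries all the information. -/
theorem fubini_truncatedDomain {F : ℍ → ℂ} (hF : Continuous F) (s : ℂ) (t : ℝ) :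
    IntegrableOn (fun y : ℝ => (y : ℂ) ^ (-s) * domainSlice F y) (Set.Iio t) ∧
    ∫ z in truncatedDomain t, F (ofComplex z) * (z.im : ℂ) ^ (-s) =
      ∫ y in Set.Iio t, (y : ℂ) ^ (-s) * domainSlice F y := by
  set h : ℂ → ℂ := (truncatedDomain t).indicator fun z => F (ofComplex z) * (z.im : ℂ) ^ (-s) with hh
  have hint : Integrable h := (integrable_indicator_iff (measurableSet_truncatedDomain t)).2
    (integrableOn_truncatedDomain hF s t)
  have hsymm := Complex.volume_preserving_equiv_real_prod.symm
  have hint2 : Integrable (fun p : ℝ × ℝ => h (p.1 + p.2 * I)) (volume.prod volume) := by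
    have := (hsymm.integrable_comp_emb measurableEquivRealProd.symm.measurableEmbedding).2 hint
    refine this.congr (Eventually.of_forall fun p => ?_)
    simp only [Function.comp_apply, measurableEquivRealProd_symm_apply, Complex.mk_eq_add_mul_I]
  have hinner : (fun y : ℝ => ∫ x : ℝ, h (x + y * I)) =
      (Set.Iio t).indicator fun y : ℝ => (y : ℂ) ^ (-s) * domainSlice F y := by
    funext y
    by_cases hy : y ∈ Set.Iio t
    · rw [Set.indicator_of_mem hy, domainSlice, ← integral_const_mul]
      refine integral_congr_ae (Eventually.of_forall fun x => ?_)
      have him : ((x : ℂ) + y * I).im = y := by simp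
      have : ((x : ℂ) + y * I) ∈ truncatedDomain t ↔ ((x : ℂ) + y * I) ∈ fundDomain := by
        simp only [truncatedDomain, fundDomain, Set.mem_ofPred_eq, him, Set.mem_Iio.1 hy, and_true]
      simp only [hh]
      by_cases hx : ((x : ℂ) + y * I) ∈ fundDomain
      · rw [Set.indicator_of_mem (this.2 hx), Set.indicator_of_mem hx, him, mul_comm]
      · rw [Set.indicator_of_notMem (this.not.2 hx), Set.indicator_of_notMem hx, mul_zero]
    · rw [Set.indicator_of_notMem hy]
      have : ∀ x : ℝ, h (x + y * I) = 0 := fun x => Set.indicator_of_notMem (fun hx => hy (by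
        have := hx.2.2.2.2
        simpa using this)) _
      simp [this]
  refine ⟨?_, ?_⟩
  · have := hint2.integral_prod_right
    simp only [hinner] at this
    rwa [integrable_indicator_iff measurableSet_Iio] at this
  · rw [← integral_indicator (measurableSet_truncatedDomain t),
      ← hsymm.integral_comp measurableEquivRealProd.symm.measurableEmbedding,
      ← integral_indicator measurableSet_Iio, ← hinner, Measure.volume_eq_prod,
      ← integral_prod_symm _ hint2]
    refine integral_congr_ae (Eventually.of_forall fun p => ?_)
    simp only [measurableEquivRealProd_symm_apply, Complex.mk_eq_add_mul_I]
    rfl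

theorem domainSlice_of_le (F : ℍ → ℂ) {y : ℝ} (hy : y ≤ 1 / 2) : domainSlice F y = 0 := by
  have : ∀ x : ℝ, fundDomain.indicator (fun z => F (ofComplex z)) (x + y * I) = 0 := fun x => by
    refine Set.indicator_of_notMem (fun hx => ?_) _
    obtain ⟨h1, h2, h3, h4⟩ := hx
    have h5 : ‖(x : ℂ) + y * I‖ ≤ |x| + |y| := by
      simpa using Complex.norm_le_abs_re_add_abs_im ((x : ℂ) + y * I)
    simp only [add_re, ofReal_re, mul_re, Complex.I_re, mul_zero, ofReal_im, Complex.I_im, mul_one, sub_self,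
      add_zero, add_im, mul_im, zero_add] at h1 h2 h4
    have h6 : |x| < 1 / 2 := abs_lt.2 ⟨h1, h2⟩
    rw [abs_of_pos h4] at h5
    linarith
  simp [domainSlice, this]

theorem domainSlice_of_gt (F : ℍ → ℂ) {y : ℝ} (hy : 1 < y) : domainSlice F y = slice F y := by
  rw [slice, intervalIntegral.integral_of_le (by norm_num), integral_Ioc_eq_integral_Ioo,
    ← integral_indicator measurableSet_Ioo, domainSlice]
  refine integral_congr_ae (Eventually.of_forall fun x => ?_)
  have h1 : ((x : ℂ) + y * I) ∈ fundDomain ↔ x ∈ Set.Ioo (-(1 / 2) : ℝ) (1 / 2) := by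
    have h2 : 1 < ‖(x : ℂ) + y * I‖ := by
      have := Complex.abs_im_le_norm ((x : ℂ) + y * I)
      have h3 : ((x : ℂ) + y * I).im = y := by simp
      rw [h3, abs_of_pos (by linarith)] at this
      linarith
    have h4 : 0 < y := by linarith
    simp [fundDomain, h2, h4]
  dsimp only
  by_cases hx : x ∈ Set.Ioo (-(1 / 2) : ℝ) (1 / 2)
  · rw [Set.indicator_of_mem hx, Set.indicator_of_mem (h1.2 hx)]
  · rw [Set.indicator_of_notMem hx, Set.indicator_of_notMem (h1.not.2 hx)]

theorem setIntegral_Iio_eq {f : ℝ → ℂ} (h0 : ∀ y ≤ 0, f y = 0) {t : ℝ} (ht : 0 ≤ t) :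
    ∫ y in Set.Iio t, f y = ∫ y in (0 : ℝ)..t, f y := by
  rw [intervalIntegral.integral_of_le ht, integral_Ioc_eq_integral_Ioo,
    ← integral_indicator measurableSet_Iio, ← integral_indicator measurableSet_Ioo]
  refine integral_congr_ae (Eventually.of_forall fun y => ?_)
  rcases le_or_gt y 0 with hy | hy
  · rw [Set.indicator_of_notMem (fun h : y ∈ Set.Ioo 0 t => h.1.not_ge hy)]
    by_cases hyt : y ∈ Set.Iio t
    · rw [Set.indicator_of_mem hyt, h0 y hy]
    · rw [Set.indicator_of_notMem hyt]
  · by_cases hyt : y ∈ Set.Iio t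
    · rw [Set.indicator_of_mem hyt, Set.indicator_of_mem (show y ∈ Set.Ioo 0 t from ⟨hy, hyt⟩)]
    · rw [Set.indicator_of_notMem hyt, Set.indicator_of_notMem fun h => hyt h.2]

theorem HasCuspExpansion.exists_regularization {F : ℍ → ℂ} (hF : HasCuspExpansion F) :
    ∃ (G : ℂ → ℂ) (a : ℂ), MeromorphicOn G Set.univ ∧ ContinuousAt G 0 ∧
      (∀ s : ℂ, 0 < s.re → Tendsto
        (fun t : ℝ => ∫ z in truncatedDomain t, F (ofComplex z) * (z.im : ℂ) ^ (-s)) atTop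
        (𝓝 (G s + a * s⁻¹))) ∧
      Tendsto (fun t : ℝ => (∫ z in truncatedDomain t, F (ofComplex z)) - a * Real.log t) atTop
        (𝓝 (G 0)) := by
  obtain ⟨p, hp⟩ := hF.asymp
  have h0 : ∀ y ≤ 1 / 2, domainSlice F y = 0 := fun y => domainSlice_of_le F
  have hint : ∀ t, IntegrableOn (domainSlice F) (Set.Iio t) := fun t => by
    simpa using (fubini_truncatedDomain hF.cont 0 t).1
  obtain ⟨G, a, h1, h2, h3, h4⟩ := CMGreen.exists_regularization h0 hint p fun m =>
    (hp m).congr' (by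
      filter_upwards [eventually_gt_atTop 1] with y hy
      rw [domainSlice_of_gt F hy]) EventuallyEq.rfl
  refine ⟨G, a, h1, h2, fun s hs => ?_, h4.congr' ?_⟩
  · obtain ⟨h5, h6⟩ := h3 s hs
    have h7 := intervalIntegral_tendsto_integral_Ioi 0 h5 tendsto_id
    rw [h6] at h7
    refine h7.congr' ?_
    filter_upwards [eventually_ge_atTop 0] with t ht
    rw [(fubini_truncatedDomain hF.cont s t).2, setIntegral_Iio_eq (fun y hy => ?_) ht]
    · rfl
    · rw [h0 y (hy.trans (by norm_num)), mul_zero]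
  · filter_upwards [eventually_ge_atTop 0] with t ht
    have h5 := (fubini_truncatedDomain hF.cont 0 t).2
    simp only [neg_zero, cpow_zero, mul_one, one_mul] at h5
    rw [h5, setIntegral_Iio_eq (fun y hy => h0 y (hy.trans (by norm_num))) ht]

theorem HasCuspExpansion.regIntegrable {F : ℍ → ℂ} (hF : HasCuspExpansion F) : RegIntegrable F := by
  obtain ⟨G, a, h1, h2, h3, -⟩ := hF.exists_regularization
  -- The principal part is $a/s$, so the constant term is the value at $0$ of the remainder $G$.
  refine ⟨G 0, fun s => G s + a * s⁻¹, ?_, ⟨0, fun s hs => ⟨fun t =>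
    integrableOn_truncatedDomain hF.cont s t, h3 s hs⟩⟩, Polynomial.C a * Polynomial.X, by simp, ?_⟩
  · exact h1.add fun s _ => (MeromorphicAt.const a s).mul (MeromorphicAt.id s).inv
  · simpa using (h2.tendsto.mono_left nhdsWithin_le_nhds)

/-- If the integrals over truncated domains tend to zero then the regularized integral is zero. -/
theorem HasCuspExpansion.hasRegIntegral_zero {F : ℍ → ℂ} (hF : HasCuspExpansion F)
    (h : Tendsto (fun t : ℝ => ∫ z in truncatedDomain t, F (ofComplex z)) atTop (𝓝 0)) :
    HasRegIntegral F 0 := by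
  obtain ⟨G, a, h1, h2, h3, h4⟩ := hF.exists_regularization
  have h5 : Tendsto (fun t : ℝ => a * (Real.log t : ℂ)) atTop (𝓝 (0 - G 0)) := by
    simpa using h.sub h4
  -- Both the truncated integrals and their difference with $a\log t$ converge, while $\log t$ is
  -- unbounded. Without the logarithm there is no pole, and the limit $0$ equals $G(0)$.
  have ha : a = 0 := by
    by_contra ha
    have h6 : Tendsto (fun t : ℝ => ‖a * (Real.log t : ℂ)‖) atTop atTop := by
      simp only [norm_mul, Complex.norm_real]
      exact (tendsto_norm_atTop_atTop.comp Real.tendsto_log_atTop).const_mul_atTop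
        (norm_pos_iff.2 ha)
    exact not_tendsto_nhds_of_tendsto_atTop h6 _ h5.norm
  subst ha
  simp only [zero_mul, sub_zero, add_zero] at h3 h4
  have hG : G 0 = 0 := tendsto_nhds_unique h4 h
  refine ⟨G, h1, ⟨0, fun s hs => ⟨fun t => integrableOn_truncatedDomain hF.cont s t, h3 s hs⟩⟩,
    0, by simp, ?_⟩
  have h6 : Tendsto G (𝓝[≠] 0) (𝓝 (G 0)) := h2.tendsto.mono_left nhdsWithin_le_nhds
  simpa [hG] using h6

theorem HasRegIntegral.add {F F' : ℍ → ℂ} {c c' : ℂ} (h : HasRegIntegral F c)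
    (h' : HasRegIntegral F' c') : HasRegIntegral (fun τ => F τ + F' τ) (c + c') := by
  obtain ⟨G, hG, ⟨σ, hσ⟩, P, hP, hc⟩ := h
  obtain ⟨G', hG', ⟨σ', hσ'⟩, P', hP', hc'⟩ := h'
  refine ⟨fun s => G s + G' s, hG.add hG', ⟨max σ σ', fun s hs => ?_⟩, P + P', by simp [hP, hP'], ?_⟩
  · obtain ⟨i1, l1⟩ := hσ s ((le_max_left _ _).trans_lt hs)
    obtain ⟨i2, l2⟩ := hσ' s ((le_max_right _ _).trans_lt hs)
    simp only [add_mul]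
    refine ⟨fun t => (i1 t).add (i2 t), (l1.add l2).congr fun t => ?_⟩
    exact (integral_add (i1 t) (i2 t)).symm
  · refine (hc.add hc').congr fun s => ?_
    rw [Polynomial.eval_add]
    ring

theorem HasRegIntegral.const_mul {F : ℍ → ℂ} {c : ℂ} (h : HasRegIntegral F c) (b : ℂ) :
    HasRegIntegral (fun τ => b * F τ) (b * c) := by
  obtain ⟨G, hG, ⟨σ, hσ⟩, P, hP, hc⟩ := h
  refine ⟨fun s => b * G s, (MeromorphicOn.const b).mul hG, ⟨σ, fun s hs => ?_⟩,
    Polynomial.C b * P, by simp [hP], ?_⟩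
  · obtain ⟨i1, l1⟩ := hσ s hs
    simp only [mul_assoc]
    refine ⟨fun t => (i1 t).const_mul b, (l1.const_mul b).congr fun t => ?_⟩
    exact (integral_const_mul b _).symm
  · refine (hc.const_mul b).congr fun s => ?_
    rw [Polynomial.eval_mul, Polynomial.eval_C]
    ring

theorem hasRegIntegral_sum_zero {ι : Type*} (s : Finset ι) {F : ι → ℍ → ℂ} (b : ι → ℂ)
    (hF : ∀ i ∈ s, HasRegIntegral (F i) 0) :
    ∀ {H : ℍ → ℂ} {c : ℂ}, HasRegIntegral H c →
      HasRegIntegral (fun τ => H τ + ∑ i ∈ s, b i * F i τ) c := by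
  classical
  induction s using Finset.induction_on with
  | empty => intro H c hH; simpa using hH
  | insert i s hi ih =>
    intro H c hH
    have h1 := ih (fun j hj => hF j (by simp [hj])) (hH.add ((hF i (by simp)).const_mul (b i)))
    simp only [Finset.sum_insert hi]
    simpa [add_assoc] using h1

/-! ### Stokes' theorem on the truncated fundamental domain -/

theorem RSmooth.dTau {F : ℍ → ℂ} (hF : RSmooth F) : RSmooth (dTau F) := by
  have h1 := (RSmooth.const (2 * Real.pi * I)).mul (hF.raise 0)
  have h2 : (fun τ => 2 * Real.pi * I * CMGreen.raise 0 F τ) = CMGreen.dTau F := by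
    funext τ
    rw [raise_eq, Int.cast_zero, zero_mul, zero_mul, add_zero, ← mul_assoc,
      mul_inv_cancel₀ Complex.two_pi_I_ne_zero, one_mul]
  rwa [h2] at h1

theorem one_sub_sq_pos {x : ℝ} (hx : x ∈ Set.Icc (-(1 / 2) : ℝ) (1 / 2)) : 0 < 1 - x ^ 2 := by
  nlinarith [hx.1, hx.2]

theorem mem_truncatedDomain_iff {t x y : ℝ} (hx : x ∈ Set.Ioo (-(1 / 2) : ℝ) (1 / 2)) :
    ((x : ℂ) + y * I) ∈ truncatedDomain t ↔ y ∈ Set.Ioo √(1 - x ^ 2) t := by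
  have h1 := one_sub_sq_pos (Set.Ioo_subset_Icc_self hx)
  have h2 : 1 < ‖(x : ℂ) + y * I‖ ↔ 1 < x ^ 2 + y ^ 2 := by
    rw [Complex.norm_add_mul_I, Real.lt_sqrt zero_le_one, one_pow]
  have hre : ((x : ℂ) + y * I).re = x := by simp
  have him : ((x : ℂ) + y * I).im = y := by simp
  simp only [truncatedDomain, Set.mem_ofPred_eq, hre, him, h2, Set.mem_Ioo]
  constructor
  · rintro ⟨-, -, h3, h4, h5⟩
    exact ⟨(Real.sqrt_lt' h4).2 (by linarith), h5⟩
  · rintro ⟨h3, h5⟩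
    have h4 : 0 < y := (Real.sqrt_pos.2 h1).trans h3
    exact ⟨hx.1, hx.2, by linarith [(Real.sqrt_lt' h4).1 h3], h4, h5⟩

theorem integral_truncatedDomain_eq {f : ℂ → ℂ} (hf : ContinuousOn f {z | 0 < z.im}) {t : ℝ}
    (ht : 1 ≤ t) : ∫ z in truncatedDomain t, f z =
      ∫ x in (-(1 / 2) : ℝ)..1 / 2, ∫ y in √(1 - x ^ 2)..t, f (x + y * I) := by
  have hint : Integrable ((truncatedDomain t).indicator f) :=
    (integrable_indicator_iff (measurableSet_truncatedDomain t)).2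
      (integrableOn_truncatedDomain_of_continuousOn hf t)
  have hsymm := Complex.volume_preserving_equiv_real_prod.symm
  have hint2 : Integrable (fun p : ℝ × ℝ => (truncatedDomain t).indicator f (p.1 + p.2 * I))
      (volume.prod volume) := by
    have := (hsymm.integrable_comp_emb measurableEquivRealProd.symm.measurableEmbedding).2 hint
    refine this.congr (Eventually.of_forall fun p => ?_)
    simp only [Function.comp_apply, measurableEquivRealProd_symm_apply, Complex.mk_eq_add_mul_I]
  rw [← integral_indicator (measurableSet_truncatedDomain t),
    ← hsymm.integral_comp measurableEquivRealProd.symm.measurableEmbedding,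
    intervalIntegral.integral_of_le (by norm_num), integral_Ioc_eq_integral_Ioo,
    ← integral_indicator measurableSet_Ioo]
  simp only [measurableEquivRealProd_symm_apply, Complex.mk_eq_add_mul_I]
  rw [Measure.volume_eq_prod, integral_prod _ hint2]
  refine integral_congr_ae (Eventually.of_forall fun x => ?_)
  dsimp only
  by_cases hx : x ∈ Set.Ioo (-(1 / 2) : ℝ) (1 / 2)
  · have hb : √(1 - x ^ 2) ≤ t := by
      refine le_trans ?_ ht
      rw [Real.sqrt_le_one]
      nlinarith
    rw [Set.indicator_of_mem hx, intervalIntegral.integral_of_le hb, integral_Ioc_eq_integral_Ioo,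
      ← integral_indicator measurableSet_Ioo]
    refine integral_congr_ae (Eventually.of_forall fun y => ?_)
    dsimp only
    by_cases hy : y ∈ Set.Ioo √(1 - x ^ 2) t
    · rw [Set.indicator_of_mem hy, Set.indicator_of_mem ((mem_truncatedDomain_iff hx).2 hy)]
    · rw [Set.indicator_of_notMem hy,
        Set.indicator_of_notMem ((mem_truncatedDomain_iff hx).not.2 hy)]
  · rw [Set.indicator_of_notMem hx]
    have : ∀ y : ℝ, (truncatedDomain t).indicator f (x + y * I) = 0 := fun y =>
      Set.indicator_of_notMem (fun h => hx ⟨by simpa using h.1, by simpa using h.2.1⟩) _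
    simp [this]

theorem fderiv_apply_fst {F : ℝ × ℝ → ℂ} {p : ℝ × ℝ} {D : ℂ} (hF : DifferentiableAt ℝ F p)
    (h : HasDerivAt (fun x => F (x, p.2)) D p.1) : fderiv ℝ F p (1, 0) = D := by
  have h1 : HasDerivAt (fun x : ℝ => (x, p.2)) ((1 : ℝ), (0 : ℝ)) p.1 :=
    (hasDerivAt_id _).prodMk (hasDerivAt_const _ _)
  exact (hF.hasFDerivAt.comp_hasDerivAt p.1 h1).unique h

theorem fderiv_apply_snd {F : ℝ × ℝ → ℂ} {p : ℝ × ℝ} {D : ℂ} (hF : DifferentiableAt ℝ F p)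
    (h : HasDerivAt (fun y => F (p.1, y)) D p.2) : fderiv ℝ F p (0, 1) = D := by
  have h1 : HasDerivAt (fun y : ℝ => (p.1, y)) ((0 : ℝ), (1 : ℝ)) p.2 :=
    (hasDerivAt_const _ _).prodMk (hasDerivAt_id _)
  exact (hF.hasFDerivAt.comp_hasDerivAt p.2 h1).unique h

theorem hasDerivAt_sqrt_one_sub_sq {x : ℝ} (hx : x ∈ Set.Icc (-(1 / 2) : ℝ) (1 / 2)) :
    HasDerivAt (fun x : ℝ => √(1 - x ^ 2)) (-x / √(1 - x ^ 2)) x := by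
  have h1 := one_sub_sq_pos hx
  have h2 : HasDerivAt (fun x : ℝ => 1 - x ^ 2) (-(2 * x)) x := by
    simpa using (hasDerivAt_pow 2 x).const_sub 1
  refine (h2.sqrt h1.ne').congr_deriv ?_
  field_simp

/-- The height of the point with parameters `(x, v)` above the unit circle. -/
def arcHeight (t : ℝ) (p : ℝ × ℝ) : ℝ := (t - √(1 - p.1 ^ 2)) * p.2 + √(1 - p.1 ^ 2)

/-- Parametrization of the truncated fundamental domain by a rectangle. -/
def arcParam (t : ℝ) (p : ℝ × ℝ) : ℂ := p.1 + arcHeight t p * I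

theorem arcHeight_pos {t : ℝ} (ht : 1 < t) {p : ℝ × ℝ} (h1 : p.1 ∈ Set.Icc (-(1 / 2) : ℝ) (1 / 2))
    (h2 : p.2 ∈ Set.Icc (0 : ℝ) 1) : 0 < arcHeight t p := by
  have h3 := Real.sqrt_pos.2 (one_sub_sq_pos h1)
  have h4 : √(1 - p.1 ^ 2) ≤ 1 := by
    rw [Real.sqrt_le_one]
    nlinarith
  have h5 : 0 ≤ (t - √(1 - p.1 ^ 2)) * p.2 := mul_nonneg (by linarith) h2.1
  rw [arcHeight]
  linarith

/-- The rectangle parametrizing the truncated fundamental domain. -/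
def arcRect : Set (ℝ × ℝ) := Set.Icc (-(1 / 2)) (1 / 2) ×ˢ Set.Icc 0 1

theorem arcParam_im {t : ℝ} (p : ℝ × ℝ) : (arcParam t p).im = arcHeight t p := by simp [arcParam]

theorem continuous_arcParam (t : ℝ) : Continuous (arcParam t) := by
  unfold arcParam arcHeight
  fun_prop

theorem differentiableAt_arcParam (t : ℝ) {p : ℝ × ℝ} (hp : p ∈ arcRect) :
    DifferentiableAt ℝ (arcParam t) p := by
  have h1 : DifferentiableAt ℝ (fun p : ℝ × ℝ => √(1 - p.1 ^ 2)) p :=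
    (hasDerivAt_sqrt_one_sub_sq hp.1).differentiableAt.comp p differentiableAt_fst
  have h2 : DifferentiableAt ℝ (arcHeight t) p := by
    unfold arcHeight
    fun_prop
  unfold arcParam
  exact (Complex.ofRealCLM.differentiableAt.comp p differentiableAt_fst).add
    ((Complex.ofRealCLM.differentiableAt.comp p h2).mul_const I)

theorem hasDerivAt_arcParam_fst (t : ℝ) {p : ℝ × ℝ} (hp : p ∈ arcRect) :
    HasDerivAt (fun x => arcParam t (x, p.2))
      (1 + ((-p.1 / √(1 - p.1 ^ 2) * (1 - p.2) : ℝ) : ℂ) * I) p.1 := by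
  have h1 := hasDerivAt_sqrt_one_sub_sq hp.1
  have h2 : HasDerivAt (fun x => arcHeight t (x, p.2)) (-p.1 / √(1 - p.1 ^ 2) * (1 - p.2)) p.1 := by
    unfold arcHeight
    exact (((h1.const_sub t).mul_const p.2).add h1).congr_deriv (by ring)
  exact (hasDerivAt_id p.1).ofReal_comp.add (h2.ofReal_comp.mul_const I)

theorem hasDerivAt_arcParam_snd (t : ℝ) (p : ℝ × ℝ) :
    HasDerivAt (fun y => arcParam t (p.1, y)) (((t - √(1 - p.1 ^ 2) : ℝ) : ℂ) * I) p.2 := by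
  have h2 : HasDerivAt (fun y => arcHeight t (p.1, y)) (t - √(1 - p.1 ^ 2)) p.2 := by
    unfold arcHeight
    simpa using ((hasDerivAt_id p.2).const_mul (t - √(1 - p.1 ^ 2))).add_const √(1 - p.1 ^ 2)
  simpa [arcParam] using (h2.ofReal_comp.mul_const I).const_add (p.1 : ℂ)

section

variable {u : ℍ → ℂ}

/-- Chain rule for the straightened coordinates; $a$ and $b$ are the partial derivatives of $u$ in
$x$ and $y$ at the image point. -/
theorem comp_arcParam_deriv (hu : RSmooth u) {t : ℝ} (ht : 1 < t) {p : ℝ × ℝ} (hp : p ∈ arcRect) :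
    ∃ a b : ℂ, dTau u (ofComplex (arcParam t p)) = (a - I * b) / 2 ∧
      DifferentiableAt ℝ (fun p => u (ofComplex (arcParam t p))) p ∧
      HasDerivAt (fun x => u (ofComplex (arcParam t (x, p.2))))
        (a + (-p.1 / √(1 - p.1 ^ 2) * (1 - p.2) : ℝ) * b) p.1 ∧
      HasDerivAt (fun y => u (ofComplex (arcParam t (p.1, y)))) ((t - √(1 - p.1 ^ 2) : ℝ) * b) p.2 := by
  have hpos : 0 < (arcParam t p).im := by
    rw [arcParam_im]; exact arcHeight_pos ht hp.1 hp.2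
  have hc : ((ofComplex (arcParam t p) : ℍ) : ℂ) = arcParam t p := by
    rw [ofComplex_apply_of_im_pos hpos]
  have hd : DifferentiableAt ℝ (u ∘ ofComplex) (arcParam t p) := by
    rw [← hc]; exact hu.differentiableAt _
  have hlin : ∀ r : ℝ, fderiv ℝ (u ∘ ofComplex) (arcParam t p) ((r : ℂ) * I) =
      r * fderiv ℝ (u ∘ ofComplex) (arcParam t p) I := fun r => by
    rw [← Complex.real_smul, map_smul, Complex.real_smul]
  refine ⟨fderiv ℝ (u ∘ ofComplex) (arcParam t p) 1, fderiv ℝ (u ∘ ofComplex) (arcParam t p) I,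
    ?_, hd.comp p (differentiableAt_arcParam t hp), ?_, ?_⟩
  · rw [dTau, hc]
  · have := hd.hasFDerivAt.comp_hasDerivAt p.1 (hasDerivAt_arcParam_fst t hp)
    rwa [map_add, hlin] at this
  · have := hd.hasFDerivAt.comp_hasDerivAt p.2 (hasDerivAt_arcParam_snd t p)
    rwa [hlin] at this

/-- Up to the factor $-i$ the integrand is $u\,d\bar\tau$ along the arc. This form is invariant
under $\tau\mapsto-1/\tau$, which maps the point over $x$ to the point over $-x$ and reverses the
arc, so the integrand is odd. -/
theorem integral_arc_eq_zero (hS : ∀ τ, u (negInv τ) = (starRingEnd ℂ) (τ : ℂ) ^ 2 * u τ) :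
    ∫ x in (-(1 / 2) : ℝ)..1 / 2, -(I + (-x / √(1 - x ^ 2) : ℝ)) *
      u (ofComplex (x + √(1 - x ^ 2) * I)) = 0 := by
  set h : ℝ → ℂ := fun x => -(I + (-x / √(1 - x ^ 2) : ℝ)) * u (ofComplex (x + √(1 - x ^ 2) * I))
    with hh
  have hodd : ∀ x ∈ Set.uIcc (-(1 / 2) : ℝ) (1 / 2), h (-x) = -h x := by
    intro x hx
    rw [Set.uIcc_of_le (by norm_num)] at hx
    have h1 := one_sub_sq_pos hx
    have h2 := Real.sqrt_pos.2 h1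
    have h3 : ((√(1 - x ^ 2) : ℝ) : ℂ) ≠ 0 := by exact_mod_cast h2.ne'
    have hsq : ((√(1 - x ^ 2) : ℝ) : ℂ) ^ 2 = 1 - x ^ 2 := by
      exact_mod_cast Real.sq_sqrt h1.le
    set b : ℝ := √(1 - x ^ 2) with hb
    have hpos : 0 < ((x : ℂ) + b * I).im := by simpa using h2
    set τ : ℍ := ⟨x + b * I, hpos⟩ with hτ
    have hco : (τ : ℂ) = x + b * I := rfl
    have hconj : (starRingEnd ℂ) (τ : ℂ) = x - b * I := by
      rw [hco]; simp [sub_eq_add_neg]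
    have hmul : (τ : ℂ) * (starRingEnd ℂ) (τ : ℂ) = 1 := by
      rw [hconj, hco]
      linear_combination hsq - (b : ℂ) ^ 2 * I_mul_I
    have hneg : (((-x : ℝ) : ℂ) + b * I) = (negInv τ : ℂ) := by
      rw [coe_negInv, eq_div_iff τ.ne_zero]
      rw [hconj] at hmul
      push_cast
      linear_combination -hmul
    simp only [hh, neg_sq, ← hb]
    rw [hneg, ofComplex_apply, hS, hconj, show ofComplex ((x : ℂ) + b * I) = τ from
      ofComplex_apply_of_im_pos hpos]
    rw [hconj, hco] at hmul
    have hw : (b : ℂ) * (b : ℂ)⁻¹ = 1 := mul_inv_cancel₀ h3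
    push_cast
    rw [div_eq_mul_inv, div_eq_mul_inv]
    linear_combination (-(b : ℂ)⁻¹ * (x - b * I) * u τ) * hmul +
      (I * ((x - b * I) ^ 2 * u τ + u τ)) * hw
  have h1 := intervalIntegral.integral_comp_neg (a := -(1 / 2)) (b := 1 / 2) h
  rw [intervalIntegral.integral_congr hodd, intervalIntegral.integral_neg, neg_neg] at h1
  exact self_eq_neg.1 h1.symm

/-- Stokes' theorem for $u\,d\bar\tau$: the vertical sides cancel by periodicity, the arc
contributes nothing by `integral_arc_eq_zero`, and only the top edge survives. -/
theorem integral_dTau_truncatedDomain (hu : RSmooth u) (hT : ∀ τ, u ((1 : ℝ) +ᵥ τ) = u τ)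
    (hS : ∀ τ, u (negInv τ) = (starRingEnd ℂ) (τ : ℂ) ^ 2 * u τ) {t : ℝ} (ht : 1 < t) :
    ∫ z in truncatedDomain t, dTau u (ofComplex z) = -(I / 2) * slice u t := by
  set U : ℝ × ℝ → ℂ := fun p => u (ofComplex (arcParam t p)) with hU
  -- The field $(u,-iu)$ has divergence $2\,\partial u/\partial\tau$. Here $f$ and $g$ are its
  -- components transported to the rectangle, chosen so that their divergence is the original one
  -- times the Jacobian $t-\sqrt{1-x^2}$.
  set f : ℝ × ℝ → ℂ := fun p => U p * (t - √(1 - p.1 ^ 2) : ℝ) with hf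
  set g : ℝ × ℝ → ℂ := fun p => -(I + (-p.1 / √(1 - p.1 ^ 2) * (1 - p.2) : ℝ)) * U p with hg
  have hmaps : Set.MapsTo (arcParam t) arcRect {z | 0 < z.im} := fun p hp => by
    change 0 < (arcParam t p).im
    rw [arcParam_im]
    exact arcHeight_pos ht hp.1 hp.2
  have hUc : ContinuousOn U arcRect :=
    (continuousOn_comp_ofComplex hu.continuous).comp (continuous_arcParam t).continuousOn hmaps
  have hsqrt : ContinuousOn (fun p : ℝ × ℝ => -p.1 / √(1 - p.1 ^ 2)) arcRect :=
    ContinuousOn.div (by fun_prop) (by fun_prop) fun p hp =>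
      (Real.sqrt_pos.2 (one_sub_sq_pos hp.1)).ne'
  have hfc : ContinuousOn f arcRect := hUc.mul (by fun_prop)
  have hgc : ContinuousOn g arcRect := by
    refine ContinuousOn.mul ?_ hUc
    have : ContinuousOn (fun p : ℝ × ℝ => -p.1 / √(1 - p.1 ^ 2) * (1 - p.2)) arcRect :=
      hsqrt.mul (by fun_prop)
    exact (continuousOn_const.add (continuous_ofReal.comp_continuousOn this)).neg
  have hbd : ∀ p ∈ arcRect, DifferentiableAt ℝ (fun p : ℝ × ℝ => √(1 - p.1 ^ 2)) p := fun p hp =>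
    (hasDerivAt_sqrt_one_sub_sq hp.1).differentiableAt.comp p differentiableAt_fst
  have hfd : ∀ p ∈ arcRect, DifferentiableAt ℝ f p := fun p hp => by
    obtain ⟨a, b, -, h1, -, -⟩ := comp_arcParam_deriv hu ht hp
    exact h1.mul (Complex.ofRealCLM.differentiableAt.comp p ((hbd p hp).const_sub t))
  have hgd : ∀ p ∈ arcRect, DifferentiableAt ℝ g p := fun p hp => by
    obtain ⟨a, b, -, h1, -, -⟩ := comp_arcParam_deriv hu ht hp
    have h2 : DifferentiableAt ℝ (fun p : ℝ × ℝ => -p.1 / √(1 - p.1 ^ 2) * (1 - p.2)) p :=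
      ((((hasDerivAt_id p.1).neg.div (hasDerivAt_sqrt_one_sub_sq hp.1) (Real.sqrt_pos.2
        (one_sub_sq_pos hp.1)).ne').differentiableAt).comp p differentiableAt_fst).mul
        (differentiableAt_snd.const_sub 1)
    exact ((Complex.ofRealCLM.differentiableAt.comp p h2).const_add I).neg.mul h1
  have hdiv : ∀ p ∈ arcRect, fderiv ℝ f p (1, 0) + fderiv ℝ g p (0, 1) =
      2 * dTau u (ofComplex (arcParam t p)) * (t - √(1 - p.1 ^ 2) : ℝ) := fun p hp => by
    obtain ⟨a, b, h1, h2, h3, h4⟩ := comp_arcParam_deriv hu ht hp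
    have h5 := h3.mul ((hasDerivAt_sqrt_one_sub_sq hp.1).const_sub t).ofReal_comp
    have h6 : HasDerivAt (fun y : ℝ => -(I + (-p.1 / √(1 - p.1 ^ 2) * (1 - y) : ℝ)))
        (-((-p.1 / √(1 - p.1 ^ 2) * (-1) : ℝ) : ℂ)) p.2 :=
      ((((hasDerivAt_id p.2).const_sub 1).const_mul _).ofReal_comp.const_add I).neg
    rw [fderiv_apply_fst (hfd p hp) h5, fderiv_apply_snd (hgd p hp) (h6.mul h4), h1]
    push_cast
    ring
  have hinner : ∀ x ∈ Set.uIcc (-(1 / 2) : ℝ) (1 / 2),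
      ∫ y in √(1 - x ^ 2)..t, dTau u (ofComplex (x + y * I)) =
        (1 / 2) * ∫ v in (0 : ℝ)..1, (fderiv ℝ f (x, v) (1, 0) + fderiv ℝ g (x, v) (0, 1)) := by
    intro x hx
    rw [Set.uIcc_of_le (by norm_num)] at hx
    have h1 := intervalIntegral.smul_integral_comp_mul_add (a := 0) (b := 1)
      (fun y : ℝ => dTau u (ofComplex (x + y * I))) (t - √(1 - x ^ 2)) √(1 - x ^ 2)
    rw [mul_zero, zero_add, mul_one, sub_add_cancel] at h1
    rw [← h1, Complex.real_smul, ← intervalIntegral.integral_const_mul,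
      ← intervalIntegral.integral_const_mul]
    refine intervalIntegral.integral_congr fun v hv => ?_
    rw [Set.uIcc_of_le zero_le_one] at hv
    rw [hdiv (x, v) ⟨hx, hv⟩, arcParam, arcHeight]
    ring
  have hrect : (Set.uIcc (-(1 / 2) : ℝ) (1 / 2)) ×ˢ (Set.uIcc (0 : ℝ) 1) = arcRect := by
    rw [Set.uIcc_of_le (by norm_num), Set.uIcc_of_le zero_le_one, arcRect]
  have hopen : Set.Ioo (min (-(1 / 2) : ℝ) (1 / 2)) (max (-(1 / 2)) (1 / 2)) ×ˢ
      Set.Ioo (min (0 : ℝ) 1) (max 0 1) \ ∅ ⊆ arcRect := by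
    rw [min_eq_left (by norm_num), max_eq_right (by norm_num), min_eq_left zero_le_one,
      max_eq_right zero_le_one, Set.sdiff_empty, arcRect]
    exact Set.prod_mono Set.Ioo_subset_Icc_self Set.Ioo_subset_Icc_self
  have hcompact : IsCompact arcRect := isCompact_Icc.prod isCompact_Icc
  have hKc : ContinuousOn (fun p : ℝ × ℝ => 2 * dTau u (ofComplex (arcParam t p)) *
      (t - √(1 - p.1 ^ 2) : ℝ)) arcRect := by
    refine ContinuousOn.mul (continuousOn_const.mul ?_) (by fun_prop)
    exact (continuousOn_comp_ofComplex hu.dTau.continuous).comp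
      (continuous_arcParam t).continuousOn hmaps
  have key := integral2_divergence_prod_of_hasFDerivAt_off_countable f g (fderiv ℝ f) (fderiv ℝ g)
    (-(1 / 2)) 0 (1 / 2) 1 ∅ Set.countable_empty (by rw [hrect]; exact hfc) (by rw [hrect]; exact hgc)
    (fun p hp => (hfd p (hopen hp)).hasFDerivAt) (fun p hp => (hgd p (hopen hp)).hasFDerivAt)
    (by
      rw [hrect]
      exact (hKc.integrableOn_compact hcompact).congr_fun (fun p hp => (hdiv p hp).symm)
        hcompact.measurableSet)
  have htop : ∫ x in (-(1 / 2) : ℝ)..1 / 2, g (x, 1) = -I * slice u t := by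
    rw [slice, ← intervalIntegral.integral_const_mul]
    refine intervalIntegral.integral_congr fun x _ => ?_
    simp [hg, hU, arcParam, arcHeight]
  have hbot : ∫ x in (-(1 / 2) : ℝ)..1 / 2, g (x, 0) = 0 := by
    rw [← integral_arc_eq_zero hS]
    refine intervalIntegral.integral_congr fun x _ => ?_
    simp [hg, hU, arcParam, arcHeight]
  have hside : ∫ v in (0 : ℝ)..1, f (1 / 2, v) = ∫ v in (0 : ℝ)..1, f (-(1 / 2), v) := by
    refine intervalIntegral.integral_congr fun v hv => ?_
    rw [Set.uIcc_of_le zero_le_one] at hv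
    have h1 : 0 < (arcParam t (-(1 / 2), v)).im := hmaps (show ((-(1 / 2) : ℝ), v) ∈ arcRect from
      ⟨⟨le_rfl, by norm_num⟩, hv⟩)
    have h2 : arcParam t (1 / 2, v) = (((1 : ℝ) +ᵥ (⟨arcParam t (-(1 / 2), v), h1⟩ : ℍ) : ℍ) : ℂ) := by
      rw [UpperHalfPlane.coe_vadd]
      simp [arcParam, arcHeight]
      ring
    simp only [hf, hU, neg_sq]
    rw [h2, ofComplex_apply, hT, ofComplex_apply_of_im_pos h1]
  rw [integral_truncatedDomain_eq (continuousOn_comp_ofComplex hu.dTau.continuous) ht.le,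
    intervalIntegral.integral_congr hinner, intervalIntegral.integral_const_mul, key, htop, hbot,
    hside]
  ring

end

theorem im_inv_eq (τ : ℍ) : (τ.im : ℂ)⁻¹ = -(4 * Real.pi) * cy τ := by
  rw [cy_eq]
  have h1 : (τ.im : ℂ) ≠ 0 := by exact_mod_cast τ.im_pos.ne'
  have h2 : (Real.pi : ℂ) ≠ 0 := by exact_mod_cast Real.pi_ne_zero
  push_cast
  field_simp

theorem rsmooth_im_inv : RSmooth fun τ => (τ.im : ℂ)⁻¹ := by
  simp only [im_inv_eq]
  exact (RSmooth.const _).mul rsmooth_cy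

/-- Since $y^{-1}$ is a multiple of `cy`, the equation `dTau_cy` says that differentiating past it
is the same as raising in weight $-1$. -/
theorem dTau_im_inv_mul {F : ℍ → ℂ} (hF : RSmooth F) (τ : ℍ) :
    (2 * Real.pi * I)⁻¹ * dTau (fun τ => (τ.im : ℂ)⁻¹ * F τ) τ =
      (τ.im : ℂ)⁻¹ * raise (-1) F τ := by
  rw [dTau_mul rsmooth_im_inv hF, raise_eq]
  have h1 : dTau (fun τ : ℍ => (τ.im : ℂ)⁻¹) τ = -(4 * Real.pi) * dTau cy τ := by
    rw [← dTau_const_mul _ rsmooth_cy, ← funext im_inv_eq]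
  rw [h1, im_inv_eq]
  push_cast
  linear_combination -(4 * Real.pi) * F τ * dTau_cy τ

theorem raise_mul_conj {F θ : ℍ → ℂ} (hF : RSmooth F) (hθ : MDiff θ) (w : ℤ) (τ : ℍ) :
    raise w (fun τ => F τ * (starRingEnd ℂ) (θ τ)) τ = raise w F τ * (starRingEnd ℂ) (θ τ) := by
  rw [raise_eq, raise_eq, dTau_mul hF (RSmooth.of_mdiff hθ).conj, dTau_conj_of_mdiff hθ]
  ring

theorem im_negInv (τ : ℍ) : (((negInv τ).im : ℝ) : ℂ)⁻¹ =
    (τ : ℂ) * (starRingEnd ℂ) (τ : ℂ) * (τ.im : ℂ)⁻¹ := by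
  have h1 : (negInv τ).im = τ.im / Complex.normSq τ := by
    rw [← coe_im, coe_negInv, neg_div, neg_im, one_div, inv_im, coe_im]
    ring
  rw [h1, Complex.mul_conj]
  push_cast
  rw [inv_div, div_eq_mul_inv]

/-! ### The pairing of $g$ with the two families of theta functions -/

section Pairing

variable {U : Submodule ℝ (Matrix (Fin 2) (Fin 2) ℝ)}

theorem discPairing_symm (μ ν : DiscGroup detForm (planeLattice U)) :
    discPairing U μ ν = discPairing U ν μ := by
  rw [discPairing, discPairing, detForm_comm]

theorem discPairing_mul_conj (μ ν : DiscGroup detForm (planeLattice U)) :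
    discPairing U μ ν * (starRingEnd ℂ) (discPairing U μ ν) = 1 := by
  rw [Complex.mul_conj', discPairing, norm_e_neg_ofReal]
  simp

variable [Fintype (DiscGroup detForm (planeLattice U))]

/-- Plancherel's identity on the finite group $N'/N$, from orthogonality of characters. -/
theorem IsRationalPlane.sum_mul_conj (h : IsRationalPlane U)
    (A B : DiscGroup detForm (planeLattice U) → ℂ) :
    ∑ ν, (∑ μ, discPairing U μ ν * A μ) * (starRingEnd ℂ) (∑ κ, discPairing U κ ν * B κ) =
      Fintype.card (DiscGroup detForm (planeLattice U)) * ∑ μ, A μ * (starRingEnd ℂ) (B μ) := by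
  classical
  have h1 : ∀ μ κ ν, discPairing U μ ν * (starRingEnd ℂ) (discPairing U κ ν) =
      discPairing U (μ - κ) ν := fun μ κ ν => by
    rw [discPairing_symm μ, discPairing_symm κ, discPairing_symm (μ - κ)]
    conv_lhs => rw [← sub_add_cancel μ κ, h.discPairing_add, mul_assoc, discPairing_mul_conj, mul_one]
  simp only [map_sum, map_mul, Finset.sum_mul_sum]
  rw [Finset.sum_comm, Finset.mul_sum]
  refine Finset.sum_congr rfl fun μ _ => ?_
  rw [Finset.sum_comm]
  have h2 : ∀ κ, ∑ ν, discPairing U μ ν * A μ *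
      ((starRingEnd ℂ) (discPairing U κ ν) * (starRingEnd ℂ) (B κ)) =
      if κ = μ then Fintype.card (DiscGroup detForm (planeLattice U)) *
        (A μ * (starRingEnd ℂ) (B κ)) else 0 := fun κ => by
    rw [Finset.sum_congr rfl fun ν _ => show _ = discPairing U (μ - κ) ν *
      (A μ * (starRingEnd ℂ) (B κ)) by rw [← h1]; ring, ← Finset.sum_mul, h.sum_discPairing]
    simp only [sub_eq_zero, eq_comm (a := μ)]
    split_ifs <;> simp
  rw [Finset.sum_congr rfl fun κ _ => h2 κ, Finset.sum_ite_eq' Finset.univ μ]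
  simp

/-- `y⁻¹ ∑_ν (R^m g) (R^n ϑ_ν) conj θ_ν`, where `θ_ν` and `ϑ_ν` are the theta functions of a rational
positive plane and of its orthogonal complement. -/
def thetaPairing (U : Submodule ℝ (Matrix (Fin 2) (Fin 2) ℝ))
    [Fintype (DiscGroup detForm (planeLattice U))] (w : ℤ) (g : ℍ → ℂ) (m n : ℕ) (τ : ℍ) : ℂ :=
  ∑ ν, (τ.im : ℂ)⁻¹ * (raiseIter w m g τ * raiseIter 1 n (negTheta U ν) τ *
    (starRingEnd ℂ) (posTheta U ν τ))

namespace IsRationalPlane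

variable {w : ℤ} {g : ℍ → ℂ}

theorem rsmooth_thetaPairing (h : IsRationalPlane U) (hg : MDiff g) (m n : ℕ) :
    RSmooth (thetaPairing U w g m n) :=
  RSmooth.sum _ fun ν _ => rsmooth_im_inv.mul <|
    (((RSmooth.of_mdiff hg).raiseIter w m).mul
      ((RSmooth.of_mdiff (h.mdiff_negTheta ν)).raiseIter 1 n)).mul
      (RSmooth.of_mdiff (h.mdiff_posTheta ν)).conj

theorem hasCuspExpansion_thetaPairing (h : IsRationalPlane U) (hg : IsWeaklyHolomorphicForm w g)
    (m n : ℕ) : HasCuspExpansion (thetaPairing U w g m n) :=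
  HasCuspExpansion.sum _ fun ν _ =>
    hasCuspExpansion_raise hg.holo (h.mdiff_negTheta ν) (h.mdiff_posTheta ν) hg.vadd
      (h.negTheta_vadd ν) (h.posTheta_vadd ν) hg.mero
      (.of_isBounded (h.negTheta_isBoundedAtImInfty ν)) (h.posTheta_isBoundedAtImInfty ν) w 1 m n

theorem thetaPairing_vadd (h : IsRationalPlane U) (hg : IsWeaklyHolomorphicForm w g) (m n : ℕ)
    (τ : ℍ) : thetaPairing U w g m n ((1 : ℝ) +ᵥ τ) = thetaPairing U w g m n τ := by
  refine Finset.sum_congr rfl fun ν _ => ?_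
  have h1 : e (discNorm U ν) * (starRingEnd ℂ) (e (discNorm U ν)) = 1 := by
    rw [conj_e, ← e_add, Complex.conj_ofReal, add_neg_cancel, e_zero]
  rw [UpperHalfPlane.vadd_im, raiseIter_vadd (RSmooth.of_mdiff hg.holo) (c := 1)
    fun τ => by rw [hg.vadd, one_mul], raiseIter_vadd (RSmooth.of_mdiff (h.mdiff_negTheta ν))
    (h.negTheta_vadd ν), h.posTheta_vadd, map_mul]
  linear_combination (τ.im : ℂ)⁻¹ * raiseIter w m g τ * raiseIter 1 n (negTheta U ν) τ *
    (starRingEnd ℂ) (posTheta U ν τ) * h1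

theorem raiseIter_negTheta_negInv (h : IsRationalPlane U)
    (ν : DiscGroup detForm (planeLattice U)) (n : ℕ) (τ : ℍ) :
    raiseIter 1 n (negTheta U ν) (negInv τ) = (τ : ℂ) ^ (1 + 2 * (n : ℤ)) *
      (-I * ((Fintype.card (DiscGroup detForm (planeLattice U)) : ℝ) ^ (-(1 / 2) : ℝ) : ℝ) *
        ∑ μ, discPairing U μ ν * raiseIter 1 n (negTheta U μ) τ) := by
  have hs : ∀ μ, RSmooth (negTheta U μ) := fun μ => RSmooth.of_mdiff (h.mdiff_negTheta μ)
  rw [raiseIter_negInv (w := 1) (G := fun τ => ∑ μ, (-I * ((Fintype.card (DiscGroup detForm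
    (planeLattice U)) : ℝ) ^ (-(1 / 2) : ℝ) : ℝ) * discPairing U μ ν) * negTheta U μ τ) (hs ν)
    (RSmooth.sum _ fun μ _ => (RSmooth.const _).mul (hs μ)) fun τ => by
      rw [h.negTheta_negInv, zpow_one, Finset.mul_sum, Finset.mul_sum]
      exact Finset.sum_congr rfl fun _ _ => by ring, raiseIter_sum _ _ fun μ _ => hs μ]
  simp only [Finset.mul_sum, mul_assoc]

/-- The holomorphic weights $w+2m$ and $1+2n$ add up to $-1$ by the weight condition; $y^{-1}$
supplies $\tau\bar\tau$ and $\overline{\theta_\nu}$ supplies $\bar\tau$. The constants cancel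
because $|{-i}|=1$ and the Fourier transform, normalized by $|N'/N|^{-1/2}$, is unitary. -/
theorem thetaPairing_negInv (h : IsRationalPlane U) (hg : IsWeaklyHolomorphicForm w g) {m n : ℕ}
    (hw : w + 2 * m + 2 * n + 2 = 0) (τ : ℍ) :
    thetaPairing U w g m n (negInv τ) = (starRingEnd ℂ) (τ : ℂ) ^ 2 * thetaPairing U w g m n τ := by
  have hτ := τ.ne_zero
  set C : ℝ := (Fintype.card (DiscGroup detForm (planeLattice U)) : ℝ) ^ (-(1 / 2) : ℝ) with hC
  have hcard : (0 : ℝ) < Fintype.card (DiscGroup detForm (planeLattice U)) := by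
    exact_mod_cast Fintype.card_pos
  have hCC : (C : ℂ) * C * (Fintype.card (DiscGroup detForm (planeLattice U)) : ℂ) = 1 := by
    have : C * C * (Fintype.card (DiscGroup detForm (planeLattice U)) : ℝ) = 1 := by
      rw [hC, ← Real.rpow_add hcard, show (-(1 / 2) + -(1 / 2) : ℝ) = -1 by norm_num,
        Real.rpow_neg_one, inv_mul_cancel₀ hcard.ne']
    exact_mod_cast this
  have hpow : (τ : ℂ) ^ (w + 2 * m) * (τ : ℂ) ^ (1 + 2 * (n : ℤ)) * τ = 1 := by
    rw [← zpow_add₀ hτ, ← zpow_add_one₀ hτ,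
      show w + 2 * m + (1 + 2 * (n : ℤ)) + 1 = 0 by linarith, zpow_zero]
  have hI : (starRingEnd ℂ) (-I) * -I = 1 := by simp
  simp only [thetaPairing, ← Finset.mul_sum, mul_assoc]
  have key := h.sum_mul_conj (fun μ => raiseIter 1 n (negTheta U μ) τ) fun μ => posTheta U μ τ
  have hterm : ∀ ν, raiseIter 1 n (negTheta U ν) (negInv τ) *
      (starRingEnd ℂ) (posTheta U ν (negInv τ)) =
      ((τ : ℂ) ^ (1 + 2 * (n : ℤ)) * (starRingEnd ℂ) (τ : ℂ) * (C * C)) *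
      ((∑ μ, discPairing U μ ν * raiseIter 1 n (negTheta U μ) τ) *
        (starRingEnd ℂ) (∑ μ, discPairing U μ ν * posTheta U μ τ)) := fun ν => by
    rw [h.raiseIter_negTheta_negInv, h.posTheta_negInv, ← hC, map_mul, map_mul, map_mul,
      Complex.conj_ofReal]
    linear_combination (τ : ℂ) ^ (1 + 2 * (n : ℤ)) * (starRingEnd ℂ) (τ : ℂ) * (C * C) *
      ((∑ μ, discPairing U μ ν * raiseIter 1 n (negTheta U μ) τ) *
        (starRingEnd ℂ) (∑ μ, discPairing U μ ν * posTheta U μ τ)) * hI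
  rw [Finset.sum_congr rfl fun ν _ => hterm ν, ← Finset.mul_sum, key, im_negInv,
    raiseIter_negInv (RSmooth.of_mdiff hg.holo) (RSmooth.of_mdiff hg.holo) hg.negInv]
  set S := ∑ μ, raiseIter 1 n (negTheta U μ) τ * (starRingEnd ℂ) (posTheta U μ τ)
  linear_combination (starRingEnd ℂ) (τ : ℂ) ^ 2 * (τ.im : ℂ)⁻¹ * raiseIter w m g τ * S *
    (C * C * (Fintype.card (DiscGroup detForm (planeLattice U)) : ℂ) * hpow + hCC)

/-- The total weight is $-1$, precisely the weight in which $y^{-1}$ absorbs the correction term.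
The Leibniz rule then raises $g$ and $\vartheta_\nu$ in turn, and $\overline{\theta_\nu}$ is inert.
-/
theorem dTau_thetaPairing (h : IsRationalPlane U) (hg : MDiff g) {m n : ℕ}
    (hw : w + 2 * m + 2 * n + 2 = 0) (τ : ℍ) :
    (2 * Real.pi * I)⁻¹ * dTau (thetaPairing U w g m n) τ =
      thetaPairing U w g (m + 1) n τ + thetaPairing U w g m (n + 1) τ := by
  have hg' := (RSmooth.of_mdiff hg).raiseIter w m
  have hn := fun ν => (RSmooth.of_mdiff (h.mdiff_negTheta ν)).raiseIter 1 n
  have hp := fun ν => (RSmooth.of_mdiff (h.mdiff_posTheta ν)).conj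
  have h1 : dTau (thetaPairing U w g m n) τ = _ := dTau_sum Finset.univ
    (fun ν _ => rsmooth_im_inv.mul ((hg'.mul (hn ν)).mul (hp ν))) τ
  rw [h1, Finset.mul_sum, thetaPairing, thetaPairing, ← Finset.sum_add_distrib]
  refine Finset.sum_congr rfl fun ν _ => ?_
  rw [dTau_im_inv_mul ((hg'.mul (hn ν)).mul (hp ν)),
    raise_mul_conj (hg'.mul (hn ν)) (h.mdiff_posTheta ν),
    show (-1 : ℤ) = (w + 2 * m) + (1 + 2 * n) by linarith, raise_mul hg' (hn ν), raiseIter, raiseIter]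
  ring

/-- The integrand is exact, so its integral over $F_t$ is a multiple of the mean of the primitive at
height $t$, which tends to zero. -/
theorem hasRegIntegral_thetaPairing_add (h : IsRationalPlane U) (hg : IsWeaklyHolomorphicForm w g)
    {m n : ℕ} (hw : w + 2 * m + 2 * n + 2 = 0) :
    HasRegIntegral (fun τ => thetaPairing U w g (m + 1) n τ + thetaPairing U w g m (n + 1) τ) 0 := by
  refine ((h.hasCuspExpansion_thetaPairing hg (m + 1) n).add
    (h.hasCuspExpansion_thetaPairing hg m (n + 1))).hasRegIntegral_zero ?_
  have h1 := ((h.hasCuspExpansion_thetaPairing hg m n).tendsto_slice.const_mul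
    (-(I / 2))).const_mul (2 * Real.pi * I : ℂ)⁻¹
  rw [mul_zero, mul_zero] at h1
  refine h1.congr' ?_
  filter_upwards [eventually_gt_atTop 1] with t ht
  rw [← integral_dTau_truncatedDomain (h.rsmooth_thetaPairing hg.holo m n)
    (h.thetaPairing_vadd hg m n) (h.thetaPairing_negInv hg hw) ht, ← integral_const_mul]
  simp only [h.dTau_thetaPairing hg.holo hw]

/-- By `exists_bracketSum_eq` the bracket differs from its leading term by exact pieces, each with
regularized integral zero. The coefficients do not depend on $\nu$, so the sum over $\nu$ can be
taken inside. -/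
theorem hasRegIntegral_bracket (h : IsRationalPlane U) {r : ℕ}
    (hg : IsWeaklyHolomorphicForm (-2 * r) g) {c : ℂ}
    (hc : HasRegIntegral (thetaPairing U (-2 * r) g r 0) c) :
    HasRegIntegral (fun τ => ∑ ν, (τ.im : ℂ)⁻¹ * ((-1) ^ r *
      rankinCohen (-2 * r) 1 r g (negTheta U ν) τ * (starRingEnd ℂ) (posTheta U ν τ))) c := by
  obtain ⟨b, hb⟩ := exists_bracketSum_eq r
  have h1 := hasRegIntegral_sum_zero (Finset.range r) b (F := fun i τ =>
    thetaPairing U (-2 * r) g (r - i) i τ + thetaPairing U (-2 * r) g (r - (i + 1)) (i + 1) τ)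
    (fun i hi => by
      have hi' := Finset.mem_range.1 hi
      have := h.hasRegIntegral_thetaPairing_add hg (m := r - (i + 1)) (n := i)
        (by push_cast [Nat.cast_sub (Nat.succ_le_of_lt hi')]; ring)
      rwa [show r - (i + 1) + 1 = r - i by omega] at this) hc
  refine (congrArg (HasRegIntegral · c) (funext fun τ => ?_)).mp h1
  simp only [rankinCohen_eq_raise _ _ r hg.holo (h.mdiff_negTheta _), hb, thetaPairing]
  simp only [← Finset.sum_add_distrib, Finset.mul_sum]
  rw [Finset.sum_comm, ← Finset.sum_add_distrib]
  refine Finset.sum_congr rfl fun ν _ => ?_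
  rw [add_mul, mul_add, Finset.sum_mul, Finset.mul_sum]
  congr 1
  exact Finset.sum_congr rfl fun i _ => by ring

end IsRationalPlane

end Pairing

/-! ### Comparison of the two theta lifts -/

variable {v : PosPlane detForm}

/-- For $b^-=2$ the weight factor is $y^{-2}$; the factor $y$ in the split Siegel theta function
leaves $y^{-1}$, as in the integrand for $N$. -/
theorem IsRationalPlane.thetaIntegrand_matLattice (h : IsRationalPlane v.carrier)
    [Fintype (DiscGroup detForm (planeLattice v.carrier))] (w : ℤ) (g : ℍ → ℂ) (r : ℕ) :
    thetaIntegrand detForm_isSymm matLattice v (scalarVector (raiseIter w r g)) =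
      thetaPairing v.carrier w g r 0 := by
  funext τ
  have hτ : (τ.im : ℂ) ≠ 0 := by exact_mod_cast τ.im_pos.ne'
  rw [thetaIntegrand, finsum_eq_single _ 0 fun ν hν => (hν (discGroup_matLattice_eq_zero ν)).elim,
    conj_siegelTheta_matLattice h, negRank_matLattice,
    show (-1 - 2 / 2 : ℝ) = ((-2 : ℤ) : ℝ) by norm_num, Real.rpow_intCast, scalarVector,
    thetaPairing, Finset.mul_sum, Finset.mul_sum, Finset.sum_mul]
  refine Finset.sum_congr rfl fun ν _ => ?_
  rw [raiseIter]
  push_cast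
  rw [zpow_neg]
  field_simp

theorem IsRationalPlane.thetaIntegrand_planeLattice (h : IsRationalPlane v.carrier)
    [Fintype (DiscGroup detForm (planeLattice v.carrier))]
    (f : DiscGroup detForm (planeLattice v.carrier) → ℍ → ℂ) :
    thetaIntegrand detForm_isSymm (planeLattice v.carrier) v f = fun τ : ℍ =>
      ∑ ν, (τ.im : ℂ)⁻¹ * (f ν τ * (starRingEnd ℂ) (posTheta v.carrier ν τ)) := by
  funext τ
  rw [thetaIntegrand, finsum_eq_sum_of_fintype, negRank_planeLattice h,
    show (-1 - 0 / 2 : ℝ) = -1 by norm_num, Real.rpow_neg_one, Finset.sum_mul]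
  refine Finset.sum_congr rfl fun ν _ => ?_
  rw [siegelTheta_planeLattice h]
  push_cast
  ring

theorem IsRationalPlane.exists_hasRegIntegral (h : IsRationalPlane v.carrier) {r : ℕ} {g : ℍ → ℂ}
    (hg : IsWeaklyHolomorphicForm (-2 * r) g) : ∃ c,
    HasRegIntegral (thetaIntegrand detForm_isSymm matLattice v
      (scalarVector (raiseIter (-2 * r) r g))) c ∧
    HasRegIntegral (thetaIntegrand detForm_isSymm (planeLattice v.carrier) v fun ν τ =>
      (-1) ^ r * rankinCohen (-2 * r) 1 r g (negTheta v.carrier ν) τ) c := by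
  have hfin := h.finite_discGroup
  have := Fintype.ofFinite (DiscGroup detForm (planeLattice v.carrier))
  obtain ⟨c, hc⟩ := (h.hasCuspExpansion_thetaPairing hg r 0).regIntegrable
  refine ⟨c, ?_, ?_⟩
  · rwa [h.thetaIntegrand_matLattice]
  · rw [h.thetaIntegrand_planeLattice]
    exact h.hasRegIntegral_bracket hg hc

theorem bracketForm_eq (r : ℕ) (g : ℍ → ℂ) (τ₁ τ₂ : ℍ) :
    bracketForm (r + 1) g τ₁ τ₂ = fun ν τ => (-1) ^ r *
      rankinCohen (-2 * r) 1 r g (negTheta (vPlus τ₁ τ₂).carrier ν) τ := by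
  funext ν τ
  have h1 : complTheta detForm matLattice (latticeN τ₁ τ₂) (latticeM τ₁ τ₂) ν =
    negTheta (vPlus τ₁ τ₂).carrier ν := complTheta_eq _ ν
  rw [bracketForm, h1, Nat.add_sub_cancel,
    show (2 - 2 * ((r + 1 : ℕ) : ℤ)) = -2 * r by push_cast; ring]

end CMGreen

end

theorem mainTheorem3 (k : ℕ) (hk : 1 < k) (lam : ℕ+ →₀ ℤ) (hlam : CMGreen.IsRelation k lam)
    (g : UpperHalfPlane → ℂ) (hg : CMGreen.IsAssociatedForm k lam g)
    (K : IntermediateField ℚ ℂ) (hK : Module.finrank ℚ K = 2)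
    (τ₁ τ₂ : UpperHalfPlane) (hτ₁ : (τ₁ : ℂ) ∈ K) (hτ₂ : (τ₂ : ℂ) ∈ K)
    (hS : (τ₁, τ₂) ∉ CMGreen.singularLocus lam) :
    Submodule.span ℝ (CMGreen.latticeN τ₁ τ₂ : Set (Matrix (Fin 2) (Fin 2) ℝ)) =
      (CMGreen.vPlus τ₁ τ₂).carrier ∧
    CMGreen.IsWeaklyHolomorphicVector CMGreen.detForm (CMGreen.latticeN τ₁ τ₂) 1
      (CMGreen.bracketForm k g τ₁ τ₂) ∧
    CMGreen.ThetaLiftDefined CMGreen.detForm_isSymm CMGreen.matLattice (CMGreen.vPlus τ₁ τ₂)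
      (CMGreen.scalarVector (CMGreen.raiseIter (2 - 2 * (k : ℤ)) (k - 1) g)) ∧
    CMGreen.ThetaLiftDefined CMGreen.detForm_isSymm (CMGreen.latticeN τ₁ τ₂)
      (CMGreen.vPlus τ₁ τ₂) (CMGreen.bracketForm k g τ₁ τ₂) ∧
    CMGreen.thetaLift CMGreen.detForm_isSymm CMGreen.matLattice (CMGreen.vPlus τ₁ τ₂)
        (CMGreen.scalarVector (CMGreen.raiseIter (2 - 2 * (k : ℤ)) (k - 1) g)) =
      CMGreen.thetaLift CMGreen.detForm_isSymm (CMGreen.latticeN τ₁ τ₂) (CMGreen.vPlus τ₁ τ₂)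
        (CMGreen.bracketForm k g τ₁ τ₂) := by
  have h := CMGreen.isRationalPlane_vPlus hK hτ₁ hτ₂
  -- With $r=k-1$ the weight $2-2k$ is $-2r$, the weight in which the bracket of order $r$ has the
  -- required normalization.
  obtain ⟨r, rfl⟩ : ∃ r, k = r + 1 := ⟨k - 1, by omega⟩
  have hw : (2 - 2 * ((r + 1 : ℕ) : ℤ)) = -2 * r := by push_cast; ring
  have hg' := hg.form
  rw [hw] at hg' ⊢
  rw [Nat.add_sub_cancel, CMGreen.bracketForm_eq]
  obtain ⟨c, h1, h2⟩ := h.exists_hasRegIntegral hg'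
  exact ⟨h.span_eq, h.isWeaklyHolomorphicVector hg' _, ⟨c, h1⟩, ⟨c, h2⟩,
    h1.regIntegral_eq.trans h2.regIntegral_eq.symm⟩
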